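/- Let $m,n\ge 1$ be integers and $d=m+n$. Let $$X_{m,n}=\operatorname{Spec}\mathbb C[x,y,u,v]/(x^m v-y^n u-1)$$ with the action of $\mathbb G_m$ given by $\lambda\cdot(x,y,u,v)=(\lambda x,\lambda y,\lambda^{-n}u,\lambda^{-m}v)$. Let $\mathcal O_{\mathbb P^1}(-d)$ denote the line bundle whose total space is glued from two copies of $\mathbb A^2=\operatorname{Spec}\mathbb C[u][T]$, one over each standard chart of $\mathbb P^1$, along $u\ne 0$ by $(u,T)\mapsto(u^{-1},u^dT)$, and let $S_{d,m}$ be the complex surface glued in the same way by $(u,T)\mapsto(u^{-1},u^dT+u^m)$. Then: 1. $S_{d,m}$ is affine; it has a projection $\rho:S_{d,m}\to\mathbb P^1$, equal to $(u,T)\mapsto u$ in the two charts, which is a Zariski locally trivial torsor under $\mathcal O_{\mathbb P^1}(-d)$ acting by fibrewise translation in the two charts; and $S_{d,m}$ is the quotient $X_{m,n}/\mathbb G_m$: there is a morphism of complex schemes $q:X_{m,n}\to S_{d,m}$ which is a geometric quotient for the $\mathbb G_m$-action and a Zariski locally trivial principal $\mathbb G_m$-bundle. 2. $\operatorname{Pic}(S_{d,m})\cong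 H^1(S_{d,m},\mathcal O_{S_{d,m}}^*)\cong\mathbb Z$, and the class of the $\mathbb G_m$-bundle $q:X_{m,n}\to S_{d,m}$ (that is, the class of the associated line bundle, whose global sections are the functions $f$ on $X_{m,n}$ with $f(\lambda\cdot p)=\lambda f(p)$) generates $\operatorname{Pic}(S_{d,m})$. -/

import Mathlib

open CategoryTheory Limits AlgebraicGeometry MonoidalCategory CartesianMonoidalCategory
open scoped LaurentPolynomial MonObj

noncomputable section

namespace FactorialThreefold

/-! ## The threefold `X_{m,n}` and its `𝔾ₘ`-action -/

/-- The equation `x ^ m * v - y ^ n * u - 1`; the variables `0, 1, 2, 3` are `x, y, u, v`. -/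
def threefoldEq (m n : ℕ) : MvPolynomial (Fin 4) ℂ :=
  MvPolynomial.X 0 ^ m * MvPolynomial.X 3 - MvPolynomial.X 1 ^ n * MvPolynomial.X 2 - 1

/-- The coordinate ring `ℂ[x, y, u, v] / (x ^ m * v - y ^ n * u - 1)`. -/
abbrev ThreefoldRing (m n : ℕ) : Type :=
  MvPolynomial (Fin 4) ℂ ⧸ Ideal.span {threefoldEq m n}

/-- The affine threefold `X_{m,n} ⊆ 𝔸⁴` with equation `x ^ m * v - y ^ n * u = 1`. -/
def Threefold (m n : ℕ) : Scheme.{0} := Spec (.of (ThreefoldRing m n))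

/-- The structure morphism of `X_{m,n}`. -/
def Threefold.toSpec (m n : ℕ) : Threefold m n ⟶ Spec (.of ℂ) :=
  Spec.map (CommRingCat.ofHom (algebraMap ℂ (ThreefoldRing m n)))

/-- The image of the coordinate function number `i` in the coordinate ring of `X_{m,n}`. -/
def coord (m n : ℕ) (i : Fin 4) : ThreefoldRing m n := Ideal.Quotient.mk _ (MvPolynomial.X i)

/-- The weights `1, 1, -n, -m` of the coordinates `x, y, u, v`. -/
def weight (m n : ℕ) : Fin 4 → ℤ := ![1, 1, -n, -m]

/-- The substitution `(x, y, u, v) ↦ (λ x, λ y, λ⁻ⁿ u, λ⁻ᵐ v)` on polynomials, with values in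
`ℂ[X_{m,n}][λ, λ⁻¹]`. -/
def coactPoly (m n : ℕ) : MvPolynomial (Fin 4) ℂ →ₐ[ℂ] (ThreefoldRing m n)[T;T⁻¹] :=
  MvPolynomial.aeval fun i ↦
    LaurentPolynomial.T (weight m n i) * LaurentPolynomial.C (coord m n i)

lemma coactPoly_eq (m n : ℕ) : coactPoly m n (threefoldEq m n) = 0 := by
  have h : coord m n 0 ^ m * coord m n 3 - coord m n 1 ^ n * coord m n 2 - 1 = 0 :=
    Ideal.Quotient.eq_zero_iff_mem.mpr (Ideal.mem_span_singleton_self (threefoldEq m n))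
  have h' := congrArg (LaurentPolynomial.C (R := ThreefoldRing m n)) h
  simp only [map_sub, map_mul, map_pow, map_one, map_zero] at h'
  have hm : (LaurentPolynomial.T 1 : (ThreefoldRing m n)[T;T⁻¹]) ^ m *
      LaurentPolynomial.T (-m) = 1 := by
    rw [LaurentPolynomial.T_pow, ← LaurentPolynomial.T_add]; simp
  have hn : (LaurentPolynomial.T 1 : (ThreefoldRing m n)[T;T⁻¹]) ^ n *
      LaurentPolynomial.T (-n) = 1 := by
    rw [LaurentPolynomial.T_pow, ← LaurentPolynomial.T_add]; simp
  simp only [coactPoly, threefoldEq, map_sub, map_mul, map_pow, map_one, MvPolynomial.aeval_X,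
    weight, Matrix.cons_val]
  linear_combination h' + (LaurentPolynomial.C (coord m n 0) ^ m *
    LaurentPolynomial.C (coord m n 3)) * hm - (LaurentPolynomial.C (coord m n 1) ^ n *
    LaurentPolynomial.C (coord m n 2)) * hn

/-- The comorphism `ℂ[X_{m,n}] → ℂ[X_{m,n}][λ, λ⁻¹]` of the `𝔾ₘ`-action. -/
def coact (m n : ℕ) : ThreefoldRing m n →+* (ThreefoldRing m n)[T;T⁻¹] :=
  Ideal.Quotient.lift _ (coactPoly m n).toRingHom fun a ha ↦ by
    obtain ⟨b, rfl⟩ := Ideal.mem_span_singleton'.mp ha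
    simp [coactPoly_eq]

/-- The product `𝔾ₘ × X_{m,n} = Spec ℂ[X_{m,n}][λ, λ⁻¹]`. -/
def GmThreefold (m n : ℕ) : Scheme.{0} := Spec (.of (ThreefoldRing m n)[T;T⁻¹])

/-- The action morphism `𝔾ₘ × X_{m,n} → X_{m,n}`,
`(λ, (x, y, u, v)) ↦ (λ x, λ y, λ⁻ⁿ u, λ⁻ᵐ v)`. -/
def act (m n : ℕ) : GmThreefold m n ⟶ Threefold m n :=
  Spec.map (CommRingCat.ofHom (coact m n))

/-- The second projection `𝔾ₘ × X_{m,n} → X_{m,n}`. -/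
def proj (m n : ℕ) : GmThreefold m n ⟶ Threefold m n :=
  Spec.map (CommRingCat.ofHom LaurentPolynomial.C)

/-- The function `λ` on `𝔾ₘ × X_{m,n}`. -/
def scaling (m n : ℕ) : Γ(GmThreefold m n, ⊤) :=
  (Scheme.ΓSpecIso (.of (ThreefoldRing m n)[T;T⁻¹])).inv (LaurentPolynomial.T 1)

/-! ## Quotients and principal bundles -/

/-- `q : X ⟶ S` is a geometric quotient of `X` by the action of a group `G` with action morphism
`a : G × X ⟶ X`, where `p : G × X ⟶ X` is the projection and `R` is `G × X`. -/
structure IsGeometricQuotient {R X S : Scheme.{0}} (a p : R ⟶ X) (q : X ⟶ S) : Prop where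
  /-- `q` is invariant. -/
  w : a ≫ q = p ≫ q
  surjective : Function.Surjective q
  /-- The geometric fibres of `q` are the orbits. -/
  orbits : Surjective (pullback.lift a p w)
  /-- `S` carries the quotient topology. -/
  isQuotientMap : Topology.IsQuotientMap q
  /-- The functions on an open subset of `S` are the invariant functions on its preimage. -/
  injective : ∀ U : S.Opens, Function.Injective (q.app U)
  invariants : ∀ (U : S.Opens) (f : Γ(X, q ⁻¹ᵁ U)),
    (∃ g : Γ(S, U), q.app U g = f) ↔
      ∀ (W : R.Opens) (ha : W ≤ a ⁻¹ᵁ (q ⁻¹ᵁ U)) (hp : W ≤ p ⁻¹ᵁ (q ⁻¹ᵁ U)),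
        a.appLE (q ⁻¹ᵁ U) W ha f = p.appLE (q ⁻¹ᵁ U) W hp f

/-- `q : X ⟶ S` is a principal bundle (torsor), locally trivial in the Zariski topology, for the
action morphism `a : R ⟶ X` of a group; here `R` is the product of the group and `X` (over `S`
if the group lives over `S`), and `p : R ⟶ X` is the projection: the group acts simply transitively
on `X` over `S`, and `q` has sections locally on `S`. -/
structure IsPrincipalBundle {R X S : Scheme.{0}} (a p : R ⟶ X) (q : X ⟶ S) : Prop where
  isPullback : IsPullback a p q q
  exists_section : ∀ s : S, ∃ U : S.Opens, s ∈ U ∧ ∃ σ : U.toScheme ⟶ X, σ ≫ q = U.ι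

/-! ## The projective line -/

instance : GradedAlgebra (MvPolynomial.homogeneousSubmodule (Fin 2) ℂ) :=
  MvPolynomial.gradedAlgebra

/-- The projective line `Proj ℂ[x, y]`. -/
def ProjLine : Scheme.{0} := Proj (MvPolynomial.homogeneousSubmodule (Fin 2) ℂ)

/-- Dehomogenization: `ℂ[x, y]_(x) → ℂ[u]`, `y / x ↦ u` for `i = 0`, and `ℂ[x, y]_(y) → ℂ[u]`,
`x / y ↦ u` for `i = 1`. -/
def dehomogenize (i : Fin 2) :
    HomogeneousLocalization.Away (MvPolynomial.homogeneousSubmodule (Fin 2) ℂ)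
      (MvPolynomial.X i) →+* Polynomial ℂ :=
  (IsLocalization.Away.lift (S := Localization.Away (MvPolynomial.X i : MvPolynomial (Fin 2) ℂ))
    (MvPolynomial.X i)
    (g := (MvPolynomial.aeval (R := ℂ)
      fun k : Fin 2 ↦ if k = i then (1 : Polynomial ℂ) else Polynomial.X).toRingHom)
    (by simp)).comp (algebraMap _ _)

/-- The two standard charts `𝔸¹ = Spec ℂ[u] ⟶ ℙ¹`: `u ↦ [1 : u]` for `i = 0`, `u ↦ [u : 1]` for
`i = 1`. -/
def lineChart (i : Fin 2) : Spec (.of (Polynomial ℂ)) ⟶ ProjLine :=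
  Spec.map (CommRingCat.ofHom (dehomogenize i)) ≫
    Proj.awayι (MvPolynomial.homogeneousSubmodule (Fin 2) ℂ) (MvPolynomial.X i)
      (MvPolynomial.isHomogeneous_X ℂ i) one_pos

/-! ## Affine line bundles over `ℙ¹` given by a transition isomorphism -/

/-- The coordinate ring of the affine plane with coordinates `u` (`= C X`) and `T` (`= X`). -/
abbrev PlaneRing : Type := Polynomial (Polynomial ℂ)

/-- The ring `ℂ[u, u⁻¹][T]`. -/
abbrev OverlapRing : Type := Polynomial ℂ[T;T⁻¹]

/-- The inclusion `ℂ[u][T] → ℂ[u, u⁻¹][T]`. -/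
def incl : PlaneRing →+* OverlapRing :=
  Polynomial.mapRingHom (Polynomial.toLaurent (R := ℂ))

/-- The ring map `ℂ[u][T] → ℂ[u, u⁻¹][T]`, `u ↦ u⁻¹`, `T ↦ u ^ d * T + c`, expressing the
coordinates of the second chart in those of the first. -/
def trans (d : ℕ) (c : ℂ[T;T⁻¹]) : PlaneRing →+* OverlapRing :=
  Polynomial.eval₂RingHom
    (Polynomial.C.comp
      (Polynomial.aeval (R := ℂ) (LaurentPolynomial.T (-1) : ℂ[T;T⁻¹])).toRingHom)
    (Polynomial.C (LaurentPolynomial.T d) * Polynomial.X + Polynomial.C c)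

/-- The automorphism `u ↦ u⁻¹`, `T ↦ u ^ d * T + c` of `ℂ[u, u⁻¹][T]`, as a ring map. -/
def overlapHom (d : ℤ) (c : ℂ[T;T⁻¹]) : OverlapRing →+* OverlapRing :=
  Polynomial.eval₂RingHom
    (Polynomial.C.comp (LaurentPolynomial.invert (R := ℂ)).toRingHom)
    (Polynomial.C (LaurentPolynomial.T d) * Polynomial.X + Polynomial.C c)

lemma overlapHom_comp_overlapHom (d : ℤ) (c : ℂ[T;T⁻¹]) :
    (overlapHom d c).comp
      (overlapHom d (- LaurentPolynomial.T d * LaurentPolynomial.invert c)) = RingHom.id _ := by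
  refine Polynomial.ringHom_ext (fun a ↦ ?_) ?_
  · simp [overlapHom, LaurentPolynomial.involutive_invert a]
  · simp only [overlapHom, RingHom.comp_apply, Polynomial.coe_eval₂RingHom, Polynomial.eval₂_X,
      RingHom.id_apply, map_mul, map_neg, map_add]
    simp [LaurentPolynomial.involutive_invert c]
    rw [mul_add, ← mul_assoc, ← map_mul, ← LaurentPolynomial.T_add]
    simp only [neg_add_cancel, LaurentPolynomial.T_zero, map_one]
    ring

lemma overlapHom_bijective (d : ℤ) (c : ℂ[T;T⁻¹]) : Function.Bijective (overlapHom d c) := by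
  have key (c : ℂ[T;T⁻¹]) := overlapHom_comp_overlapHom d c
  have hc : - LaurentPolynomial.T d * LaurentPolynomial.invert
      (- LaurentPolynomial.T d * LaurentPolynomial.invert c) = c := by
    rw [map_mul, map_neg, LaurentPolynomial.invert_T, LaurentPolynomial.involutive_invert c,
      ← mul_assoc, neg_mul_neg, ← LaurentPolynomial.T_add]
    simp
  have h₁ := key c
  have h₂ := key (- LaurentPolynomial.T d * LaurentPolynomial.invert c)
  rw [hc] at h₂
  exact ⟨Function.LeftInverse.injective fun x ↦ DFunLike.congr_fun h₂ x,
    Function.RightInverse.surjective fun x ↦ DFunLike.congr_fun h₁ x⟩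

lemma overlapHom_comp_incl (d : ℕ) (c : ℂ[T;T⁻¹]) :
    (overlapHom d c).comp incl = trans d c := by
  refine Polynomial.ringHom_ext (fun a ↦ ?_) ?_
  · simp only [overlapHom, incl, trans, RingHom.comp_apply, Polynomial.coe_eval₂RingHom,
      Polynomial.eval₂_C, Polynomial.coe_mapRingHom, Polynomial.map_C]
    congr 1
    induction a using Polynomial.induction_on' with
    | add p q hp hq => simp only [map_add, hp, hq]
    | monomial k r => simp [← Polynomial.C_mul_X_pow_eq_monomial]
  · simp [overlapHom, incl, trans]

instance isOpenImmersion_incl : IsOpenImmersion (Spec.map (CommRingCat.ofHom incl)) := by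
  let : Algebra PlaneRing OverlapRing := incl.toAlgebra
  have : IsLocalization.Away (Polynomial.C Polynomial.X : PlaneRing) OverlapRing := by
    have := Polynomial.isLocalization (Submonoid.powers (Polynomial.X : Polynomial ℂ)) ℂ[T;T⁻¹]
    rw [Submonoid.map_powers] at this
    exact this
  exact IsOpenImmersion.of_isLocalization (Polynomial.C Polynomial.X : PlaneRing)

instance isOpenImmersion_trans (d : ℕ) (c : ℂ[T;T⁻¹]) :
    IsOpenImmersion (Spec.map (CommRingCat.ofHom (trans d c))) := by
  have : IsIso (CommRingCat.ofHom (overlapHom d c)) :=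
    (ConcreteCategory.isIso_iff_bijective _).mpr (overlapHom_bijective d c)
  rw [← overlapHom_comp_incl, CommRingCat.ofHom_comp, Spec.map_comp]
  infer_instance

instance isOpenImmersion_span {X Y Z : Scheme.{0}} (f : X ⟶ Y) (g : X ⟶ Z) [IsOpenImmersion f]
    [IsOpenImmersion g] {i j : WalkingSpan} (k : i ⟶ j) : IsOpenImmersion ((span f g).map k) := by
  match i, j, k with
  | _, _, WidePushoutShape.Hom.id _ => exact inferInstanceAs (IsOpenImmersion ((span f g).map (𝟙 _)))
  | _, _, WidePushoutShape.Hom.init .left => assumption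
  | _, _, WidePushoutShape.Hom.init .right => assumption

/-- The total space of the affine line bundle over `ℙ¹` with transition isomorphism
`T ↦ u ^ d * T + c`: the gluing of two copies of `𝔸² = Spec ℂ[u][T]` along the open subsets
`u ≠ 0` through `(u, T) ↦ (u⁻¹, u ^ d * T + c)`. -/
def AffineLineBundle (d : ℕ) (c : ℂ[T;T⁻¹]) : Scheme.{0} :=
  pushout (Spec.map (CommRingCat.ofHom incl)) (Spec.map (CommRingCat.ofHom (trans d c)))

/-- The two charts of `AffineLineBundle d c`. -/
def bundleChart (d : ℕ) (c : ℂ[T;T⁻¹]) (i : Fin 2) :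
    Spec (.of PlaneRing) ⟶ AffineLineBundle d c :=
  if i = 0 then
    pushout.inl (Spec.map (CommRingCat.ofHom incl)) (Spec.map (CommRingCat.ofHom (trans d c)))
  else
    pushout.inr (Spec.map (CommRingCat.ofHom incl)) (Spec.map (CommRingCat.ofHom (trans d c)))

/-- The structure morphism of `AffineLineBundle d c` over `ℂ`. -/
def AffineLineBundle.toSpec (d : ℕ) (c : ℂ[T;T⁻¹]) : AffineLineBundle d c ⟶ Spec (.of ℂ) :=
  pushout.desc (Spec.map (CommRingCat.ofHom (algebraMap ℂ PlaneRing)))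
    (Spec.map (CommRingCat.ofHom (algebraMap ℂ PlaneRing))) (by
      rw [← Spec.map_comp, ← Spec.map_comp, ← CommRingCat.ofHom_comp, ← CommRingCat.ofHom_comp]
      congr 2
      ext r
      simp [incl, trans, Polynomial.algebraMap_apply])

/-- `ρ` is the bundle projection of `AffineLineBundle d c` onto `ℙ¹`: over each of the two
standard charts of `ℙ¹` it is the projection `(u, T) ↦ u` of the corresponding chart. -/
def IsBundleProjection (d : ℕ) (c : ℂ[T;T⁻¹]) (ρ : AffineLineBundle d c ⟶ ProjLine) : Prop :=
  ∀ i : Fin 2, IsPullback (bundleChart d c i) (Spec.map (CommRingCat.ofHom Polynomial.C)) ρ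
    (lineChart i)

/-- The total space of the line bundle `𝒪(-d)` on `ℙ¹`. In the local frames `x⁻ᵈ` and `y⁻ᵈ` of
`𝒪(-d)`, with `u = y / x`, its transition isomorphism is `T ↦ u ^ d * T`. -/
abbrev OMinus (d : ℕ) : Scheme.{0} := AffineLineBundle d 0

/-- The surface `S_{d,m}`, with transition isomorphism `T ↦ u ^ d * T + u ^ m`. -/
abbrev Surface (d m : ℕ) : Scheme.{0} := AffineLineBundle d (LaurentPolynomial.T m)

/-- The morphism `Spec ℂ[u][s][t] ⟶ AffineLineBundle d c`, with values in the chart number `i`, given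
by `(u, s, t) ↦ (u, f (u, s, t))`. -/
def chartPoint (d : ℕ) (c : ℂ[T;T⁻¹]) (i : Fin 2) (f : Polynomial PlaneRing) :
    Spec (.of (Polynomial PlaneRing)) ⟶ AffineLineBundle d c :=
  Spec.map (CommRingCat.ofHom (Polynomial.eval₂RingHom (Polynomial.C.comp Polynomial.C) f)) ≫
    bundleChart d c i

/-- The `ℙ¹`-morphism `σ` from the fibre product over `ℙ¹` of the line bundle `𝒪(-d)` and
`AffineLineBundle d c` to `AffineLineBundle d c` is fibrewise the translation: in each of the two
charts it is `((u, s), (u, t)) ↦ (u, s + t)`. -/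
def IsTranslation {d : ℕ} {c : ℂ[T;T⁻¹]} {ρL : OMinus d ⟶ ProjLine}
    {ρ : AffineLineBundle d c ⟶ ProjLine} (σ : Over.mk ρL ⊗ Over.mk ρ ⟶ Over.mk ρ) : Prop :=
  ∀ (i : Fin 2) (Z : Over ProjLine) (e : Z.left ⟶ Spec (.of (Polynomial PlaneRing)))
    (x : Z ⟶ Over.mk ρL) (y : Z ⟶ Over.mk ρ),
    x.left = e ≫ chartPoint d 0 i (Polynomial.C Polynomial.X) →
    y.left = e ≫ chartPoint d c i Polynomial.X →
    (lift x y ≫ σ).left = e ≫ chartPoint d c i (Polynomial.C Polynomial.X + Polynomial.X)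

/-- `ρ : AffineLineBundle d c ⟶ ℙ¹` is the bundle projection, and it is a torsor under the line
bundle `𝒪(-d)`: the total space of `𝒪(-d)` is a group scheme over `ℙ¹` under fibrewise addition,
and it acts on `AffineLineBundle d c` over `ℙ¹` by fibrewise translations, simply transitively,
with local sections. -/
def IsOMinusTorsor {d : ℕ} {c : ℂ[T;T⁻¹]} (ρ : AffineLineBundle d c ⟶ ProjLine) : Prop :=
  IsBundleProjection d c ρ ∧
    ∃ ρL : OMinus d ⟶ ProjLine, IsBundleProjection d 0 ρL ∧
      ∃ (_ : GrpObj (Over.mk ρL)) (_ : ModObj (Over.mk ρL) (Over.mk ρ)),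
        IsTranslation (ρL := ρL) (ρ := ρL) μ[Over.mk ρL] ∧
        IsTranslation (ρL := ρL) (ρ := ρ) γ[Over.mk ρL, Over.mk ρ] ∧
        IsPrincipalBundle (R := (Over.mk ρL ⊗ Over.mk ρ).left) (X := AffineLineBundle d c)
          (γ[Over.mk ρL, Over.mk ρ] : Over.mk ρL ⊗ Over.mk ρ ⟶ Over.mk ρ).left
          (snd (Over.mk ρL) (Over.mk ρ)).left ρ

/-! ## Units and the Picard group -/

/-- The functor sending a commutative ring to its group of units, written additively. -/
def unitsFunctor : CommRingCat.{0} ⥤ AddCommGrpCat.{0} :=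
  forget₂ CommRingCat CommMonCat ⋙ CommMonCat.units ⋙ commGroupAddCommGroupEquivalence.functor

instance : PreservesLimits unitsFunctor :=
  inferInstanceAs (PreservesLimits (forget₂ CommRingCat CommMonCat ⋙ CommMonCat.units ⋙
    commGroupAddCommGroupEquivalence.functor))

/-- The sheaf `𝒪_S^*` of abelian groups on the Zariski site of `S`. -/
def unitsSheaf (S : Scheme.{0}) : Sheaf (Opens.grothendieckTopology S) AddCommGrpCat.{0} :=
  (sheafCompose _ unitsFunctor).obj S.sheaf

/-- The first cohomology group `H¹(S, 𝒪_S^*)`. -/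
abbrev H1Units (S : Scheme.{0}) : Type := (unitsSheaf S).H 1

/-- The Picard group of an affine scheme: isomorphism classes of invertible modules over the ring
of global functions, with the tensor product. -/
abbrev Pic (S : Scheme.{0}) [IsAffine S] : Type := CommRing.Pic Γ(S, ⊤)

/-- `L` is the class of the principal `𝔾ₘ`-bundle `q : X ⟶ S` over the affine scheme `S`, where `a`
and `p` are the action and the projection `R = 𝔾ₘ × X ⟶ X`, and `l` is the function `λ` on `R`:
the sections of `L` are the functions `f` on `X` with `f (λ • x) = λ * f x`. (These are the global
sections of the line bundle with the transition functions of `q`. The opposite sign convention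
would replace the class by its inverse.) -/
def IsClassOfBundle {R X S : Scheme.{0}} [IsAffine S] (a p : R ⟶ X) (l : Γ(R, ⊤)) (q : X ⟶ S)
    (L : Pic S) : Prop :=
  ∃ φ : L.AsModule →ₛₗ[q.appTop.hom] Γ(X, ⊤), Function.Injective φ ∧
    Set.range φ = {f | a.appTop f = l * p.appTop f}

end FactorialThreefold

end

open FactorialThreefold

/-! Write `X` for the threefold, `A` for its coordinate ring, `S` for the surface and `B` for its
ring of functions.

The quotient map. The functions `y / x` and `xⁿ u` on `x ≠ 0`, and `x / y` and `yᵐ v` on `y ≠ 0`,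
are invariant. Multiplying `xᵐ v - yⁿ u = 1` by `(y / x)ᵐ` gives `yᵐ v = (y / x)ᵐ⁺ⁿ (xⁿ u) + (y /
x)ᵐ`, which is the gluing rule of `S`; so these pairs define `q : X ⟶ S`. Setting `x = 1` or `y = 1`
gives a section of `q` over each chart. Two points of `X` with the same image agree on all the
invariants `xⁱ yᵏ u` (`i + k = n`) and `xⁱ yᵏ v` (`i + k = m`), and then `λ = x' xᵐ⁻¹ v - y' yⁿ⁻¹ u`
is the unique scalar carrying the unprimed point to the primed one (`existsUnique_orbit`). Hence `𝔾ₘ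
× X` is `X ×_S X`, so `q` is a principal bundle, and any Zariski locally trivial principal bundle is
a geometric quotient (`IsPrincipalBundle.isGeometricQuotient`).

Affineness and torsor. The invariants `xᵐ v` and `yⁿ u` differ by `1`, and each is nonzero only
inside one of the two affine charts of `S`. A point of an affine line bundle with values in a
`ℙ¹`-scheme is a pair of functions with `t₁ = uᵈ t₀ + c` (`res_fib`, `exists_fib_eq`); adding a
solution of the linear rule gives another solution, and two solutions differ by a unique solution of
the linear rule.

Picard group. Inverting `x` in `A` gives `ℂ[y, u][x, x⁻¹]`, and `A / x` embeds in `ℂ[v][y, y⁻¹]`, so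
`x` is prime and `A` is factorial by Nagata's theorem; its units are constants. As `Pic A` is
trivial, every class of `Pic B` is represented by an invertible `B`-submodule `I` of `A`. If `a ∈ I`
and `b ∈ I⁻¹` have nonzero product, their coactions multiply to a constant Laurent polynomial, so
`a` and `b` are homogeneous. This puts `I` in a single weight `k` and identifies it with the `k`-th
power of the weight one part of `A`, which is invertible because `1 = x (xᵐ⁻¹ v) - y (yⁿ⁻¹ u)`. If
that power is trivial it is spanned by a unit of weight `k`, so `k = 0`. The class of the bundle is
therefore a free generator (`exists_pic_generator`).

Cohomology. On the spectrum of a factorial ring a unit on `U₁ ∩ U₂` is a quotient of units on `U₁`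
and `U₂`, so `𝒪*` is acyclic on both charts of `S`. The units are `ℂ*` on the charts and `ℂ* × u^ℤ`
on the overlap, so `H¹` is infinite cyclic, generated by the class of `u`. The group isomorphism of
`Pic` and `H¹` is obtained by comparing both with `ℤ`. -/

noncomputable section

namespace FactorialThreefold

/-! ## Morphisms in local coordinates -/

section Charts

variable {S Z Z' : Scheme.{0}}

/-- In the coordinates of the chart `j : Spec R ⟶ S`, the restriction of `g : Z ⟶ S` to `U` is the
morphism with comorphism `φ`. -/
def ChartOn {R : Type} [CommRing R] (j : Spec (.of R) ⟶ S) (g : Z ⟶ S) (U : Z.Opens)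
    (φ : R →+* Γ(Z, U)) : Prop :=
  U.ι ≫ g = U.toSpecΓ ≫ Spec.map (CommRingCat.ofHom φ) ≫ j

/-- The restriction map between rings of sections. -/
def res (Z : Scheme.{0}) {U V : Z.Opens} (h : U ≤ V) : Γ(Z, V) →+* Γ(Z, U) :=
  (Z.presheaf.map (homOfLE h).op).hom

lemma res_comp_res {U V W : Z.Opens} (h : U ≤ V) (h' : V ≤ W) :
    (res Z h).comp (res Z h') = res Z (h.trans h') := by
  rw [res, res, ← CommRingCat.hom_comp, ← Functor.map_comp]
  rfl

lemma res_res {U V W : Z.Opens} (h : U ≤ V) (h' : V ≤ W) (s : Γ(Z, W)) :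
    res Z h (res Z h' s) = res Z (h.trans h') s :=
  DFunLike.congr_fun (res_comp_res h h') s

lemma res_self {U : Z.Opens} (h : U ≤ U) (s : Γ(Z, U)) : res Z h s = s := by
  simp [res]

variable {R R' : Type} [CommRing R] [CommRing R']

lemma toSpecΓ_comp_injective (U : Z.Opens) {φ ψ : R →+* Γ(Z, U)}
    (h : U.toSpecΓ ≫ Spec.map (CommRingCat.ofHom φ) = U.toSpecΓ ≫ Spec.map (CommRingCat.ofHom ψ)) :
    φ = ψ := by
  have h' := congrArg Scheme.Hom.appTop h
  simp only [Scheme.Hom.comp_appTop, Scheme.Opens.toSpecΓ_appTop] at h'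
  rw [Scheme.ΓSpecIso_naturality_assoc, Scheme.ΓSpecIso_naturality_assoc, Iso.cancel_iso_hom_left,
    Iso.cancel_iso_inv_right] at h'
  exact congrArg CommRingCat.Hom.hom h'

lemma exists_eq_toSpecΓ_comp (U : Z.Opens) (h : U.toScheme ⟶ Spec (.of R)) :
    ∃ φ : R →+* Γ(Z, U), h = U.toSpecΓ ≫ Spec.map (CommRingCat.ofHom φ) := by
  refine ⟨((Scheme.ΓSpecIso (.of R)).inv ≫ h.appTop ≫ U.topIso.hom).hom, ?_⟩
  rw [CommRingCat.ofHom_hom, Scheme.Opens.toSpecΓ, Spec.map_comp, Spec.map_comp, Category.assoc,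
    Category.assoc, ← Spec.map_comp_assoc, Iso.hom_inv_id, Spec.map_id, Category.id_comp,
    ← Scheme.toSpecΓ_naturality_assoc, toSpecΓ_SpecMap_ΓSpecIso_inv, Category.comp_id]

lemma homOfLE_toSpecΓ_comp {U V : Z.Opens} (h : U ≤ V) (φ : R →+* Γ(Z, V)) :
    Z.homOfLE h ≫ V.toSpecΓ ≫ Spec.map (CommRingCat.ofHom φ) =
      U.toSpecΓ ≫ Spec.map (CommRingCat.ofHom ((res Z h).comp φ)) := by
  rw [CommRingCat.ofHom_comp, Spec.map_comp, res, CommRingCat.ofHom_hom,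
    Scheme.Opens.toSpecΓ_SpecMap_presheaf_map_assoc]

section

variable {j : Spec (.of R) ⟶ S}

lemma ChartOn.unique [Mono j] {g : Z ⟶ S} {U : Z.Opens} {φ ψ : R →+* Γ(Z, U)}
    (h : ChartOn j g U φ) (h' : ChartOn j g U ψ) : φ = ψ := by
  refine toSpecΓ_comp_injective U ((cancel_mono j).mp ?_)
  simpa using h.symm.trans h'

lemma exists_chartOn [IsOpenImmersion j] {g : Z ⟶ S} {U : Z.Opens}
    (h : U ≤ g ⁻¹ᵁ j.opensRange) : ∃ φ : R →+* Γ(Z, U), ChartOn j g U φ := by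
  have h' : Set.range (U.ι ≫ g) ⊆ Set.range j := by
    rintro _ ⟨x, rfl⟩
    exact h x.2
  obtain ⟨φ, hφ⟩ := exists_eq_toSpecΓ_comp U (IsOpenImmersion.lift j (U.ι ≫ g) h')
  refine ⟨φ, ?_⟩
  rw [ChartOn, ← Category.assoc, ← hφ, IsOpenImmersion.lift_fac]

lemma ChartOn.le [IsOpenImmersion j] {g : Z ⟶ S} {U : Z.Opens} {φ : R →+* Γ(Z, U)}
    (h : ChartOn j g U φ) : U ≤ g ⁻¹ᵁ j.opensRange := by
  intro x hx
  have := congrArg (fun f : U.toScheme ⟶ S ↦ f ⟨x, hx⟩) h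
  exact ⟨_, this.symm⟩

lemma ChartOn.comp {g : Z ⟶ S} {U : Z.Opens} {φ : R →+* Γ(Z, U)} (h : ChartOn j g U φ)
    (f : Z' ⟶ Z) (U' : Z'.Opens) (e : U' ≤ f ⁻¹ᵁ U) :
    ChartOn j (f ≫ g) U' ((f.appLE U U' e).hom.comp φ) := by
  rw [ChartOn, CommRingCat.ofHom_comp, Spec.map_comp, CommRingCat.ofHom_hom, Category.assoc,
    Scheme.Opens.toSpecΓ_SpecMap_appLE_assoc, ← h, Scheme.Hom.resLE_comp_ι_assoc]

lemma ChartOn.res {g : Z ⟶ S} {U V : Z.Opens} {φ : R →+* Γ(Z, V)} (h : ChartOn j g V φ)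
    (e : U ≤ V) : ChartOn j g U ((res Z e).comp φ) := by
  have := homOfLE_toSpecΓ_comp e φ
  rw [ChartOn, ← reassoc_of% this, ← h, Scheme.homOfLE_ι_assoc]

lemma ChartOn.postcomp {P : Scheme.{0}} {j' : Spec (.of R') ⟶ P} {r : S ⟶ P} {a : R' →+* R}
    (w : j ≫ r = Spec.map (CommRingCat.ofHom a) ≫ j') {g : Z ⟶ S} {U : Z.Opens}
    {φ : R →+* Γ(Z, U)} (h : ChartOn j g U φ) : ChartOn j' (g ≫ r) U (φ.comp a) := by
  rw [ChartOn, CommRingCat.ofHom_comp, Spec.map_comp, Category.assoc, ← w, reassoc_of% h]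

lemma ChartOn.of_comp_comp {i : Spec (.of R') ⟶ S} {k : R →+* R'}
    (w : i = Spec.map (CommRingCat.ofHom k) ≫ j) {g : Z ⟶ S} {U : Z.Opens}
    {ψ : R' →+* Γ(Z, U)} (h : ChartOn i g U ψ) : ChartOn j g U (ψ.comp k) := by
  rw [ChartOn, CommRingCat.ofHom_comp, Spec.map_comp, Category.assoc, ← w, h]

end

lemma hom_ext_of_sup_eq_top {U₀ U₁ : Z.Opens} (hU : U₀ ⊔ U₁ = ⊤) {f g : Z ⟶ S}
    (h₀ : U₀.ι ≫ f = U₀.ι ≫ g) (h₁ : U₁.ι ≫ f = U₁.ι ≫ g) : f = g := by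
  refine Scheme.hom_ext_of_forall f g fun x ↦ ?_
  have hx : x ∈ U₀ ⊔ U₁ := hU ▸ TopologicalSpace.Opens.mem_top x
  rcases hx with hx | hx
  exacts [⟨U₀, hx, h₀⟩, ⟨U₁, hx, h₁⟩]

lemma exists_hom_of_sup_eq_top {U₀ U₁ : Z.Opens} (hU : U₀ ⊔ U₁ = ⊤) (f₀ : U₀.toScheme ⟶ S)
    (f₁ : U₁.toScheme ⟶ S)
    (h : Z.homOfLE (inf_le_left : U₀ ⊓ U₁ ≤ U₀) ≫ f₀ = Z.homOfLE inf_le_right ≫ f₁) :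
    ∃ f : Z ⟶ S, U₀.ι ≫ f = f₀ ∧ U₁.ι ≫ f = f₁ := by
  let U : Fin 2 → Z.Opens := ![U₀, U₁]
  have hU' : TopologicalSpace.IsOpenCover U := by
    rw [TopologicalSpace.IsOpenCover, ← hU, ← Finset.sup_univ_eq_iSup]
    simp [Fin.univ_succ, U]
  let 𝒰 := Z.openCoverOfIsOpenCover U hU'
  let f : ∀ i : Fin 2, (U i).toScheme ⟶ S := fun i ↦ match i with
    | 0 => f₀
    | 1 => f₁
  have key : pullback.fst U₀.ι U₁.ι ≫ f₀ = pullback.snd U₀.ι U₁.ι ≫ f₁ := by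
    rw [← (isPullback_opens_inf U₀ U₁).isoPullback_inv_fst,
      ← (isPullback_opens_inf U₀ U₁).isoPullback_inv_snd, Category.assoc, Category.assoc, h]
  have hf : ∀ x y : Fin 2, pullback.fst (U x).ι (U y).ι ≫ f x = pullback.snd _ _ ≫ f y := by
    intro x y
    match x, y with
    | 0, 0 => rw [(cancel_mono (U 0).ι).mp (pullback.condition (f := (U 0).ι) (g := (U 0).ι))]
    | 1, 1 => rw [(cancel_mono (U 1).ι).mp (pullback.condition (f := (U 1).ι) (g := (U 1).ι))]
    | 0, 1 => exact key
    | 1, 0 =>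
      rw [← cancel_epi (pullbackSymmetry (U 0).ι (U 1).ι).hom, pullbackSymmetry_hom_comp_fst_assoc,
        pullbackSymmetry_hom_comp_snd_assoc]
      exact key.symm
  exact ⟨𝒰.glueMorphisms f hf, 𝒰.ι_glueMorphisms f hf (0 : Fin 2),
    𝒰.ι_glueMorphisms f hf (1 : Fin 2)⟩

variable {R₀ R₁ R₀₁ : Type} [CommRing R₀] [CommRing R₁] [CommRing R₀₁]
  {j₀ : Spec (.of R₀) ⟶ S} {j₁ : Spec (.of R₁) ⟶ S}

lemma ChartOn.hom_ext {U₀ U₁ : Z.Opens} (hU : U₀ ⊔ U₁ = ⊤) {f g : Z ⟶ S}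
    {φ₀ : R₀ →+* Γ(Z, U₀)} {φ₁ : R₁ →+* Γ(Z, U₁)}
    (hf₀ : ChartOn j₀ f U₀ φ₀) (hf₁ : ChartOn j₁ f U₁ φ₁)
    (hg₀ : ChartOn j₀ g U₀ φ₀) (hg₁ : ChartOn j₁ g U₁ φ₁) : f = g :=
  hom_ext_of_sup_eq_top hU (hf₀.trans hg₀.symm) (hf₁.trans hg₁.symm)

/-- Morphisms to `S` given in local coordinates glue. -/
lemma exists_hom_chartOn {k₀ : R₀ →+* R₀₁} {k₁ : R₁ →+* R₀₁}
    (w : Spec.map (CommRingCat.ofHom k₀) ≫ j₀ = Spec.map (CommRingCat.ofHom k₁) ≫ j₁)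
    {U₀ U₁ : Z.Opens} (hU : U₀ ⊔ U₁ = ⊤) (φ₀ : R₀ →+* Γ(Z, U₀)) (φ₁ : R₁ →+* Γ(Z, U₁))
    (ψ : R₀₁ →+* Γ(Z, U₀ ⊓ U₁)) (h₀ : (FactorialThreefold.res Z inf_le_left).comp φ₀ = ψ.comp k₀)
    (h₁ : (FactorialThreefold.res Z inf_le_right).comp φ₁ = ψ.comp k₁) :
    ∃ g : Z ⟶ S, ChartOn j₀ g U₀ φ₀ ∧ ChartOn j₁ g U₁ φ₁ := by
  refine exists_hom_of_sup_eq_top hU _ _ ?_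
  have h₀' := homOfLE_toSpecΓ_comp (inf_le_left : U₀ ⊓ U₁ ≤ U₀) φ₀
  have h₁' := homOfLE_toSpecΓ_comp (inf_le_right : U₀ ⊓ U₁ ≤ U₁) φ₁
  rw [reassoc_of% h₀', reassoc_of% h₁', h₀, h₁, CommRingCat.ofHom_comp, CommRingCat.ofHom_comp,
    Spec.map_comp, Spec.map_comp, Category.assoc, Category.assoc, w]

end Charts

/-! ### Gluing sections over two open subsets -/

section Sections

variable {S Z : Scheme.{0}}

lemma exists_section_sup {U V : Z.Opens} (s : Γ(Z, U)) (t : Γ(Z, V))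
    (h : res Z (inf_le_left : U ⊓ V ≤ U) s = res Z inf_le_right t) :
    ∃ e : Γ(Z, U ⊔ V), res Z le_sup_left e = s ∧ res Z le_sup_right e = t :=
  ⟨(Z.sheaf.objSupIsoProdEqLocus U V).inv ⟨(s, t), h⟩,
    Z.sheaf.objSupIsoProdEqLocus_inv_fst U V _, Z.sheaf.objSupIsoProdEqLocus_inv_snd U V _⟩

lemma section_ext {U V W : Z.Opens} (hU : U ≤ W) (hV : V ≤ W) (h : W ≤ U ⊔ V) {s t : Γ(Z, W)}
    (h₀ : res Z hU s = res Z hU t) (h₁ : res Z hV s = res Z hV t) : s = t :=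
  Z.sheaf.eq_of_locally_eq₂ (homOfLE hU) (homOfLE hV) h s t h₀ h₁

lemma exists_section {U V W : Z.Opens} (hU : U ≤ W) (hV : V ≤ W) (h : W ≤ U ⊔ V)
    (s : Γ(Z, U)) (t : Γ(Z, V))
    (hst : res Z (inf_le_left : U ⊓ V ≤ U) s = res Z inf_le_right t) :
    ∃ e : Γ(Z, W), res Z hU e = s ∧ res Z hV e = t := by
  obtain ⟨e, rfl, rfl⟩ := exists_section_sup s t hst
  exact ⟨res Z h e, res_res _ _ _, res_res _ _ _⟩

variable {R : Type} [CommRing R] {j : Spec (.of R) ⟶ S}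

/-- The local expression of the identity is the comorphism of the inverse of `j` on its range, hence
an isomorphism. This identifies functions on a chart with elements of its coordinate ring. -/
lemma ChartOn.bijective_of_id [IsOpenImmersion j] {U : S.Opens} (hU : U = j.opensRange)
    {φ : R →+* Γ(S, U)} (h : ChartOn j (𝟙 S) U φ) : Function.Bijective φ := by
  subst hU
  have hV : IsAffineOpen j.opensRange := isAffineOpen_opensRange j
  have e : j.isoOpensRange.inv = j.opensRange.toSpecΓ ≫ Spec.map (CommRingCat.ofHom φ) := by
    rw [← cancel_mono j, Scheme.Hom.isoOpensRange_inv_comp, Category.assoc, ← h, Category.comp_id]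
  have : IsIso (Spec.map (CommRingCat.ofHom φ)) := by
    rw [← hV.isoSpec_hom, ← Iso.inv_comp_eq] at e
    rw [← e]
    infer_instance
  exact isIso_SpecMap_iff.mp this

end Sections

/-! ### The two charts of an affine line bundle and their overlap -/

section Bundle

variable (d : ℕ) (c : ℂ[T;T⁻¹])

instance isOpenImmersion_bundleChart (i : Fin 2) : IsOpenImmersion (bundleChart d c i) := by
  match i with
  | 0 => exact inferInstanceAs (IsOpenImmersion (colimit.ι (span _ _) WalkingSpan.left))
  | 1 => exact inferInstanceAs (IsOpenImmersion (colimit.ι (span _ _) WalkingSpan.right))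

lemma incl_bundleChart : Spec.map (CommRingCat.ofHom incl) ≫ bundleChart d c 0 =
    Spec.map (CommRingCat.ofHom (trans d c)) ≫ bundleChart d c 1 :=
  pushout.condition

lemma exists_bundleChart_eq (x : AffineLineBundle d c) : ∃ i y, bundleChart d c i y = x := by
  obtain ⟨i, y, rfl⟩ := Scheme.IsLocallyDirected.ι_jointly_surjective
    (span (Spec.map (CommRingCat.ofHom incl)) (Spec.map (CommRingCat.ofHom (trans d c)))) x
  match i with
  | none =>
    exact ⟨0, Spec.map (CommRingCat.ofHom incl) y,
      congrArg (fun f : Spec (.of OverlapRing) ⟶ AffineLineBundle d c ↦ f y)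
        (colimit.w (span (Spec.map (CommRingCat.ofHom incl))
          (Spec.map (CommRingCat.ofHom (trans d c)))) WalkingSpan.Hom.fst)⟩
  | some .left => exact ⟨0, y, rfl⟩
  | some .right => exact ⟨1, y, rfl⟩

/-- In the gluing of a span, points of the two legs become equal only through an object mapping to
both legs, and the apex is the only such object. -/
lemma bundleChart_eq_bundleChart {x y : Spec (.of PlaneRing)}
    (h : bundleChart d c 0 x = bundleChart d c 1 y) :
    ∃ z, Spec.map (CommRingCat.ofHom incl) z = x ∧
      Spec.map (CommRingCat.ofHom (trans d c)) z = y := by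
  obtain ⟨k, fi, fj, z, hx, hy⟩ := (Scheme.IsLocallyDirected.ι_eq_ι_iff
    (span (Spec.map (CommRingCat.ofHom incl)) (Spec.map (CommRingCat.ofHom (trans d c))))
    (i := WalkingSpan.left) (j := WalkingSpan.right)).mp h
  change WidePushoutShape.Hom k (some .left) at fi
  change WidePushoutShape.Hom k (some .right) at fj
  cases fi with
  | id => cases fj
  | init =>
    cases fj
    exact ⟨z, hx, hy⟩

/-- The open subset of the total space covered by the chart number `i`. -/
def chartOpens (i : Fin 2) : (AffineLineBundle d c).Opens := (bundleChart d c i).opensRange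

lemma isAffineOpen_chartOpens (i : Fin 2) : IsAffineOpen (chartOpens d c i) :=
  isAffineOpen_opensRange _

lemma chartOpens_sup : chartOpens d c 0 ⊔ chartOpens d c 1 = ⊤ := by
  refine top_unique fun x _ ↦ ?_
  obtain ⟨i, y, rfl⟩ := exists_bundleChart_eq d c x
  match i with
  | 0 => exact Or.inl ⟨y, rfl⟩
  | 1 => exact Or.inr ⟨y, rfl⟩

/-- The intersection of the two charts. -/
def overlapChart : Spec (.of OverlapRing) ⟶ AffineLineBundle d c :=
  Spec.map (CommRingCat.ofHom incl) ≫ bundleChart d c 0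

lemma overlapChart_eq : overlapChart d c =
    Spec.map (CommRingCat.ofHom (trans d c)) ≫ bundleChart d c 1 := incl_bundleChart d c

instance : IsOpenImmersion (overlapChart d c) := by
  unfold overlapChart
  infer_instance

lemma chartOpens_inf : chartOpens d c 0 ⊓ chartOpens d c 1 = (overlapChart d c).opensRange := by
  ext x
  constructor
  · rintro ⟨⟨y, rfl⟩, z, hz⟩
    obtain ⟨w, rfl, -⟩ := bundleChart_eq_bundleChart d c hz.symm
    exact ⟨w, Scheme.Hom.comp_apply _ _ _⟩
  · rintro ⟨w, rfl⟩
    refine ⟨⟨_, (Scheme.Hom.comp_apply _ _ _).symm⟩, ⟨Spec.map (CommRingCat.ofHom (trans d c)) w, ?_⟩⟩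
    rw [overlapChart_eq]
    exact (Scheme.Hom.comp_apply _ _ _).symm

lemma opensRange_incl : (Spec.map (CommRingCat.ofHom incl)).opensRange =
    PrimeSpectrum.basicOpen (Polynomial.C Polynomial.X : PlaneRing) := by
  let : Algebra PlaneRing OverlapRing := incl.toAlgebra
  have : IsLocalization.Away (Polynomial.C Polynomial.X : PlaneRing) OverlapRing := by
    have := Polynomial.isLocalization (Submonoid.powers (Polynomial.X : Polynomial ℂ)) ℂ[T;T⁻¹]
    rw [Submonoid.map_powers] at this
    exact this
  exact TopologicalSpace.Opens.ext
    (PrimeSpectrum.localization_away_comap_range OverlapRing (Polynomial.C Polynomial.X : PlaneRing))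

lemma opensRange_trans : (Spec.map (CommRingCat.ofHom (trans d c))).opensRange =
    PrimeSpectrum.basicOpen (Polynomial.C Polynomial.X : PlaneRing) := by
  have : IsIso (CommRingCat.ofHom (overlapHom d c)) :=
    (ConcreteCategory.isIso_iff_bijective _).mpr (overlapHom_bijective d c)
  rw [← opensRange_incl]
  simp only [← overlapHom_comp_incl, CommRingCat.ofHom_comp, Spec.map_comp]
  rw [Scheme.Hom.opensRange_comp, Scheme.Hom.opensRange_of_isIso, Scheme.Hom.image_top_eq_opensRange]

lemma bundleChart_preimage (i k : Fin 2) (h : i ≠ k) :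
    bundleChart d c i ⁻¹ᵁ chartOpens d c k =
      PrimeSpectrum.basicOpen (Polynomial.C Polynomial.X : PlaneRing) := by
  match i, k, h with
  | 0, 0, h | 1, 1, h => exact absurd rfl h
  | 0, 1, _ =>
    rw [← opensRange_incl]
    ext x
    constructor
    · rintro ⟨y, hy⟩
      obtain ⟨w, rfl, -⟩ := bundleChart_eq_bundleChart d c hy.symm
      exact ⟨w, rfl⟩
    · rintro ⟨w, rfl⟩
      refine ⟨Spec.map (CommRingCat.ofHom (trans d c)) w, ?_⟩
      simp only [← Scheme.Hom.comp_apply, incl_bundleChart]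
  | 1, 0, _ =>
    rw [← opensRange_trans d c]
    ext x
    constructor
    · rintro ⟨y, hy⟩
      obtain ⟨w, -, rfl⟩ := bundleChart_eq_bundleChart d c hy
      exact ⟨w, rfl⟩
    · rintro ⟨w, rfl⟩
      refine ⟨Spec.map (CommRingCat.ofHom incl) w, ?_⟩
      simp only [← Scheme.Hom.comp_apply, incl_bundleChart]

lemma exists_chartSection (i : Fin 2) : ∃ φ : PlaneRing →+* Γ(AffineLineBundle d c, chartOpens d c i),
    ChartOn (bundleChart d c i) (𝟙 _) (chartOpens d c i) φ :=
  exists_chartOn le_rfl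

/-- The functions on the chart number `i`, as sections of the structure sheaf. -/
def chartSection (i : Fin 2) : PlaneRing →+* Γ(AffineLineBundle d c, chartOpens d c i) :=
  (exists_chartSection d c i).choose

lemma chartOn_chartSection (i : Fin 2) :
    ChartOn (bundleChart d c i) (𝟙 _) (chartOpens d c i) (chartSection d c i) :=
  (exists_chartSection d c i).choose_spec

lemma chartSection_bijective (i : Fin 2) : Function.Bijective (chartSection d c i) :=
  (chartOn_chartSection d c i).bijective_of_id rfl

lemma exists_overlapSection :
    ∃ φ : OverlapRing →+* Γ(AffineLineBundle d c, chartOpens d c 0 ⊓ chartOpens d c 1),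
      ChartOn (overlapChart d c) (𝟙 _) (chartOpens d c 0 ⊓ chartOpens d c 1) φ :=
  exists_chartOn (chartOpens_inf d c).le

/-- The functions on the intersection of the charts, as sections of the structure sheaf. -/
def overlapSection :
    OverlapRing →+* Γ(AffineLineBundle d c, chartOpens d c 0 ⊓ chartOpens d c 1) :=
  (exists_overlapSection d c).choose

lemma chartOn_overlapSection :
    ChartOn (overlapChart d c) (𝟙 _) (chartOpens d c 0 ⊓ chartOpens d c 1) (overlapSection d c) :=
  (exists_overlapSection d c).choose_spec

lemma overlapSection_bijective : Function.Bijective (overlapSection d c) :=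
  (chartOn_overlapSection d c).bijective_of_id (chartOpens_inf d c)

lemma res_chartSection_zero (P : PlaneRing) :
    res _ inf_le_left (chartSection d c 0 P) = overlapSection d c (incl P) :=
  DFunLike.congr_fun (((chartOn_chartSection d c 0).res inf_le_left).unique
    ((chartOn_overlapSection d c).of_comp_comp rfl)) P

lemma res_chartSection_one (P : PlaneRing) :
    res _ inf_le_right (chartSection d c 1 P) = overlapSection d c (trans d c P) :=
  DFunLike.congr_fun (((chartOn_chartSection d c 1).res inf_le_right).unique
    ((chartOn_overlapSection d c).of_comp_comp (overlapChart_eq d c))) P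

variable {d c} in
/-- Global functions on the total space in terms of the two charts. -/
lemma exists_function {P Q : PlaneRing} (h : incl P = trans d c Q) :
    ∃ e : Γ(AffineLineBundle d c, ⊤), res _ le_top e = chartSection d c 0 P ∧
      res _ le_top e = chartSection d c 1 Q :=
  exists_section le_top le_top (chartOpens_sup d c).ge _ _ (by
    rw [res_chartSection_zero, res_chartSection_one, h])

variable {d c} in
/-- The local expression of a morphism computes the pullback of functions. -/
lemma ChartOn.res_appTop {Z : Scheme.{0}} {i : Fin 2} {g : Z ⟶ AffineLineBundle d c} {U : Z.Opens}
    {φ : PlaneRing →+* Γ(Z, U)} (h : ChartOn (bundleChart d c i) g U φ)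
    {e : Γ(AffineLineBundle d c, ⊤)} {P : PlaneRing}
    (he : FactorialThreefold.res _ le_top e = chartSection d c i P) :
    FactorialThreefold.res Z le_top (g.appTop e) = φ P := by
  have h₁ := (chartOn_chartSection d c i).comp g U h.le
  rw [Category.comp_id] at h₁
  rw [h.unique h₁, RingHom.comp_apply, ← he]
  have : g.appTop ≫ Z.presheaf.map (homOfLE (le_top : U ≤ ⊤)).op =
      (AffineLineBundle d c).presheaf.map (homOfLE le_top).op ≫ g.appLE _ U h.le := by
    rw [Scheme.Hom.map_appLE]
    rfl
  exact ConcreteCategory.congr_hom this e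

end Bundle

/-! ### Global functions on the surface and its affineness -/

section Affine

lemma ChartOn.mem_basicOpen_iff {S Z : Scheme.{0}} {R : Type} [CommRing R]
    {j : Spec (.of R) ⟶ S} [IsOpenImmersion j] {g : Z ⟶ S} {U : Z.Opens} {φ : R →+* Γ(Z, U)}
    (h : ChartOn j g U φ) {x : Z} (hx : x ∈ U) {y : Spec (.of R)} (hy : j y = g x) {P : R} :
    x ∈ Z.basicOpen (φ P) ↔ y ∈ PrimeSpectrum.basicOpen P := by
  have h₁ := congrArg (fun f : U.toScheme ⟶ S ↦ f ⟨x, hx⟩) h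
  have h₂ : y = Spec.map (CommRingCat.ofHom φ) (U.toSpecΓ ⟨x, hx⟩) :=
    j.isOpenEmbedding.injective (hy.trans h₁)
  have h₃ : (⟨x, hx⟩ : U) ∈ U.toSpecΓ ⁻¹ᵁ PrimeSpectrum.basicOpen (φ P) ↔
      (⟨x, hx⟩ : U) ∈ U.ι ⁻¹ᵁ Z.basicOpen (φ P) := by
    rw [Scheme.Opens.toSpecΓ_preimage_basicOpen]
  rw [h₂]
  exact h₃.symm

/-- A point outside the chart `k` lies in the chart `i` at `u = 0`, and there `P`, being divisible
by `u`, vanishes. -/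
lemma basicOpen_le_chartOpens {d : ℕ} {c : ℂ[T;T⁻¹]} {i k : Fin 2} (hik : i ≠ k)
    {e : Γ(AffineLineBundle d c, ⊤)} {P : PlaneRing}
    (he : res _ le_top e = chartSection d c i P) (hP : Polynomial.C Polynomial.X ∣ P) :
    (AffineLineBundle d c).basicOpen e ≤ chartOpens d c k := by
  intro x hx
  have hx' : x ∈ chartOpens d c 0 ⊔ chartOpens d c 1 :=
    chartOpens_sup d c ▸ TopologicalSpace.Opens.mem_top x
  by_cases hk : x ∈ chartOpens d c k
  · exact hk
  have hi : x ∈ chartOpens d c i := by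
    rcases hx' with h | h <;> revert hik hk h <;> fin_cases i <;> fin_cases k <;> simp <;> tauto
  have hx : x ∈ (AffineLineBundle d c).basicOpen (chartSection d c i P) := by
    rw [← he]
    rw [res, Scheme.basicOpen_res]
    exact ⟨hi, hx⟩
  obtain ⟨y, rfl⟩ := hi
  rw [(chartOn_chartSection d c i).mem_basicOpen_iff ⟨y, rfl⟩ rfl] at hx
  have hy : y ∈ bundleChart d c i ⁻¹ᵁ chartOpens d c k := by
    rw [bundleChart_preimage d c i k hik]
    obtain ⟨Q, rfl⟩ := hP
    rw [PrimeSpectrum.basicOpen_mul] at hx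
    exact hx.1
  exact hy

lemma incl_C_X : incl (Polynomial.C Polynomial.X) = Polynomial.C (LaurentPolynomial.T 1) := by
  simp [incl]

lemma incl_X : incl Polynomial.X = Polynomial.X := by
  simp [incl]

lemma trans_C_X (d : ℕ) (c : ℂ[T;T⁻¹]) :
    trans d c (Polynomial.C Polynomial.X) = Polynomial.C (LaurentPolynomial.T (-1)) := by
  simp [trans]

lemma trans_X (d : ℕ) (c : ℂ[T;T⁻¹]) : trans d c Polynomial.X =
    Polynomial.C (LaurentPolynomial.T d) * Polynomial.X + Polynomial.C c := by
  simp [trans]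

lemma C_T_natCast (k : ℕ) : (Polynomial.C (LaurentPolynomial.T k) : OverlapRing) =
    Polynomial.C (LaurentPolynomial.T 1) ^ k := by
  rw [← map_pow, LaurentPolynomial.T_pow, mul_one]

lemma C_T_neg_one_pow_mul (k : ℕ) : (Polynomial.C (LaurentPolynomial.T (-1)) : OverlapRing) ^ k *
    Polynomial.C (LaurentPolynomial.T 1) ^ k = 1 := by
  rw [← mul_pow, ← map_mul, ← LaurentPolynomial.T_add]
  simp

/-- This is the invariant `xⁱ yᵏ u` of the threefold, read off at `x = 1` in the first chart and at
`y = 1` in the second. -/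
lemma exists_function_u (m n i k : ℕ) (h : i + k = n) :
    ∃ e : Γ(Surface (m + n) m, ⊤),
      res _ le_top e = chartSection _ _ 0 (Polynomial.C Polynomial.X ^ k * Polynomial.X) ∧
      res _ le_top e = chartSection _ _ 1 (Polynomial.C Polynomial.X ^ i *
        (Polynomial.C Polynomial.X ^ m * Polynomial.X - 1)) := by
  refine exists_function ?_
  subst h
  have h₁ := C_T_neg_one_pow_mul m
  have h₂ := C_T_neg_one_pow_mul i
  simp only [map_mul, map_pow, incl_C_X, incl_X, trans_C_X, map_sub, trans_X, map_one, C_T_natCast,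
    pow_add]
  set t : OverlapRing := Polynomial.C (LaurentPolynomial.T 1)
  set t' : OverlapRing := Polynomial.C (LaurentPolynomial.T (-1))
  linear_combination (-(t ^ k * Polynomial.X) - t' ^ i) * h₁ -
    t ^ k * Polynomial.X * (t' ^ m * t ^ m) * h₂

/-- This is the invariant `xⁱ yᵏ v`, read off in the same way. -/
lemma exists_function_v (m n i k : ℕ) (h : i + k = m) :
    ∃ e : Γ(Surface (m + n) m, ⊤),
      res _ le_top e = chartSection _ _ 0 (Polynomial.C Polynomial.X ^ k *
        (1 + Polynomial.C Polynomial.X ^ n * Polynomial.X)) ∧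
      res _ le_top e = chartSection _ _ 1 (Polynomial.C Polynomial.X ^ i * Polynomial.X) := by
  refine exists_function ?_
  subst h
  have h₂ := C_T_neg_one_pow_mul i
  simp only [map_mul, map_pow, incl_C_X, incl_X, trans_C_X, map_add, trans_X, map_one, C_T_natCast,
    pow_add]
  set t : OverlapRing := Polynomial.C (LaurentPolynomial.T 1)
  set t' : OverlapRing := Polynomial.C (LaurentPolynomial.T (-1))
  linear_combination -(t ^ k * (1 + t ^ n * Polynomial.X)) * h₂

/-- Two global functions that generate the unit ideal and have affine nonvanishing loci suffice. -/
lemma isAffine_surface {m n : ℕ} (hm : 1 ≤ m) (hn : 1 ≤ n) : IsAffine (Surface (m + n) m) := by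
  -- `a = xᵐ v` is divisible by `u` in the second chart and `b = yⁿ u` is divisible by `u` in the
  -- first; here `1 ≤ m` and `1 ≤ n` matter.
  obtain ⟨a, ha₀, ha₁⟩ := exists_function_v m n m 0 rfl
  obtain ⟨b, hb₀, hb₁⟩ := exists_function_u m n 0 n (zero_add n)
  have hab : a - b = 1 := by
    refine section_ext le_top le_top (chartOpens_sup _ _).ge ?_ ?_
    · rw [map_sub, ha₀, hb₀, ← map_sub, map_one]
      convert map_one (chartSection (m + n) (LaurentPolynomial.T m) 0) using 2
      ring
    · rw [map_sub, ha₁, hb₁, ← map_sub, map_one]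
      convert map_one (chartSection (m + n) (LaurentPolynomial.T m) 1) using 2
      ring
  have ha : (Surface (m + n) m).basicOpen a ≤ chartOpens _ _ 0 :=
    basicOpen_le_chartOpens one_ne_zero ha₁ ((dvd_pow_self _ (by lia)).mul_right _)
  have hb : (Surface (m + n) m).basicOpen b ≤ chartOpens _ _ 1 :=
    basicOpen_le_chartOpens zero_ne_one hb₀ ((dvd_pow_self _ (by lia)).mul_right _)
  have key {i : Fin 2} {e : Γ(Surface (m + n) m, ⊤)}
      (h : (Surface (m + n) m).basicOpen e ≤ chartOpens _ _ i) :
      IsAffineOpen ((Surface (m + n) m).basicOpen e) := by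
    have := (isAffineOpen_chartOpens (m + n) (LaurentPolynomial.T m) i).basicOpen
      (res _ le_top e)
    rwa [res, Scheme.basicOpen_res, inf_eq_right.mpr h] at this
  refine isAffine_of_isAffineOpen_basicOpen {a, b} ?_ ?_
  · rw [Ideal.eq_top_iff_one, ← hab]
    exact sub_mem (Ideal.subset_span (by simp)) (Ideal.subset_span (by simp))
  · rintro e (rfl | rfl)
    exacts [key ha, key hb]

end Affine

/-! ### Morphisms to an affine line bundle -/

section BundleMaps

variable {Z : Scheme.{0}} {d : ℕ} {c : ℂ[T;T⁻¹]}

/-- Morphisms to the total space of an affine line bundle over `ℙ¹` in terms of sections. -/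
lemma exists_hom_bundle {U₀ U₁ : Z.Opens} (hU : U₀ ⊔ U₁ = ⊤) {α₀ : Polynomial ℂ →+* Γ(Z, U₀)}
    {α₁ : Polynomial ℂ →+* Γ(Z, U₁)} {e : ℂ[T;T⁻¹] →+* Γ(Z, U₀ ⊓ U₁)}
    (h₀ : (res Z inf_le_left).comp α₀ = e.comp Polynomial.toLaurent)
    (h₁ : (res Z inf_le_right).comp α₁ =
      e.comp (Polynomial.aeval (R := ℂ) (LaurentPolynomial.T (-1) : ℂ[T;T⁻¹])).toRingHom)
    {t₀ : Γ(Z, U₀)} {t₁ : Γ(Z, U₁)}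
    (ht : res Z inf_le_right t₁ = e (LaurentPolynomial.T d) * res Z inf_le_left t₀ + e c) :
    ∃ g : Z ⟶ AffineLineBundle d c,
      ChartOn (bundleChart d c 0) g U₀ (Polynomial.eval₂RingHom α₀ t₀) ∧
      ChartOn (bundleChart d c 1) g U₁ (Polynomial.eval₂RingHom α₁ t₁) := by
  refine exists_hom_chartOn (incl_bundleChart d c) hU _ _
    (Polynomial.eval₂RingHom e (res Z inf_le_left t₀)) ?_ ?_
  · refine Polynomial.ringHom_ext (fun a ↦ ?_) ?_
    · simpa [incl] using DFunLike.congr_fun h₀ a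
    · simp [incl]
  · refine Polynomial.ringHom_ext (fun a ↦ ?_) ?_
    · simpa [trans] using DFunLike.congr_fun h₁ a
    · simp [trans, ht]

end BundleMaps

/-! ### Ring elements as functions on open subsets of a spectrum -/

section Spec

variable {R R' : Type} [CommRing R] [CommRing R']

/-- Elements of a ring as functions on an open subset of its spectrum. -/
def specFun (U : (Spec (.of R)).Opens) : R →+* Γ(Spec (.of R), U) :=
  (res _ le_top).comp (Scheme.ΓSpecIso (.of R)).inv.hom

lemma res_specFun {U V : (Spec (.of R)).Opens} (h : U ≤ V) (a : R) :
    res _ h (specFun V a) = specFun U a := by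
  rw [specFun, specFun, RingHom.comp_apply, RingHom.comp_apply, res_res]

lemma specFun_top (a : R) : specFun ⊤ a = (Scheme.ΓSpecIso (.of R)).inv a := by
  exact res_self (Z := Spec (.of R)) (le_refl ⊤) ((Scheme.ΓSpecIso (.of R)).inv a)

lemma appLE_specFun {F : Spec (.of R') ⟶ Spec (.of R)} {f : R →+* R'}
    (hF : F = Spec.map (CommRingCat.ofHom f)) {U : (Spec (.of R)).Opens}
    {W : (Spec (.of R')).Opens} (h : W ≤ F ⁻¹ᵁ U) (a : R) :
    F.appLE U W h (specFun U a) = specFun W (f a) := by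
  subst hF
  have h₁ : (Spec (.of R)).presheaf.map (homOfLE (le_top : U ≤ ⊤)).op ≫
      (Spec.map (CommRingCat.ofHom f)).appLE U W h =
        (Spec.map (CommRingCat.ofHom f)).appTop ≫
          (Spec (.of R')).presheaf.map (homOfLE (le_top : W ≤ ⊤)).op := by
    rw [Scheme.Hom.map_appLE]
    rfl
  have h₂ := Scheme.ΓSpecIso_inv_naturality (CommRingCat.ofHom f)
  have h₃ := (Scheme.ΓSpecIso (.of R)).inv ≫= h₁
  rw [← reassoc_of% h₂] at h₃
  exact ConcreteCategory.congr_hom h₃ a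

/-- The basic open subset of the spectrum of a ring, as an open subset of the scheme. -/
def specOpen (a : R) : (Spec (.of R)).Opens := PrimeSpectrum.basicOpen a

lemma isUnit_specFun {a : R} {U : (Spec (.of R)).Opens} (h : U ≤ specOpen a) :
    IsUnit (specFun U a) := by
  rw [← res_specFun h]
  refine RingHom.isUnit_map _ ?_
  have this := (Spec (.of R)).toRingedSpace.isUnit_res_basicOpen
    ((Scheme.ΓSpecIso (.of R)).inv a)
  have h : specOpen a ≤ (Spec (.of R)).basicOpen ((Scheme.ΓSpecIso (.of R)).inv a) :=
    (basicOpen_eq_of_affine (R := .of R) a).ge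
  have h' := RingHom.isUnit_map (res _ h) this
  change IsUnit (res (Spec (.of R)) h (res _ le_top ((Scheme.ΓSpecIso (.of R)).inv a))) at h'
  rwa [res_res] at h'

lemma chartOn_specMap {S : Scheme.{0}} {j : Spec (.of R) ⟶ S} (f : R →+* R')
    (U : (Spec (.of R')).Opens) :
    ChartOn j (Spec.map (CommRingCat.ofHom f) ≫ j) U ((specFun U).comp f) := by
  rw [ChartOn, specFun, CommRingCat.ofHom_comp, CommRingCat.ofHom_comp, Spec.map_comp,
    Spec.map_comp, res, CommRingCat.ofHom_hom, CommRingCat.ofHom_hom, Category.assoc,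
    Category.assoc, Scheme.Opens.toSpecΓ_SpecMap_presheaf_map_top_assoc,
    toSpecΓ_SpecMap_ΓSpecIso_inv_assoc]

end Spec

/-! ### Functions on the threefold and the coaction -/

section Quotient

variable (m n : ℕ)

lemma coord_relation : coord m n 0 ^ m * coord m n 3 - coord m n 1 ^ n * coord m n 2 = 1 := by
  have h : coord m n 0 ^ m * coord m n 3 - coord m n 1 ^ n * coord m n 2 - 1 = 0 :=
    Ideal.Quotient.eq_zero_iff_mem.mpr (Ideal.mem_span_singleton_self (threefoldEq m n))
  linear_combination h

/-- Elements of the coordinate ring as functions on an open subset. -/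
def funOn (U : (Threefold m n).Opens) : ThreefoldRing m n →+* Γ(Threefold m n, U) :=
  specFun U

lemma res_funOn {U V : (Threefold m n).Opens} (h : U ≤ V) (a : ThreefoldRing m n) :
    res _ h (funOn m n V a) = funOn m n U a :=
  res_specFun h a

/-- Elements of `ℂ[X_{m,n}][λ, λ⁻¹]` as functions on an open subset of `𝔾ₘ × X_{m,n}`. -/
def gmFunOn (U : (GmThreefold m n).Opens) : (ThreefoldRing m n)[T;T⁻¹] →+* Γ(GmThreefold m n, U) :=
  specFun U


lemma act_appLE_funOn {U : (Threefold m n).Opens} {W : (GmThreefold m n).Opens}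
    (h : W ≤ act m n ⁻¹ᵁ U) (a : ThreefoldRing m n) :
    (act m n).appLE U W h (funOn m n U a) = gmFunOn m n W (coact m n a) :=
  appLE_specFun (R := ThreefoldRing m n) (R' := (ThreefoldRing m n)[T;T⁻¹]) (F := act m n)
    (f := coact m n) rfl (U := U) (W := W) h a

lemma proj_appLE_funOn {U : (Threefold m n).Opens} {W : (GmThreefold m n).Opens}
    (h : W ≤ proj m n ⁻¹ᵁ U) (a : ThreefoldRing m n) :
    (proj m n).appLE U W h (funOn m n U a) = gmFunOn m n W (LaurentPolynomial.C a) :=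
  appLE_specFun (R := ThreefoldRing m n) (R' := (ThreefoldRing m n)[T;T⁻¹]) (F := proj m n)
    (f := LaurentPolynomial.C) rfl (U := U) (W := W) h a

lemma coact_mk (a : MvPolynomial (Fin 4) ℂ) :
    coact m n (Ideal.Quotient.mk _ a) = coactPoly m n a :=
  rfl

lemma coact_coord (i : Fin 4) : coact m n (coord m n i) =
    LaurentPolynomial.T (weight m n i) * LaurentPolynomial.C (coord m n i) := by
  rw [coord, coact_mk, coactPoly, MvPolynomial.aeval_X]
  rfl

lemma coact_algebraMap (z : ℂ) : coact m n (algebraMap ℂ _ z) =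
    LaurentPolynomial.C (algebraMap ℂ _ z) := by
  have : algebraMap ℂ (ThreefoldRing m n) z = Ideal.Quotient.mk _ (MvPolynomial.C z) := rfl
  rw [this, coact_mk, coactPoly, MvPolynomial.aeval_C, ← this]
  rfl

/-- The open subsets `x ≠ 0` and `y ≠ 0` of the threefold. -/
def coordOpens (i : Fin 2) : (Threefold m n).Opens :=
  specOpen (coord m n (Fin.castLE (by decide) i))

/-- A prime containing both `x` and `y` contains `xᵐ v - yⁿ u = 1`. -/
lemma coordOpens_sup {m n : ℕ} (hm : 1 ≤ m) (hn : 1 ≤ n) :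
    coordOpens m n 0 ⊔ coordOpens m n 1 = ⊤ := by
  refine top_unique fun p _ ↦ ?_
  by_contra h
  have h' : p ∉ (coordOpens m n 0 : Set (Threefold m n)) ∧ p ∉ (coordOpens m n 1 : Set _) := by
    rw [← not_or]
    exact h
  have hx : coord m n 0 ∈ p.asIdeal := by
    by_contra hx
    exact h'.1 hx
  have hy : coord m n 1 ∈ p.asIdeal := by
    by_contra hy
    exact h'.2 hy
  refine p.2.ne_top ((Ideal.eq_top_iff_one _).mpr ?_)
  rw [← coord_relation m n]
  exact sub_mem (Ideal.mul_mem_right _ _ (Ideal.pow_mem_of_mem _ hx _ hm))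
    (Ideal.mul_mem_right _ _ (Ideal.pow_mem_of_mem _ hy _ hn))

lemma isUnit_funOn_zero {U : (Threefold m n).Opens} (h : U ≤ coordOpens m n 0) :
    IsUnit (funOn m n U (coord m n 0)) :=
  isUnit_specFun (R := ThreefoldRing m n) h

lemma isUnit_funOn_one {U : (Threefold m n).Opens} (h : U ≤ coordOpens m n 1) :
    IsUnit (funOn m n U (coord m n 1)) :=
  isUnit_specFun (R := ThreefoldRing m n) h

end Quotient

/-! ### The quotient morphism and its invariance -/

section Quotient

variable {m n : ℕ}

/-- The ring map `ℂ[u][T] → L` with given values at `u` and `T`. -/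
def planeEval {L : Type} [CommRing L] (f : ℂ →+* L) (s t : L) : PlaneRing →+* L :=
  Polynomial.eval₂RingHom (Polynomial.eval₂RingHom f s) t

section

variable {L : Type} [CommRing L] (f : ℂ →+* L) (s t : L)

@[simp] lemma planeEval_X : planeEval f s t Polynomial.X = t := by
  simp [planeEval]

@[simp] lemma planeEval_C_X : planeEval f s t (Polynomial.C Polynomial.X) = s := by
  simp [planeEval]

@[simp] lemma planeEval_C_C (z : ℂ) : planeEval f s t (Polynomial.C (Polynomial.C z)) = f z := by
  simp [planeEval]

lemma planeRing_hom_ext {φ ψ : PlaneRing →+* L}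
    (h : ∀ z : ℂ, φ (Polynomial.C (Polynomial.C z)) = ψ (Polynomial.C (Polynomial.C z)))
    (hu : φ (Polynomial.C Polynomial.X) = ψ (Polynomial.C Polynomial.X))
    (ht : φ Polynomial.X = ψ Polynomial.X) : φ = ψ := by
  refine Polynomial.ringHom_ext (fun a ↦ ?_) ht
  exact DFunLike.congr_fun (Polynomial.ringHom_ext (f := φ.comp Polynomial.C)
    (g := ψ.comp Polynomial.C) h hu) a

end

/-- A quadruple of functions `x, y, u, v` with `x ^ m * v - y ^ n * u = 1` defines a morphism to the
surface, given by `(y / x, xⁿ u)` where `x` is invertible and by `(x / y, yᵐ v)` where `y` is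
invertible. -/
lemma exists_hom_surface {Z : Scheme.{0}} {U₀ U₁ : Z.Opens} (hU : U₀ ⊔ U₁ = ⊤) (f : ℂ →+* Γ(Z, ⊤))
    {x y u v : Γ(Z, ⊤)} (hr : x ^ m * v - y ^ n * u = 1) (hx : IsUnit (res Z (le_top : U₀ ≤ ⊤) x))
    (hy : IsUnit (res Z (le_top : U₁ ≤ ⊤) y)) :
    ∃ (g : Z ⟶ Surface (m + n) m) (s₀ : Γ(Z, U₀)) (s₁ : Γ(Z, U₁)),
      s₀ * res Z le_top x = res Z le_top y ∧ s₁ * res Z le_top y = res Z le_top x ∧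
      ChartOn (bundleChart (m + n) (LaurentPolynomial.T m) 0) g U₀
        (planeEval ((res Z le_top).comp f) s₀ (res Z le_top (x ^ n * u))) ∧
      ChartOn (bundleChart (m + n) (LaurentPolynomial.T m) 1) g U₁
        (planeEval ((res Z le_top).comp f) s₁ (res Z le_top (y ^ m * v))) := by
  obtain ⟨a, ha⟩ := hx
  obtain ⟨b, hb⟩ := hy
  let W := U₀ ⊓ U₁
  let X : Γ(Z, W)ˣ := Units.map (res _ (inf_le_left : W ≤ _)).toMonoidHom a
  let Y : Γ(Z, W)ˣ := Units.map (res _ (inf_le_right : W ≤ _)).toMonoidHom b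
  have hX : X.val = res Z le_top x := by
    rw [← res_res inf_le_left le_top, ← ha]
    rfl
  have hY : Y.val = res Z le_top y := by
    rw [← res_res inf_le_right le_top, ← hb]
    rfl
  have hX' : res Z inf_le_left (a⁻¹).val = (X⁻¹).val := rfl
  have hY' : res Z inf_le_right (b⁻¹).val = (Y⁻¹).val := rfl
  replace hr := congrArg (res Z (le_top : W ≤ ⊤)) hr
  simp only [map_sub, map_mul, map_pow, map_one, ← hX, ← hY] at hr
  -- On the overlap the coordinate `u` of the first chart takes the value `y / x`.
  let e : ℂ[T;T⁻¹] →+* Γ(Z, W) :=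
    LaurentPolynomial.eval₂ ((res Z le_top).comp f) (Y * X⁻¹)
  have he : e (LaurentPolynomial.T (-1)) = X.val * (Y⁻¹).val := by
    have := LaurentPolynomial.eval₂_T_neg_n ((res Z (le_top : W ≤ ⊤)).comp f) (Y * X⁻¹) 1
    rw [pow_one, Nat.cast_one] at this
    rw [this, mul_inv_rev, inv_inv, Units.val_mul]
  have he' (k : ℕ) : e (LaurentPolynomial.T k) = (Y.val * (X⁻¹).val) ^ k := by
    simp [e]
  have heC (z : ℂ) : e (LaurentPolynomial.C z) = res Z le_top (f z) := by
    simp [e]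
  clear_value e X Y
  have hs₀ : res Z (le_top : U₀ ≤ ⊤) y * (a⁻¹).val * res Z le_top x = res Z le_top y := by
    rw [← ha, Units.inv_mul_cancel_right]
  have hs₁ : res Z (le_top : U₁ ≤ ⊤) x * (b⁻¹).val * res Z le_top y = res Z le_top x := by
    rw [← hb, Units.inv_mul_cancel_right]
  obtain ⟨g, hg⟩ := exists_hom_bundle (c := LaurentPolynomial.T m) (d := m + n) hU
    (α₀ := Polynomial.eval₂RingHom ((res Z le_top).comp f) (res Z le_top y * (a⁻¹).val))
    (α₁ := Polynomial.eval₂RingHom ((res Z le_top).comp f) (res Z le_top x * (b⁻¹).val))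
    (e := e) (t₀ := res Z le_top (x ^ n * u)) (t₁ := res Z le_top (y ^ m * v))
    (by
      refine Polynomial.ringHom_ext (fun z ↦ ?_) ?_
      · simp [heC, res_res]
      · simp only [RingHom.comp_apply, Polynomial.coe_eval₂RingHom, Polynomial.eval₂_X, map_mul,
          res_res, Polynomial.toLaurent_X, hX']
        rw [← Nat.cast_one (R := ℤ), he', hY, pow_one])
    (by
      refine Polynomial.ringHom_ext (fun z ↦ ?_) ?_
      · simp [heC, res_res]
      · simp only [RingHom.comp_apply, Polynomial.coe_eval₂RingHom, Polynomial.eval₂_X, map_mul,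
          res_res, hY', AlgHom.toRingHom_eq_coe, RingHom.coe_coe, Polynomial.aeval_X, he, hX])
    (by
      have h₁ : X.val * (X⁻¹).val = 1 := X.mul_inv
      have h₂ : X.val ^ m * (X⁻¹).val ^ m = 1 := by rw [← mul_pow, h₁, one_pow]
      have h₃ : X.val ^ n * (X⁻¹).val ^ n = 1 := by rw [← mul_pow, h₁, one_pow]
      rw [he', he', res_res, res_res]
      simp only [map_mul, map_pow, ← hX, ← hY]
      change Y.val ^ m * res Z (le_top : W ≤ ⊤) v = (Y.val * (X⁻¹).val) ^ (m + n) *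
        (X.val ^ n * res Z (le_top : W ≤ ⊤) u) + (Y.val * (X⁻¹).val) ^ m
      simp only [mul_pow, pow_add]
      -- The gluing rule is the relation `xᵐ v - yⁿ u = 1` multiplied by `(y / x)ᵐ`.
      linear_combination Y.val ^ m * (X⁻¹).val ^ m * hr -
        Y.val ^ m * res Z (le_top : W ≤ ⊤) v * h₂ -
        Y.val ^ m * Y.val ^ n * (X⁻¹).val ^ m * res Z (le_top : W ≤ ⊤) u * h₃)
  exact ⟨g, _, _, hs₀, hs₁, hg⟩

variable (m n) in
/-- In local coordinates, `q` is the morphism `(x, y, u, v) ↦ (y / x, xⁿ u)` to the first chart and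
the morphism `(x, y, u, v) ↦ (x / y, yᵐ v)` to the second one. -/
def IsQuotientMorphism (q : Threefold m n ⟶ Surface (m + n) m) : Prop :=
  ∃ s₀ s₁, s₀ * funOn m n (coordOpens m n 0) (coord m n 0) = funOn m n _ (coord m n 1) ∧
    s₁ * funOn m n (coordOpens m n 1) (coord m n 1) = funOn m n _ (coord m n 0) ∧
    ChartOn (bundleChart (m + n) (LaurentPolynomial.T m) 0) q (coordOpens m n 0)
      (planeEval ((funOn m n _).comp (algebraMap ℂ _)) s₀
        (funOn m n _ (coord m n 0 ^ n * coord m n 2))) ∧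
    ChartOn (bundleChart (m + n) (LaurentPolynomial.T m) 1) q (coordOpens m n 1)
      (planeEval ((funOn m n _).comp (algebraMap ℂ _)) s₁
        (funOn m n _ (coord m n 1 ^ m * coord m n 3)))

lemma exists_isQuotientMorphism (hm : 1 ≤ m) (hn : 1 ≤ n) :
    ∃ q, IsQuotientMorphism m n q := by
  have hr := congrArg (funOn m n ⊤) (coord_relation m n)
  simp only [map_sub, map_mul, map_pow, map_one] at hr
  obtain ⟨q, s₀, s₁, h⟩ := exists_hom_surface (coordOpens_sup hm hn)
    ((funOn m n ⊤).comp (algebraMap ℂ _)) hr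
    (by rw [res_funOn]; exact isUnit_funOn_zero m n le_rfl)
    (by rw [res_funOn]; exact isUnit_funOn_one m n le_rfl)
  have e (U : (Threefold m n).Opens) : (res _ (le_top : U ≤ ⊤)).comp
      ((funOn m n ⊤).comp (algebraMap ℂ _)) = (funOn m n U).comp (algebraMap ℂ _) :=
    RingHom.ext fun z ↦ res_funOn m n _ _
  simp only [← map_pow, ← map_mul, res_funOn, e] at h
  exact ⟨q, s₀, s₁, h⟩

variable {q : Threefold m n ⟶ Surface (m + n) m}

lemma IsQuotientMorphism.comp_toSpec (h : IsQuotientMorphism m n q) (hm : 1 ≤ m) (hn : 1 ≤ n) :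
    q ≫ AffineLineBundle.toSpec (m + n) (LaurentPolynomial.T m) = Threefold.toSpec m n := by
  obtain ⟨s₀, s₁, hs₀, hs₁, h₀, h₁⟩ := h
  have key (U : (Threefold m n).Opens) : ChartOn (𝟙 _) (Threefold.toSpec m n) U
      ((funOn m n U).comp (algebraMap ℂ (ThreefoldRing m n))) := by
    have := chartOn_specMap (j := 𝟙 (Spec (.of ℂ))) (algebraMap ℂ (ThreefoldRing m n)) U
    rwa [Category.comp_id] at this
  have w (i : Fin 2) : bundleChart (m + n) (LaurentPolynomial.T m) i ≫
      AffineLineBundle.toSpec (m + n) (LaurentPolynomial.T m) =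
      Spec.map (CommRingCat.ofHom (algebraMap ℂ PlaneRing)) ≫ 𝟙 (Spec (.of ℂ)) := by
    rw [Category.comp_id]
    match i with
    | 0 => exact pushout.inl_desc _ _ _
    | 1 => exact pushout.inr_desc _ _ _
  have k₀ := h₀.postcomp (w 0)
  have k₁ := h₁.postcomp (w 1)
  refine ChartOn.hom_ext (coordOpens_sup hm hn) k₀ k₁ ?_ ?_
  · convert key _ using 1
    ext z
    simp [Polynomial.algebraMap_apply]
  · convert key _ using 1
    ext z
    simp [Polynomial.algebraMap_apply]

/-- Together with the monomials in `v` below, these invariants descend to the surface, so they agree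
on points with the same image. They suffice to recover the scalar relating two such points. -/
lemma IsQuotientMorphism.exists_appTop_u (h : IsQuotientMorphism m n q) (hm : 1 ≤ m) (hn : 1 ≤ n)
    {i k : ℕ} (hik : i + k = n) : ∃ e, q.appTop e =
      funOn m n ⊤ (coord m n 0 ^ i * coord m n 1 ^ k * coord m n 2) := by
  obtain ⟨s₀, s₁, hs₀, hs₁, h₀, h₁⟩ := h
  obtain ⟨e, he₀, he₁⟩ := exists_function_u m n i k hik
  refine ⟨e, section_ext le_top le_top (coordOpens_sup hm hn).ge ?_ ?_⟩
  · refine (h₀.res_appTop he₀).trans ?_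
    rw [res_funOn]
    have hp (a : Γ(Threefold m n, coordOpens m n 0)) : a ^ n = a ^ i * a ^ k := by
      rw [← pow_add, hik]
    simp only [map_mul, map_pow, planeEval_X, planeEval_C_X, ← hs₀, hp]
    ring
  · refine (h₁.res_appTop he₁).trans ?_
    rw [res_funOn]
    have hr := congrArg (funOn m n (coordOpens m n 1)) (coord_relation m n)
    simp only [map_mul, map_pow, map_sub, map_one] at hr
    simp only [map_mul, map_pow, map_sub, map_one, planeEval_X, planeEval_C_X]
    have hp (a : Γ(Threefold m n, coordOpens m n 1)) : a ^ n = a ^ i * a ^ k := by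
      rw [← pow_add, hik]
    rw [hp, ← hs₁] at hr
    rw [← hs₁]
    -- With `x = s₁ y`, the relation turns `yᵐ xᵐ-type` terms of the second chart into `yⁿ u`, up to
    -- the factor `s₁ⁱ`.
    linear_combination s₁ ^ i * hr

lemma IsQuotientMorphism.exists_appTop_v (h : IsQuotientMorphism m n q) (hm : 1 ≤ m) (hn : 1 ≤ n)
    {i k : ℕ} (hik : i + k = m) : ∃ e, q.appTop e =
      funOn m n ⊤ (coord m n 0 ^ i * coord m n 1 ^ k * coord m n 3) := by
  obtain ⟨s₀, s₁, hs₀, hs₁, h₀, h₁⟩ := h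
  obtain ⟨e, he₀, he₁⟩ := exists_function_v m n i k hik
  refine ⟨e, section_ext le_top le_top (coordOpens_sup hm hn).ge ?_ ?_⟩
  · refine (h₀.res_appTop he₀).trans ?_
    rw [res_funOn]
    have hr := congrArg (funOn m n (coordOpens m n 0)) (coord_relation m n)
    simp only [map_mul, map_pow, map_sub, map_one] at hr
    simp only [map_mul, map_pow, map_add, map_one, planeEval_X, planeEval_C_X]
    have hp (a : Γ(Threefold m n, coordOpens m n 0)) : a ^ m = a ^ i * a ^ k := by
      rw [← pow_add, hik]
    rw [hp, ← hs₀] at hr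
    rw [← hs₀]
    linear_combination -s₀ ^ k * hr
  · refine (h₁.res_appTop he₁).trans ?_
    rw [res_funOn]
    have hp (a : Γ(Threefold m n, coordOpens m n 1)) : a ^ m = a ^ i * a ^ k := by
      rw [← pow_add, hik]
    simp only [map_mul, map_pow, planeEval_X, planeEval_C_X, ← hs₁, hp]
    ring

variable (m n) in
lemma coact_zero : coact m n (coord m n 0) =
    LaurentPolynomial.T 1 * LaurentPolynomial.C (coord m n 0) :=
  coact_coord m n 0

variable (m n) in
lemma coact_one : coact m n (coord m n 1) =
    LaurentPolynomial.T 1 * LaurentPolynomial.C (coord m n 1) :=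
  coact_coord m n 1

variable (m n) in
lemma coact_two : coact m n (coord m n 2) =
    LaurentPolynomial.T (-n) * LaurentPolynomial.C (coord m n 2) :=
  coact_coord m n 2

variable (m n) in
lemma coact_three : coact m n (coord m n 3) =
    LaurentPolynomial.T (-m) * LaurentPolynomial.C (coord m n 3) :=
  coact_coord m n 3

lemma T_one_pow_mul_T_neg {R : Type} [CommRing R] (k : ℕ) :
    (LaurentPolynomial.T 1 : R[T;T⁻¹]) ^ k * LaurentPolynomial.T (-k) = 1 := by
  rw [LaurentPolynomial.T_pow, ← LaurentPolynomial.T_add, mul_one, add_neg_cancel,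
    LaurentPolynomial.T_zero]

variable (m n) in
lemma coact_zero_pow_mul_two : coact m n (coord m n 0 ^ n * coord m n 2) =
    LaurentPolynomial.C (coord m n 0 ^ n * coord m n 2) := by
  rw [map_mul, map_pow, coact_zero, coact_two, map_mul, map_pow]
  linear_combination LaurentPolynomial.C (coord m n 0) ^ n * LaurentPolynomial.C (coord m n 2) *
    T_one_pow_mul_T_neg (R := ThreefoldRing m n) n

variable (m n) in
lemma coact_one_pow_mul_three : coact m n (coord m n 1 ^ m * coord m n 3) =
    LaurentPolynomial.C (coord m n 1 ^ m * coord m n 3) := by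
  rw [map_mul, map_pow, coact_one, coact_three, map_mul, map_pow]
  linear_combination LaurentPolynomial.C (coord m n 1) ^ m * LaurentPolynomial.C (coord m n 3) *
    T_one_pow_mul_T_neg (R := ThreefoldRing m n) m

/-- The action multiplies `x` and `y` by the unit `λ`, which does not change where they vanish. -/
lemma act_preimage_coordOpens (i : Fin 2) :
    act m n ⁻¹ᵁ coordOpens m n i = proj m n ⁻¹ᵁ coordOpens m n i := by
  ext p
  change coact m n (coord m n _) ∉ p.asIdeal ↔ LaurentPolynomial.C (coord m n _) ∉ p.asIdeal
  have h : coact m n (coord m n (Fin.castLE (by decide) i)) = LaurentPolynomial.T 1 *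
      LaurentPolynomial.C (coord m n (Fin.castLE (by decide) i)) := by
    match i with
    | 0 => exact coact_zero m n
    | 1 => exact coact_one m n
  rw [h, not_iff_not]
  refine ⟨fun h ↦ ?_, fun h ↦ Ideal.mul_mem_left _ _ h⟩
  have := p.asIdeal.mul_mem_left (LaurentPolynomial.T (-1)) h
  rwa [← mul_assoc, ← LaurentPolynomial.T_add, neg_add_cancel, LaurentPolynomial.T_zero,
    one_mul] at this

/-- Both composites have the same expression in each chart, because `y / x`, `xⁿ u` and `x / y`, `yᵐ
v` have weight zero. -/
lemma IsQuotientMorphism.act_comp (h : IsQuotientMorphism m n q) (hm : 1 ≤ m) (hn : 1 ≤ n) :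
    act m n ≫ q = proj m n ≫ q := by
  obtain ⟨s₀, s₁, hs₀, hs₁, h₀, h₁⟩ := h
  have hU : proj m n ⁻¹ᵁ coordOpens m n 0 ⊔ proj m n ⁻¹ᵁ coordOpens m n 1 = ⊤ := by
    rw [← Scheme.Hom.preimage_sup, coordOpens_sup hm hn]
    rfl
  have hT (W : (GmThreefold m n).Opens) : IsUnit (gmFunOn m n W (LaurentPolynomial.T 1)) :=
    RingHom.isUnit_map _ (LaurentPolynomial.isUnit_T 1)
  have hx : IsUnit (gmFunOn m n (proj m n ⁻¹ᵁ coordOpens m n 0)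
      (LaurentPolynomial.C (coord m n 0))) := by
    rw [← proj_appLE_funOn (U := coordOpens m n 0) (h := le_rfl)]
    exact RingHom.isUnit_map _ (isUnit_funOn_zero m n le_rfl)
  have hy : IsUnit (gmFunOn m n (proj m n ⁻¹ᵁ coordOpens m n 1)
      (LaurentPolynomial.C (coord m n 1))) := by
    rw [← proj_appLE_funOn (U := coordOpens m n 1) (h := le_rfl)]
    exact RingHom.isUnit_map _ (isUnit_funOn_one m n le_rfl)
  refine ChartOn.hom_ext hU (h₀.comp (act m n) _ (act_preimage_coordOpens 0).ge)
    (h₁.comp (act m n) _ (act_preimage_coordOpens 1).ge) ?_ ?_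
  · convert h₀.comp (proj m n) _ le_rfl using 1
    have k₁ := congrArg ((act m n).appLE _ _ (act_preimage_coordOpens 0).ge) hs₀
    have k₂ := congrArg ((proj m n).appLE _ _ le_rfl) hs₀
    rw [map_mul, act_appLE_funOn, act_appLE_funOn, coact_zero, coact_one, map_mul, map_mul] at k₁
    rw [map_mul, proj_appLE_funOn, proj_appLE_funOn] at k₂
    refine planeRing_hom_ext (fun z ↦ ?_) ?_ ?_
    · simp only [RingHom.comp_apply, planeEval_C_C]
      exact (act_appLE_funOn m n _ _).trans ((congrArg _ (coact_algebraMap m n z)).trans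
        (proj_appLE_funOn m n _ _).symm)
    · simp only [RingHom.comp_apply, planeEval_C_X]
      -- `s₀ = y / x` is known only through `s₀ x = y`, so its invariance is checked after
      -- multiplication by the unit `λ x`.
      refine ((hT _).mul hx).mul_right_cancel ?_
      linear_combination k₁ - gmFunOn m n _ (LaurentPolynomial.T 1) * k₂
    · simp only [RingHom.comp_apply, planeEval_X]
      exact (act_appLE_funOn m n _ _).trans ((congrArg _ (coact_zero_pow_mul_two m n)).trans
        (proj_appLE_funOn m n _ _).symm)
  · convert h₁.comp (proj m n) _ le_rfl using 1
    have k₁ := congrArg ((act m n).appLE _ _ (act_preimage_coordOpens 1).ge) hs₁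
    have k₂ := congrArg ((proj m n).appLE _ _ le_rfl) hs₁
    rw [map_mul, act_appLE_funOn, act_appLE_funOn, coact_zero, coact_one, map_mul, map_mul] at k₁
    rw [map_mul, proj_appLE_funOn, proj_appLE_funOn] at k₂
    refine planeRing_hom_ext (fun z ↦ ?_) ?_ ?_
    · simp only [RingHom.comp_apply, planeEval_C_C]
      exact (act_appLE_funOn m n _ _).trans ((congrArg _ (coact_algebraMap m n z)).trans
        (proj_appLE_funOn m n _ _).symm)
    · simp only [RingHom.comp_apply, planeEval_C_X]
      refine ((hT _).mul hy).mul_right_cancel ?_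
      linear_combination k₁ - gmFunOn m n _ (LaurentPolynomial.T 1) * k₂
    · simp only [RingHom.comp_apply, planeEval_X]
      exact (act_appLE_funOn m n _ _).trans ((congrArg _ (coact_one_pow_mul_three m n)).trans
        (proj_appLE_funOn m n _ _).symm)

end Quotient

/-! ### Zariski locally trivial principal bundles are geometric quotients -/

section PrincipalBundles

section

variable {X Y Z : Scheme.{0}}

lemma appLE_appLE (f : X ⟶ Y) (g : Y ⟶ Z) {U : Z.Opens} {V : Y.Opens} {W : X.Opens}
    (e₁ : V ≤ g ⁻¹ᵁ U) (e₂ : W ≤ f ⁻¹ᵁ V) (e : W ≤ (f ≫ g) ⁻¹ᵁ U) (s : Γ(Z, U)) :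
    f.appLE V W e₂ (g.appLE U V e₁ s) = (f ≫ g).appLE U W e s :=
  ConcreteCategory.congr_hom (Scheme.Hom.appLE_comp_appLE f g U V W e₁ e₂) s

lemma appLE_congr_hom {f g : X ⟶ Y} (h : f = g) {U : Y.Opens} {W : X.Opens} (e : W ≤ f ⁻¹ᵁ U)
    (e' : W ≤ g ⁻¹ᵁ U) (s : Γ(Y, U)) : f.appLE U W e s = g.appLE U W e' s := by
  subst h
  rfl

lemma res_appLE (f : X ⟶ Y) {U : Y.Opens} {V W : X.Opens} (h : V ≤ W) (e : W ≤ f ⁻¹ᵁ U)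
    (s : Γ(Y, U)) : res X h (f.appLE U W e s) = f.appLE U V (h.trans e) s :=
  ConcreteCategory.congr_hom (Scheme.Hom.appLE_map f e (homOfLE h).op) s

lemma appLE_res (f : X ⟶ Y) {U V : Y.Opens} {W : X.Opens} (h : U ≤ V) (e : W ≤ f ⁻¹ᵁ U)
    (s : Γ(Y, V)) : f.appLE U W e (res Y h s) = f.appLE V W (e.trans fun _ hx ↦ h hx) s :=
  ConcreteCategory.congr_hom (Scheme.Hom.map_appLE f e (homOfLE h).op) s

lemma ι_appLE_bijective (V : X.Opens) : Function.Bijective (V.ι.appLE V ⊤ (by simp)) := by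
  have h : V.ι.appLE V ⊤ (by simp) = V.topIso.inv := by
    rw [Scheme.Opens.ι_appLE, Scheme.Opens.topIso_inv]
    rfl
  rw [h]
  exact ConcreteCategory.bijective_of_isIso V.topIso.inv

lemma sections_ext {I : Type} {U : X.Opens} (V : I → X.Opens) (hV : ∀ i, V i ≤ U)
    (h : U ≤ ⨆ i, V i) {s t : Γ(X, U)} (hst : ∀ i, res X (hV i) s = res X (hV i) t) : s = t :=
  X.sheaf.eq_of_locally_eq' V U (fun i ↦ homOfLE (hV i)) h s t hst

lemma exists_glue {I : Type} {U : X.Opens} (V : I → X.Opens) (hV : ∀ i, V i ≤ U)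
    (h : U ≤ ⨆ i, V i) (s : ∀ i, Γ(X, V i))
    (hs : ∀ i j, res X (inf_le_left : V i ⊓ V j ≤ V i) (s i) = res X inf_le_right (s j)) :
    ∃ t : Γ(X, U), ∀ i, res X (hV i) t = s i :=
  (X.sheaf.existsUnique_gluing' V U (fun i ↦ homOfLE (hV i)) h s hs).exists

end

variable {R X S : Scheme.{0}} {a p : R ⟶ X} {q : X ⟶ S}

lemma IsPrincipalBundle.exists_section_le (h : IsPrincipalBundle a p q) {U : S.Opens} {s : S}
    (hs : s ∈ U) : ∃ V : S.Opens, s ∈ V ∧ V ≤ U ∧ ∃ σ : V.toScheme ⟶ X, σ ≫ q = V.ι := by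
  obtain ⟨V, hV, σ, hσ⟩ := h.exists_section s
  exact ⟨V ⊓ U, ⟨hV, hs⟩, inf_le_right, S.homOfLE inf_le_left ≫ σ, by simp [hσ]⟩

/-- Pullback along a local section `σ` undoes pullback along `q`, so a function is determined
locally by its pullback. -/
lemma IsPrincipalBundle.app_injective (h : IsPrincipalBundle a p q) (U : S.Opens) :
    Function.Injective (q.app U) := by
  intro s t hst
  choose V hV hVU σ hσ using fun x : U ↦ h.exists_section_le x.2
  refine sections_ext V hVU (fun x hx ↦ TopologicalSpace.Opens.mem_iSup.mpr ⟨⟨x, hx⟩, hV _⟩)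
    fun x ↦ (ι_appLE_bijective (V x)).1 ?_
  rw [Scheme.Hom.app_eq_appLE] at hst
  have hle : ⊤ ≤ (σ x ≫ q) ⁻¹ᵁ U := by
    rw [hσ]
    exact fun y _ ↦ hVU x y.2
  have key (r : Γ(S, U)) : (V x).ι.appLE (V x) ⊤ (by simp) (res S (hVU x) r) =
      (σ x).appLE (q ⁻¹ᵁ U) ⊤ hle (q.appLE U _ le_rfl r) := by
    rw [appLE_res]
    exact (appLE_congr_hom (hσ x).symm _ hle _).trans (appLE_appLE (σ x) q le_rfl hle hle r).symm
  rw [key, key, hst]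

/-- An invariant function takes the same values at points with the same image. -/
lemma IsPrincipalBundle.appLE_eq_appLE (h : IsPrincipalBundle a p q) {U : S.Opens}
    {f : Γ(X, q ⁻¹ᵁ U)} (hf : ∀ (W : R.Opens) (ha : W ≤ a ⁻¹ᵁ (q ⁻¹ᵁ U)) (hp : W ≤ p ⁻¹ᵁ (q ⁻¹ᵁ U)),
        a.appLE (q ⁻¹ᵁ U) W ha f = p.appLE (q ⁻¹ᵁ U) W hp f) {Z : Scheme.{0}} {x y : Z ⟶ X}
    (w : x ≫ q = y ≫ q) {W : Z.Opens} (hx : W ≤ x ⁻¹ᵁ (q ⁻¹ᵁ U)) (hy : W ≤ y ⁻¹ᵁ (q ⁻¹ᵁ U)) :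
    x.appLE _ W hx f = y.appLE _ W hy f := by
  obtain ⟨l, rfl, rfl⟩ : ∃ l, l ≫ a = x ∧ l ≫ p = y :=
    ⟨h.isPullback.lift _ _ w, h.isPullback.lift_fst _ _ w, h.isPullback.lift_snd _ _ w⟩
  have hW : a ⁻¹ᵁ (q ⁻¹ᵁ U) ≤ p ⁻¹ᵁ (q ⁻¹ᵁ U) := by
    change (a ≫ q) ⁻¹ᵁ U ≤ (p ≫ q) ⁻¹ᵁ U
    rw [h.isPullback.w]
  have hl : W ≤ l ⁻¹ᵁ (a ⁻¹ᵁ (q ⁻¹ᵁ U)) := hx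
  have k := congrArg (l.appLE _ W hl) (hf _ le_rfl hW)
  rwa [appLE_appLE _ _ _ _ hx, appLE_appLE _ _ _ _ hy] at k

/-- The descended function is `g = σ^* f`. A point and `σ` of its image have the same image under
`q`, so the invariant `f` has the same value at both. -/
lemma IsPrincipalBundle.exists_appLE_eq (h : IsPrincipalBundle a p q) {U V : S.Opens}
    {f : Γ(X, q ⁻¹ᵁ U)} (hf : ∀ (W : R.Opens) (ha : W ≤ a ⁻¹ᵁ (q ⁻¹ᵁ U)) (hp : W ≤ p ⁻¹ᵁ (q ⁻¹ᵁ U)),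
        a.appLE (q ⁻¹ᵁ U) W ha f = p.appLE (q ⁻¹ᵁ U) W hp f) (hVU : V ≤ U) {σ : V.toScheme ⟶ X}
    (hσ : σ ≫ q = V.ι) (hqV : q ⁻¹ᵁ V ≤ q ⁻¹ᵁ U) :
    ∃ g : Γ(S, V), q.appLE V (q ⁻¹ᵁ V) le_rfl g = res X hqV f := by
  have hle : ⊤ ≤ σ ⁻¹ᵁ (q ⁻¹ᵁ U) := by
    change ⊤ ≤ (σ ≫ q) ⁻¹ᵁ U
    rw [hσ]
    exact fun y _ ↦ hVU y.2
  obtain ⟨g, hg⟩ := (ι_appLE_bijective V).2 (σ.appLE (q ⁻¹ᵁ U) ⊤ hle f)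
  refine ⟨g, (ι_appLE_bijective _).1 ?_⟩
  have hr : q ∣_ V ≫ V.ι = (q ⁻¹ᵁ V).ι ≫ q := morphismRestrict_ι q V
  have w : (q ∣_ V ≫ σ) ≫ q = (q ⁻¹ᵁ V).ι ≫ q := by rw [Category.assoc, hσ, hr]
  have h₁ : ⊤ ≤ (q ∣_ V ≫ σ) ⁻¹ᵁ (q ⁻¹ᵁ U) := by
    change ⊤ ≤ ((q ∣_ V ≫ σ) ≫ q) ⁻¹ᵁ U
    rw [w]
    exact fun y _ ↦ hqV y.2
  have h₂ : ⊤ ≤ (q ⁻¹ᵁ V).ι ⁻¹ᵁ (q ⁻¹ᵁ U) := fun y _ ↦ hqV y.2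
  have h₃ : ⊤ ≤ ((q ⁻¹ᵁ V).ι ≫ q) ⁻¹ᵁ V := fun y _ ↦ y.2
  have h₄ : ⊤ ≤ (q ∣_ V ≫ V.ι) ⁻¹ᵁ V := by
    rw [hr]
    exact h₃
  have h₅ : (⊤ : (q ⁻¹ᵁ V).toScheme.Opens) ≤ (q ∣_ V) ⁻¹ᵁ ⊤ := le_rfl
  rw [appLE_res, ← h.appLE_eq_appLE hf w h₁ h₂, appLE_appLE _ _ _ _ h₃,
    ← appLE_appLE (q ∣_ V) σ hle h₅ h₁, ← hg, appLE_appLE _ _ _ _ h₄]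
  exact appLE_congr_hom hr.symm _ _ _

/-- The local descents along sections agree on overlaps because pullback along `q` is injective, so
they glue. -/
lemma IsPrincipalBundle.exists_app_eq (h : IsPrincipalBundle a p q) (U : S.Opens)
    (f : Γ(X, q ⁻¹ᵁ U)) (hf : ∀ (W : R.Opens) (ha : W ≤ a ⁻¹ᵁ (q ⁻¹ᵁ U)) (hp : W ≤ p ⁻¹ᵁ (q ⁻¹ᵁ U)),
        a.appLE (q ⁻¹ᵁ U) W ha f = p.appLE (q ⁻¹ᵁ U) W hp f) : ∃ g : Γ(S, U), q.app U g = f := by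
  choose V hV hVU σ hσ using fun x : U ↦ h.exists_section_le x.2
  have hUV : U ≤ ⨆ x, V x := fun x hx ↦ TopologicalSpace.Opens.mem_iSup.mpr ⟨⟨x, hx⟩, hV _⟩
  have hqV (x : U) : q ⁻¹ᵁ V x ≤ q ⁻¹ᵁ U := fun _ hy ↦ hVU x hy
  choose g key using fun x ↦ h.exists_appLE_eq hf (hVU x) (hσ x) (hqV x)
  obtain ⟨t, ht⟩ := exists_glue V hVU hUV g fun x y ↦ by
    refine h.app_injective _ ?_
    rw [Scheme.Hom.app_eq_appLE, appLE_res, appLE_res]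
    have h₁ := congrArg (res X (show q ⁻¹ᵁ (V x ⊓ V y) ≤ q ⁻¹ᵁ V x from fun _ hz ↦ hz.1)) (key x)
    have h₂ := congrArg (res X (show q ⁻¹ᵁ (V x ⊓ V y) ≤ q ⁻¹ᵁ V y from fun _ hz ↦ hz.2)) (key y)
    rw [res_appLE, res_res] at h₁ h₂
    rw [h₁, h₂]
  refine ⟨t, sections_ext (fun x ↦ q ⁻¹ᵁ V x) hqV (fun x hx ↦ ?_) fun x ↦ ?_⟩
  · obtain ⟨i, hi⟩ := TopologicalSpace.Opens.mem_iSup.mp (hUV hx)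
    exact TopologicalSpace.Opens.mem_iSup.mpr ⟨i, hi⟩
  · rw [← key, ← ht, Scheme.Hom.app_eq_appLE, res_appLE, appLE_res]

lemma IsPrincipalBundle.surjective (h : IsPrincipalBundle a p q) : Function.Surjective q := by
  intro s
  obtain ⟨U, hs, σ, hσ⟩ := h.exists_section s
  exact ⟨σ ⟨s, hs⟩, congrArg (fun f : U.toScheme ⟶ S ↦ f ⟨s, hs⟩) hσ⟩

/-- Over an open set with a section `σ`, membership in `t` can be tested on the preimage of `q⁻¹(t)`
under `σ`, which is open. -/
lemma IsPrincipalBundle.isQuotientMap (h : IsPrincipalBundle a p q) :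
    Topology.IsQuotientMap q := by
  refine ⟨Topology.isCoinducing_iff.mpr fun t ↦ ⟨fun ht ↦ ?_, fun ht ↦ ht.preimage q.continuous⟩,
    h.surjective⟩
  refine isOpen_iff_mem_nhds.mpr fun s hs ↦ ?_
  obtain ⟨U, hsU, σ, hσ⟩ := h.exists_section s
  have hq (y : U) : q (σ y) = y := congrArg (fun f : U.toScheme ⟶ S ↦ f y) hσ
  have ht' : IsOpen {y : U | q (σ y) ∈ t} := ht.preimage σ.continuous
  have h₁ := U.isOpenEmbedding.isOpenMap _ ht'
  refine Filter.mem_of_superset (h₁.mem_nhds (x := s)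
    ⟨⟨s, hsU⟩, (congrArg (· ∈ t) (hq ⟨s, hsU⟩)).mpr hs, rfl⟩) ?_
  rintro _ ⟨y, hy, rfl⟩
  exact (congrArg (· ∈ t) (hq y)).mp hy

/-- The map to the fibre product is the comparison isomorphism of two pullbacks. -/
lemma IsPrincipalBundle.orbits (h : IsPrincipalBundle a p q) :
    Surjective (pullback.lift a p h.isPullback.w) := by
  have : pullback.lift a p h.isPullback.w = h.isPullback.isoPullback.hom := by
    refine pullback.hom_ext ?_ ?_
    · rw [pullback.lift_fst, IsPullback.isoPullback_hom_fst]
    · rw [pullback.lift_snd, IsPullback.isoPullback_hom_snd]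
  rw [this]
  infer_instance

/-- A Zariski locally trivial principal bundle is a geometric quotient. -/
lemma IsPrincipalBundle.isGeometricQuotient (h : IsPrincipalBundle a p q) :
    IsGeometricQuotient a p q where
  w := h.isPullback.w
  surjective := h.surjective
  orbits := h.orbits
  isQuotientMap := h.isQuotientMap
  injective := h.app_injective
  invariants U f := by
    refine ⟨?_, h.exists_app_eq U f⟩
    rintro ⟨g, rfl⟩ W ha hp
    rw [Scheme.Hom.app_eq_appLE]
    exact (appLE_appLE a q le_rfl ha ha g).trans ((appLE_congr_hom h.isPullback.w ha hp g).trans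
      (appLE_appLE p q le_rfl hp hp g).symm)

end PrincipalBundles

/-! ### Pullbacks and morphisms to affine schemes -/

section UniversalProperties

lemma isPullback_of_existsUnique {C : Type*} [Category C] {R X Y S : C} {a : R ⟶ X} {p : R ⟶ Y}
    {f : X ⟶ S} {g : Y ⟶ S} (w : a ≫ f = p ≫ g)
    (h : ∀ (Z : C) (x : Z ⟶ X) (y : Z ⟶ Y), x ≫ f = y ≫ g → ∃! l : Z ⟶ R, l ≫ a = x ∧ l ≫ p = y) :
    IsPullback a p f g := by
  choose l hl hl' using fun s : PullbackCone f g ↦ h s.pt s.fst s.snd s.condition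
  exact ⟨⟨w⟩, ⟨PullbackCone.IsLimit.mk w l (fun s ↦ (hl s).1) (fun s ↦ (hl s).2)
    fun s k hk hk' ↦ hl' s k ⟨hk, hk'⟩⟩⟩

variable {R R' : Type} [CommRing R] [CommRing R'] {W : Scheme.{0}}

/-- The comorphism of a morphism to the spectrum of a ring. -/
def coHom (f : W ⟶ Spec (.of R)) : R →+* Γ(W, ⊤) := f.appTop.hom.comp (specFun ⊤)

lemma coHom_injective {f g : W ⟶ Spec (.of R)} (h : coHom f = coHom g) : f = g := by
  refine ext_of_isAffine ?_
  rw [← Iso.cancel_iso_inv_left (Scheme.ΓSpecIso (.of R))]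
  ext a
  have := DFunLike.congr_fun h a
  simp only [coHom, RingHom.comp_apply, specFun_top] at this
  exact this

lemma coHom_comp (f : W ⟶ Spec (.of R')) {F : Spec (.of R') ⟶ Spec (.of R)} {φ : R →+* R'}
    (hF : F = Spec.map (CommRingCat.ofHom φ)) : coHom (f ≫ F) = (coHom f).comp φ := by
  ext a
  have := appLE_specFun hF (U := ⊤) (W := ⊤) le_rfl a
  have h : F.appLE ⊤ ⊤ le_rfl = F.appTop := F.appLE_eq_app (U := ⊤)
  rw [h] at this
  simp only [coHom, RingHom.comp_apply, ← this]
  rw [Scheme.Hom.comp_appTop]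
  rfl

lemma exists_coHom_eq (φ : R →+* Γ(W, ⊤)) : ∃ f : W ⟶ Spec (.of R), coHom f = φ := by
  refine ⟨W.toSpecΓ ≫ Spec.map (CommRingCat.ofHom φ), ?_⟩
  ext a
  rw [coHom, RingHom.comp_apply, specFun_top, Scheme.Hom.comp_appTop]
  have h₁ := Scheme.ΓSpecIso_inv_naturality (CommRingCat.ofHom φ)
  have h₂ : (Scheme.ΓSpecIso _).inv ≫ W.toSpecΓ.appTop = 𝟙 Γ(W, ⊤) := by
    rw [Scheme.toSpecΓ_appTop, Iso.inv_hom_id]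
  have h₃ := congrArg (· ≫ W.toSpecΓ.appTop) h₁
  refine (ConcreteCategory.congr_hom h₃ a).symm.trans ?_
  exact ConcreteCategory.congr_hom h₂ (φ a)

end UniversalProperties

/-! ### Ring-valued points of the threefold and their orbits -/

section Algebra

variable {L : Type} [CommRing L] {m n : ℕ}

lemma threefoldRing_hom_ext {φ ψ : ThreefoldRing m n →+* L}
    (h : ∀ z : ℂ, φ (algebraMap ℂ _ z) = ψ (algebraMap ℂ _ z))
    (h' : ∀ i, φ (coord m n i) = ψ (coord m n i)) : φ = ψ :=
  Ideal.Quotient.ringHom_ext (MvPolynomial.ringHom_ext h h')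

lemma laurent_hom_ext {A : Type} [CommRing A] {φ ψ : A[T;T⁻¹] →+* L}
    (h : ∀ a, φ (LaurentPolynomial.C a) = ψ (LaurentPolynomial.C a))
    (h' : φ (LaurentPolynomial.T 1) = ψ (LaurentPolynomial.T 1)) : φ = ψ := by
  refine IsLocalization.ringHom_ext (Submonoid.powers (Polynomial.X : Polynomial A)) ?_
  refine Polynomial.ringHom_ext (fun a ↦ ?_) ?_
  · simpa using h a
  · simpa using h'

/-- Powers of coprime elements are coprime. This replaces division by `x` or `y`, neither of which
need be invertible. -/
lemma eq_zero_of_pow_mul_eq_zero {x y d : L} {N : ℕ} (h : IsCoprime x y) (hx : x ^ N * d = 0)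
    (hy : y ^ N * d = 0) : d = 0 := by
  obtain ⟨a, b, hab⟩ := h.pow (m := N) (n := N)
  linear_combination a * hx + b * hy - d * hab

/-- The element of the multiplicative group relating two points of the threefold. -/
lemma orbit_scaling_mul (hm : 1 ≤ m) (hn : 1 ≤ n) {x y u v x' y' u' v' : L}
    (hr : x' ^ m * v' - y' ^ n * u' = 1) (hu : y' ^ n * u' = y ^ n * u)
    (hu' : x' * y' ^ (n - 1) * u' = x * y ^ (n - 1) * u) (hv : x' ^ m * v' = x ^ m * v)
    (hv' : x' ^ (m - 1) * y' * v' = x ^ (m - 1) * y * v) :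
    (x' * x ^ (m - 1) * v - y' * y ^ (n - 1) * u) * x = x' ∧
      (x' * x ^ (m - 1) * v - y' * y ^ (n - 1) * u) * y = y' := by
  have hpm (a : L) : a ^ m = a ^ (m - 1) * a := (pow_sub_one_mul (by omega) a).symm
  have hpn (a : L) : a ^ n = a ^ (n - 1) * a := (pow_sub_one_mul (by omega) a).symm
  constructor
  · linear_combination x' * hr - x' * hv - x' * v * hpm x + y' * hu' + x' * u' * hpn y'
  · linear_combination y' * hr - x' * hv' + y' * u * hpn y - y' * v' * hpm x' + y' * hu

/-- Two points of the threefold on which the invariant functions agree differ by a unique element of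
the multiplicative group. -/
lemma existsUnique_orbit (hm : 1 ≤ m) (hn : 1 ≤ n) {α β : ThreefoldRing m n →+* L}
    (hC : ∀ z : ℂ, α (algebraMap ℂ _ z) = β (algebraMap ℂ _ z))
    (hu : ∀ i k, i + k = n → α (coord m n 0 ^ i * coord m n 1 ^ k * coord m n 2) =
      β (coord m n 0 ^ i * coord m n 1 ^ k * coord m n 2))
    (hv : ∀ i k, i + k = m → α (coord m n 0 ^ i * coord m n 1 ^ k * coord m n 3) =
      β (coord m n 0 ^ i * coord m n 1 ^ k * coord m n 3)) :
    ∃! g : (ThreefoldRing m n)[T;T⁻¹] →+* L,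
      g.comp (coact m n) = α ∧ g.comp LaurentPolynomial.C = β := by
  have hα := congrArg α (coord_relation m n)
  have hβ := congrArg β (coord_relation m n)
  have hu₀ := hu n 0 rfl
  have hu₁ := hu 0 n (zero_add n)
  have hu₂ := hu 1 (n - 1) (by omega)
  have hv₀ := hv m 0 rfl
  have hv₁ := hv 0 m (zero_add m)
  have hv₂ := hv (m - 1) 1 (by omega)
  simp only [map_mul, map_pow, map_sub, map_one, pow_zero, mul_one, one_mul, pow_one]
    at hα hβ hu₀ hu₁ hu₂ hv₀ hv₁ hv₂
  have hpm (a : L) : a ^ m = a ^ (m - 1) * a := (pow_sub_one_mul (by omega) a).symm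
  have hpn (a : L) : a ^ n = a ^ (n - 1) * a := (pow_sub_one_mul (by omega) a).symm
  clear hu hv
  generalize hx' : α (coord m n 0) = x' at *
  generalize hy' : α (coord m n 1) = y' at *
  generalize hu' : α (coord m n 2) = u' at *
  generalize hv' : α (coord m n 3) = v' at *
  generalize hx : β (coord m n 0) = x at *
  generalize hy : β (coord m n 1) = y at *
  generalize hu : β (coord m n 2) = u at *
  generalize hv : β (coord m n 3) = v at *
  -- `l` carries the point `β` to `α` and `k` carries `α` back to `β`.
  obtain ⟨hlx, hly⟩ := orbit_scaling_mul hm hn hα hu₁ hu₂ hv₀ hv₂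
  obtain ⟨hkx, hky⟩ := orbit_scaling_mul hm hn hβ hu₁.symm hu₂.symm hv₀.symm hv₂.symm
  generalize hl : x' * x ^ (m - 1) * v - y' * y ^ (n - 1) * u = l at *
  generalize x * x' ^ (m - 1) * v' - y * y' ^ (n - 1) * u' = k at *
  -- Since `x'` and `y'` generate the unit ideal, the identities for `l * k`, `u'` and `v'` may be
  -- checked after multiplication by powers of each of them.
  have hc : IsCoprime x' y' := ⟨x' ^ (m - 1) * v', - (y' ^ (n - 1) * u'), by
    linear_combination hα - v' * hpm x' + u' * hpn y'⟩
  have hlk : l * k = 1 := by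
    refine sub_eq_zero.mp (eq_zero_of_pow_mul_eq_zero (N := 1) hc ?_ ?_)
    · linear_combination l * hkx + hlx
    · linear_combination l * hky + hly
  have hk (a b : L) (h : k * a = b) (N : ℕ) : a ^ N * k ^ N = b ^ N := by
    rw [← mul_pow, mul_comm a, h]
  have hlu : k ^ n * u = u' := by
    refine sub_eq_zero.mp (eq_zero_of_pow_mul_eq_zero (N := n) hc ?_ ?_)
    · linear_combination u * hk _ _ hkx n - hu₀
    · linear_combination u * hk _ _ hky n - hu₁
  have hlv : k ^ m * v = v' := by
    refine sub_eq_zero.mp (eq_zero_of_pow_mul_eq_zero (N := m) hc ?_ ?_)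
    · linear_combination v * hk _ _ hkx m - hv₀
    · linear_combination v * hk _ _ hky m - hv₁
  let t : Lˣ := ⟨l, k, hlk, by rw [mul_comm, hlk]⟩
  have hT : LaurentPolynomial.eval₂ β t (LaurentPolynomial.T 1) = l := by
    exact (LaurentPolynomial.eval₂_T_n β t 1).trans (pow_one _)
  have hT' (N : ℕ) : LaurentPolynomial.eval₂ β t (LaurentPolynomial.T (-N)) = k ^ N :=
    LaurentPolynomial.eval₂_T_neg_n β t N
  refine ⟨LaurentPolynomial.eval₂ β t, ⟨?_, ?_⟩, ?_⟩
  · refine threefoldRing_hom_ext (fun z ↦ ?_) fun i ↦ ?_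
    · rw [RingHom.comp_apply, coact_algebraMap, LaurentPolynomial.eval₂_C, hC]
    · rw [RingHom.comp_apply]
      match i with
      | 0 => rw [coact_zero, map_mul, LaurentPolynomial.eval₂_C, hT, hx, hx', hlx]
      | 1 => rw [coact_one, map_mul, LaurentPolynomial.eval₂_C, hT, hy, hy', hly]
      | 2 => rw [coact_two, map_mul, LaurentPolynomial.eval₂_C, hT', hu, hu', hlu]
      | 3 => rw [coact_three, map_mul, LaurentPolynomial.eval₂_C, hT', hv, hv', hlv]
  · exact RingHom.ext fun a ↦ LaurentPolynomial.eval₂_C _ _ _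
  · rintro g ⟨h₁, h₂⟩
    have hg (a) : g (LaurentPolynomial.C a) = β a := DFunLike.congr_fun h₂ a
    have k₁ := DFunLike.congr_fun h₁ (coord m n 0)
    have k₂ := DFunLike.congr_fun h₁ (coord m n 1)
    rw [RingHom.comp_apply, coact_zero, map_mul, hg, hx, hx'] at k₁
    rw [RingHom.comp_apply, coact_one, map_mul, hg, hy, hy'] at k₂
    refine laurent_hom_ext (fun a ↦ (hg a).trans (LaurentPolynomial.eval₂_C _ _ _).symm) ?_
    -- Uniqueness: multiply `xᵐ v - yⁿ u = 1` by `g(λ)` and use `g(λ) x = x'` and `g(λ) y = y'`.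
    rw [hT, ← hl]
    linear_combination v * x ^ (m - 1) * k₁ - u * y ^ (n - 1) * k₂ -
      g (LaurentPolynomial.T 1) * hβ + g (LaurentPolynomial.T 1) * v * hpm x -
      g (LaurentPolynomial.T 1) * u * hpn y

end Algebra

/-! ### The threefold as a principal bundle over the surface -/

section Quotient

variable {m n : ℕ} {q : Threefold m n ⟶ Surface (m + n) m}

lemma IsQuotientMorphism.coHom_eq (w : q ≫ AffineLineBundle.toSpec (m + n) (LaurentPolynomial.T m) =
    Threefold.toSpec m n) {W : Scheme.{0}} {f g : W ⟶ Threefold m n} (hfg : f ≫ q = g ≫ q) (z : ℂ) :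
    coHom (R := ThreefoldRing m n) f (algebraMap ℂ _ z) =
      coHom (R := ThreefoldRing m n) g (algebraMap ℂ _ z) := by
  have h := congrArg (· ≫ AffineLineBundle.toSpec (m + n) (LaurentPolynomial.T m)) hfg
  simp only [Category.assoc, w] at h
  have h' := congrArg (coHom (R := ℂ)) h
  have key (f : W ⟶ Threefold m n) := coHom_comp (R := ℂ) (R' := ThreefoldRing m n) f
    (F := Threefold.toSpec m n) rfl
  exact DFunLike.congr_fun ((key f).symm.trans (h'.trans (key g))) z

lemma coHom_eq_of_appTop {W : Scheme.{0}} {f g : W ⟶ Threefold m n} (hfg : f ≫ q = g ≫ q)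
    {a : ThreefoldRing m n} (h : ∃ e, q.appTop e = funOn m n ⊤ a) :
    coHom (R := ThreefoldRing m n) f a = coHom (R := ThreefoldRing m n) g a := by
  obtain ⟨e, he⟩ := h
  have key (f : W ⟶ Threefold m n) : coHom (R := ThreefoldRing m n) f a = (f ≫ q).appTop e := by
    rw [Scheme.Hom.comp_appTop]
    exact congrArg f.appTop he.symm
  rw [key, key, hfg]

/-- The threefold and its product with `𝔾ₘ` are affine, so their `W`-points are ring homomorphisms
to global functions on `W`. Equality of the images in the surface gives equality on constants and on
the invariant monomials, and `existsUnique_orbit` supplies the point of the product. -/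
lemma IsQuotientMorphism.isPullback (h : IsQuotientMorphism m n q) (hm : 1 ≤ m) (hn : 1 ≤ n) :
    IsPullback (act m n) (proj m n) q q := by
  refine isPullback_of_existsUnique (h.act_comp hm hn) fun W f g hfg ↦ ?_
  obtain ⟨φ, ⟨h₁, h₂⟩, h₃⟩ := existsUnique_orbit hm hn
    (IsQuotientMorphism.coHom_eq (h.comp_toSpec hm hn) hfg)
    (fun i k hik ↦ coHom_eq_of_appTop hfg (h.exists_appTop_u hm hn hik))
    (fun i k hik ↦ coHom_eq_of_appTop hfg (h.exists_appTop_v hm hn hik))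
  have ka (l : W ⟶ GmThreefold m n) := coHom_comp (R := ThreefoldRing m n)
    (R' := (ThreefoldRing m n)[T;T⁻¹]) l (F := act m n) rfl
  have kp (l : W ⟶ GmThreefold m n) := coHom_comp (R := ThreefoldRing m n)
    (R' := (ThreefoldRing m n)[T;T⁻¹]) l (F := proj m n) rfl
  obtain ⟨l, hl⟩ := exists_coHom_eq (R := (ThreefoldRing m n)[T;T⁻¹]) φ
  refine ⟨l, ⟨?_, ?_⟩, fun l' ⟨ha, hp⟩ ↦ ?_⟩
  · exact coHom_injective (R := ThreefoldRing m n) ((ka l).trans (by rw [hl, h₁]))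
  · exact coHom_injective (R := ThreefoldRing m n) ((kp l).trans (by rw [hl, h₂]))
  · refine coHom_injective (R := (ThreefoldRing m n)[T;T⁻¹]) ?_
    rw [hl]
    refine h₃ _ ⟨?_, ?_⟩
    · exact (ka l').symm.trans (congrArg (coHom (R := ThreefoldRing m n)) ha)
    · exact (kp l').symm.trans (congrArg (coHom (R := ThreefoldRing m n)) hp)

/-- The section of `q` over the first chart is `(u, T) ↦ (1, u, T, 1 + u ^ n * T)`, the one over the
second chart is `(u, T) ↦ (u, 1, u ^ m * T - 1, T)`. -/
def sectionPoly (m n : ℕ) (i : Fin 2) : MvPolynomial (Fin 4) ℂ →ₐ[ℂ] PlaneRing :=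
  MvPolynomial.aeval (match i with
    | 0 => ![1, .C .X, .X, 1 + .C .X ^ n * .X]
    | 1 => ![.C .X, 1, .C .X ^ m * .X - 1, .X])

lemma sectionPoly_eq (m n : ℕ) (i : Fin 2) : sectionPoly m n i (threefoldEq m n) = 0 := by
  match i with
  | 0 => simp [sectionPoly, threefoldEq]
  | 1 => simp [sectionPoly, threefoldEq]

/-- The comorphism of the section of `q` over a chart. -/
def sectionHom (m n : ℕ) (i : Fin 2) : ThreefoldRing m n →+* PlaneRing :=
  Ideal.Quotient.lift _ (sectionPoly m n i).toRingHom fun a ha ↦ by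
    obtain ⟨b, rfl⟩ := Ideal.mem_span_singleton'.mp ha
    simp [sectionPoly_eq]

lemma sectionHom_coord (m n : ℕ) (i : Fin 2) (k : Fin 4) :
    sectionHom m n i (coord m n k) = sectionPoly m n i (.X k) :=
  rfl

lemma sectionHom_algebraMap (m n : ℕ) (i : Fin 2) (z : ℂ) :
    sectionHom m n i (algebraMap ℂ _ z) = .C (.C z) :=
  (sectionPoly m n i).commutes z

/-- The section of `q` over a chart. -/
def sectionMap (m n : ℕ) (i : Fin 2) : Spec (.of PlaneRing) ⟶ Threefold m n :=
  Spec.map (CommRingCat.ofHom (sectionHom m n i))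

/-- On the slice `x = 1` the functions `y / x` and `xⁿ u` are the chart coordinates `u` and `T`;
likewise `x / y` and `yᵐ v` on the slice `y = 1`. -/
lemma IsQuotientMorphism.sectionMap_comp (h : IsQuotientMorphism m n q) (i : Fin 2) :
    sectionMap m n i ≫ q = bundleChart (m + n) (LaurentPolynomial.T m) i := by
  obtain ⟨s₀, s₁, hs₀, hs₁, h₀, h₁⟩ := h
  have hid (j : Spec (.of PlaneRing) ⟶ Surface (m + n) m) : ChartOn j j ⊤ (specFun ⊤) := by
    simpa using chartOn_specMap (j := j) (RingHom.id PlaneRing) ⊤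
  have hs (i) (U) (hU : ⊤ ≤ sectionMap m n i ⁻¹ᵁ U) (a) : (sectionMap m n i).appLE U ⊤ hU
      (funOn m n U a) = specFun ⊤ (sectionHom m n i a) :=
    appLE_specFun (R := ThreefoldRing m n) (F := sectionMap m n i) rfl hU a
  match i with
  | 0 =>
    have hU : ⊤ ≤ sectionMap m n 0 ⁻¹ᵁ coordOpens m n 0 := by
      intro p _
      change sectionHom m n 0 (coord m n 0) ∉ p.asIdeal
      have : sectionHom m n 0 (coord m n 0) = 1 := by simp [sectionHom_coord, sectionPoly]
      rw [this]
      exact (Ideal.ne_top_iff_one _).mp p.2.ne_top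
    have k := congrArg ((sectionMap m n 0).appLE _ ⊤ hU) hs₀
    rw [map_mul, hs, hs] at k
    have e : ((sectionMap m n 0).appLE _ ⊤ hU).hom.comp (planeEval ((funOn m n _).comp
        (algebraMap ℂ _)) s₀ (funOn m n _ (coord m n 0 ^ n * coord m n 2))) = specFun ⊤ := by
      refine planeRing_hom_ext (fun z ↦ ?_) ?_ ?_
      · rw [RingHom.comp_apply, planeEval_C_C]
        exact (hs _ _ _ _).trans (congrArg _ (sectionHom_algebraMap _ _ _ _))
      · rw [RingHom.comp_apply, planeEval_C_X]
        simpa [sectionHom_coord, sectionPoly] using k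
      · rw [RingHom.comp_apply, planeEval_X]
        refine (hs _ _ _ _).trans (congrArg _ ?_)
        rw [map_mul, map_pow]
        simp [sectionHom_coord, sectionPoly]
    have := (h₀.comp (sectionMap m n 0) ⊤ hU).trans (e ▸ (hid _).symm)
    exact hom_ext_of_sup_eq_top (sup_idem ⊤) this this
  | 1 =>
    have hU : ⊤ ≤ sectionMap m n 1 ⁻¹ᵁ coordOpens m n 1 := by
      intro p _
      change sectionHom m n 1 (coord m n 1) ∉ p.asIdeal
      have : sectionHom m n 1 (coord m n 1) = 1 := by simp [sectionHom_coord, sectionPoly]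
      rw [this]
      exact (Ideal.ne_top_iff_one _).mp p.2.ne_top
    have k := congrArg ((sectionMap m n 1).appLE _ ⊤ hU) hs₁
    rw [map_mul, hs, hs] at k
    have e : ((sectionMap m n 1).appLE _ ⊤ hU).hom.comp (planeEval ((funOn m n _).comp
        (algebraMap ℂ _)) s₁ (funOn m n _ (coord m n 1 ^ m * coord m n 3))) = specFun ⊤ := by
      refine planeRing_hom_ext (fun z ↦ ?_) ?_ ?_
      · rw [RingHom.comp_apply, planeEval_C_C]
        exact (hs _ _ _ _).trans (congrArg _ (sectionHom_algebraMap _ _ _ _))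
      · rw [RingHom.comp_apply, planeEval_C_X]
        simpa [sectionHom_coord, sectionPoly] using k
      · rw [RingHom.comp_apply, planeEval_X]
        refine (hs _ _ _ _).trans (congrArg _ ?_)
        rw [map_mul, map_pow]
        simp [sectionHom_coord, sectionPoly]
    have := (h₁.comp (sectionMap m n 1) ⊤ hU).trans (e ▸ (hid _).symm)
    exact hom_ext_of_sup_eq_top (sup_idem ⊤) this this

lemma IsQuotientMorphism.isPrincipalBundle (h : IsQuotientMorphism m n q) (hm : 1 ≤ m)
    (hn : 1 ≤ n) : IsPrincipalBundle (act m n) (proj m n) q where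
  isPullback := h.isPullback hm hn
  exists_section s := by
    obtain ⟨i, y, rfl⟩ := exists_bundleChart_eq _ _ s
    refine ⟨(bundleChart _ _ i).opensRange, ⟨y, rfl⟩,
      (bundleChart (m + n) (LaurentPolynomial.T m) i).isoOpensRange.inv ≫ sectionMap m n i, ?_⟩
    rw [Category.assoc, h.sectionMap_comp, Scheme.Hom.isoOpensRange_inv_comp]

end Quotient

/-! ### The standard charts of the projective line -/

section ProjectiveLine

lemma aeval_mul_of_isHomogeneous {A : Type} [CommRing A] [Algebra ℂ A] {I : Type} [Fintype I]
    {P : MvPolynomial I ℂ} {k : ℕ} (hP : P.IsHomogeneous k) (t : A) (g : I → A) :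
    MvPolynomial.aeval (fun i ↦ t * g i) P = t ^ k * MvPolynomial.aeval g P := by
  rw [MvPolynomial.aeval_def, MvPolynomial.aeval_def, MvPolynomial.eval₂_eq',
    MvPolynomial.eval₂_eq', Finset.mul_sum]
  refine Finset.sum_congr rfl fun d hd ↦ ?_
  have hk : d.degree = k := by
    by_contra h
    exact MvPolynomial.mem_support_iff.mp hd (hP.coeff_eq_zero h)
  simp_rw [mul_pow]
  rw [Finset.prod_mul_distrib, Finset.prod_pow_eq_pow_sum, ← Finsupp.degree_eq_sum, hk]
  ring

local notation "𝒜₂" => MvPolynomial.homogeneousSubmodule (Fin 2) ℂ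

/-- Evaluation on the chart number `i` before localization. -/
def dehomEval (i : Fin 2) : MvPolynomial (Fin 2) ℂ →ₐ[ℂ] Polynomial ℂ :=
  MvPolynomial.aeval (R := ℂ) fun k : Fin 2 ↦ if k = i then (1 : Polynomial ℂ) else Polynomial.X

lemma X_mem (i : Fin 2) : (MvPolynomial.X i : MvPolynomial (Fin 2) ℂ) ∈ 𝒜₂ 1 :=
  MvPolynomial.isHomogeneous_X ℂ i

lemma val_mk_mul {f : MvPolynomial (Fin 2) ℂ} {d : ℕ} (hf : f ∈ 𝒜₂ d) (k : ℕ)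
    (a : MvPolynomial (Fin 2) ℂ) (ha : a ∈ 𝒜₂ (k • d)) :
    (HomogeneousLocalization.Away.mk 𝒜₂ hf k a ha).val *
      algebraMap _ (Localization.Away f) (f ^ k) = algebraMap _ _ a := by
  rw [HomogeneousLocalization.Away.val_mk, Localization.mk_eq_mk']
  exact IsLocalization.mk'_spec (Localization.Away f) a
    (⟨f ^ k, k, rfl⟩ : Submonoid.powers f)

lemma dehomogenize_mk (i : Fin 2) (k : ℕ) (a : MvPolynomial (Fin 2) ℂ) (ha : a ∈ 𝒜₂ (k • 1)) :
    dehomogenize i (HomogeneousLocalization.Away.mk 𝒜₂ (X_mem i) k a ha) = dehomEval i a := by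
  have h₁ : IsUnit ((dehomEval i).toRingHom (MvPolynomial.X i)) := by simp [dehomEval]
  have h' := congrArg (IsLocalization.Away.lift
    (S := Localization.Away (MvPolynomial.X i : MvPolynomial (Fin 2) ℂ)) (MvPolynomial.X i) h₁)
    (val_mk_mul (X_mem i) k a ha)
  have h₂ : (dehomEval i).toRingHom (MvPolynomial.X i ^ k) = 1 := by simp [dehomEval]
  rw [map_mul, IsLocalization.Away.lift_eq, IsLocalization.Away.lift_eq, h₂, mul_one] at h'
  exact h'

/-- Homogenization undoes it: sending `u` to the quotient of the other variable by the variable `i`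
recovers the original fraction, by homogeneity of its numerator. -/
lemma dehomogenize_injective (i : Fin 2) : Function.Injective (dehomogenize i) := by
  let A := Localization.Away (MvPolynomial.X i : MvPolynomial (Fin 2) ℂ)
  let t : A := IsLocalization.Away.invSelf (MvPolynomial.X i : MvPolynomial (Fin 2) ℂ)
  have ht : algebraMap (MvPolynomial (Fin 2) ℂ) A (MvPolynomial.X i) * t = 1 := IsLocalization.Away.mul_invSelf _
  have htk (k : ℕ) : algebraMap (MvPolynomial (Fin 2) ℂ) A (MvPolynomial.X i ^ k) * t ^ k = 1 := by
    rw [map_pow, ← mul_pow, ht, one_pow]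
  obtain ⟨k, hk⟩ : ∃ k : Fin 2, ∀ l, l ≠ i → l = k :=
    ⟨1 - i, fun l hl ↦ by fin_cases i <;> fin_cases l <;> simp_all⟩
  let r : Polynomial ℂ →ₐ[ℂ] A := Polynomial.aeval (t * algebraMap (MvPolynomial (Fin 2) ℂ) A (MvPolynomial.X k))
  have hr : r.comp (dehomEval i) = MvPolynomial.aeval
      (fun l ↦ t * algebraMap (MvPolynomial (Fin 2) ℂ) A (MvPolynomial.X l)) := by
    refine MvPolynomial.algHom_ext fun l ↦ ?_
    rw [MvPolynomial.aeval_X, AlgHom.comp_apply, dehomEval, MvPolynomial.aeval_X]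
    split_ifs with h
    · rw [map_one, h, mul_comm, ht]
    · rw [Polynomial.aeval_X, hk l h]
  have ha (P : MvPolynomial (Fin 2) ℂ) :
      MvPolynomial.aeval (fun l ↦ algebraMap (MvPolynomial (Fin 2) ℂ) A (MvPolynomial.X l)) P = algebraMap _ A P := by
    have : MvPolynomial.aeval (fun l ↦ algebraMap (MvPolynomial (Fin 2) ℂ) A (MvPolynomial.X l)) =
        IsScalarTower.toAlgHom ℂ (MvPolynomial (Fin 2) ℂ) A :=
      MvPolynomial.algHom_ext fun l ↦ by simp
    exact DFunLike.congr_fun this P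
  refine Function.Injective.of_comp (f := r) ?_
  -- The composite with `r` is the inclusion of the homogeneous localization in the full
  -- localization.
  convert HomogeneousLocalization.val_injective (𝒜 := 𝒜₂) (.powers (MvPolynomial.X i)) using 1
  ext z
  obtain ⟨N, a, ha', rfl⟩ := HomogeneousLocalization.Away.mk_surjective 𝒜₂ (X_mem i) z
  have hN := val_mk_mul (X_mem i) N a ha'
  rw [Function.comp_apply, dehomogenize_mk, ← AlgHom.comp_apply, hr,
    aeval_mul_of_isHomogeneous (k := N) (by simpa using ha'), ha, ← hN, mul_comm, mul_assoc, htk,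
    mul_one]

lemma dehomogenize_bijective (i : Fin 2) : Function.Bijective (dehomogenize i) := by
  refine ⟨dehomogenize_injective i, fun P ↦ ?_⟩
  rw [← RingHom.mem_range]
  have hC (z : ℂ) : Polynomial.C z ∈ (dehomogenize i).range :=
    ⟨HomogeneousLocalization.Away.mk 𝒜₂ (X_mem i) 0 (MvPolynomial.C z) (by
      simp), by rw [dehomogenize_mk]; simp [dehomEval]⟩
  have hX : Polynomial.X ∈ (dehomogenize i).range :=
    ⟨HomogeneousLocalization.Away.mk 𝒜₂ (X_mem i) 1 (MvPolynomial.X (1 - i)) (by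
      simpa using MvPolynomial.isHomogeneous_X ℂ (1 - i)), by
      rw [dehomogenize_mk]; fin_cases i <;> simp [dehomEval]⟩
  induction P using Polynomial.induction_on' with
  | add p q hp hq => exact add_mem hp hq
  | monomial k a =>
    rw [← Polynomial.C_mul_X_pow_eq_monomial]
    exact mul_mem (hC a) (pow_mem hX k)

/-- The open immersion of a standard affine open subset of the projective line. -/
def lineAway (f : MvPolynomial (Fin 2) ℂ) {d : ℕ} (hf : f ∈ 𝒜₂ d) (hd : 0 < d) :
    Spec (.of (HomogeneousLocalization.Away 𝒜₂ f)) ⟶ ProjLine :=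
  Proj.awayι 𝒜₂ f hf hd

instance {f : MvPolynomial (Fin 2) ℂ} {d : ℕ} (hf : f ∈ 𝒜₂ d) (hd : 0 < d) :
    IsOpenImmersion (lineAway f hf hd) :=
  inferInstanceAs (IsOpenImmersion (Proj.awayι 𝒜₂ f hf hd))

lemma lineChart_eq (i : Fin 2) : lineChart i =
    Spec.map (CommRingCat.ofHom (dehomogenize i)) ≫
      lineAway (MvPolynomial.X i) (X_mem i) one_pos :=
  rfl

instance isIso_dehomogenize (i : Fin 2) : IsIso (CommRingCat.ofHom (dehomogenize i)) :=
  (ConcreteCategory.isIso_iff_bijective _).mpr (dehomogenize_bijective i)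

instance isOpenImmersion_lineChart (i : Fin 2) : IsOpenImmersion (lineChart i) := by
  rw [lineChart_eq]
  infer_instance

lemma opensRange_lineChart (i : Fin 2) :
    (lineChart i).opensRange = Proj.basicOpen 𝒜₂ (MvPolynomial.X i) := by
  simp only [lineChart_eq]
  rw [Scheme.Hom.opensRange_comp_of_isIso]
  exact Proj.opensRange_awayι 𝒜₂ (MvPolynomial.X i) (X_mem i) one_pos

/-- The ratio of the two variables that cuts out the other chart is the coordinate `u`. -/
lemma mem_lineChart_preimage {i k : Fin 2} (h : i ≠ k) (p : Spec (.of (Polynomial ℂ))) :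
    lineChart i p ∈ (lineChart k).opensRange ↔ Polynomial.X ∉ p.asIdeal := by
  have h₁ := Proj.awayι_preimage_basicOpen 𝒜₂ (X_mem i) one_pos (X_mem k) one_pos
  have h₂ : dehomogenize i (HomogeneousLocalization.Away.isLocalizationElem (X_mem i) (X_mem k)) =
      Polynomial.X := by
    refine (dehomogenize_mk i 1 _ _).trans ?_
    fin_cases i <;> fin_cases k <;> simp_all [dehomEval]
  rw [opensRange_lineChart]
  have h₃ := congrArg (Spec.map (CommRingCat.ofHom (dehomogenize i)) p ∈ ·) h₁
  refine h₃.to_iff.trans ?_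
  rw [← h₂]
  rfl

lemma opensRange_lineChart_sup : (lineChart 0).opensRange ⊔ (lineChart 1).opensRange = ⊤ := by
  -- The charts cover because a polynomial without constant term lies in the ideal of the variables.
  have h : (HomogeneousIdeal.irrelevant 𝒜₂).toIdeal ≤ Ideal.span (Set.range MvPolynomial.X) := by
    intro P hP
    have hP' : MvPolynomial.homogeneousComponent 0 P = 0 :=
      (MvPolynomial.decomposition.decompose'_apply P 0).symm.trans
        ((HomogeneousIdeal.mem_irrelevant_iff 𝒜₂ P).mp hP)
    rw [MvPolynomial.homogeneousComponent_zero, map_eq_zero] at hP'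
    rw [← Set.image_univ, MvPolynomial.mem_ideal_span_X_image]
    intro d hd
    by_contra! hd'
    have : d = 0 := Finsupp.ext fun i ↦ hd' i (Set.mem_univ i)
    rw [MvPolynomial.mem_support_iff, this] at hd
    exact hd hP'
  have key := Proj.iSup_basicOpen_eq_top 𝒜₂ MvPolynomial.X h
  rw [opensRange_lineChart, opensRange_lineChart]
  refine top_unique (key.ge.trans (iSup_le fun i ↦ ?_))
  fin_cases i
  exacts [le_sup_left, le_sup_right]

/-- Both sides factor through the affine open subset where the product of the variables is nonzero,
by the same map `h` induced by the point `[1 : T]`. -/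
lemma toLaurent_lineChart : Spec.map (CommRingCat.ofHom (Polynomial.toLaurent (R := ℂ))) ≫
    lineChart 0 = Spec.map (CommRingCat.ofHom
      (Polynomial.aeval (R := ℂ) (LaurentPolynomial.T (-1) : ℂ[T;T⁻¹])).toRingHom) ≫
    lineChart 1 := by
  have hm : (MvPolynomial.X 0 * MvPolynomial.X 1 : MvPolynomial (Fin 2) ℂ) ∈ 𝒜₂ (1 + 1) :=
    SetLike.mul_mem_graded (X_mem 0) (X_mem 1)
  let f : MvPolynomial (Fin 2) ℂ →ₐ[ℂ] ℂ[T;T⁻¹] := MvPolynomial.aeval ![1, LaurentPolynomial.T 1]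
  have hf : IsUnit (f.toRingHom (MvPolynomial.X 0 * MvPolynomial.X 1)) := by
    simpa [f] using LaurentPolynomial.isUnit_T 1
  obtain ⟨h, hh⟩ : ∃ h : HomogeneousLocalization.Away 𝒜₂
      (MvPolynomial.X 0 * MvPolynomial.X 1) →+* ℂ[T;T⁻¹], ∀ k a ha,
      h (HomogeneousLocalization.Away.mk 𝒜₂ hm k a ha) * LaurentPolynomial.T k = f a := by
    refine ⟨(IsLocalization.Away.lift (S := Localization.Away
      (MvPolynomial.X 0 * MvPolynomial.X 1 : MvPolynomial (Fin 2) ℂ)) _ hf).comp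
        (algebraMap _ _), fun k a ha ↦ ?_⟩
    have h' := congrArg (IsLocalization.Away.lift (S := Localization.Away
      (MvPolynomial.X 0 * MvPolynomial.X 1 : MvPolynomial (Fin 2) ℂ)) _ hf)
      (val_mk_mul hm k a ha)
    rw [map_mul, IsLocalization.Away.lift_eq, IsLocalization.Away.lift_eq] at h'
    have h₂ : f.toRingHom ((MvPolynomial.X 0 * MvPolynomial.X 1) ^ k) =
        LaurentPolynomial.T k := by simp [f]
    rw [h₂] at h'
    exact h'
  have hT (k : ℕ) : IsUnit (LaurentPolynomial.T k : ℂ[T;T⁻¹]) := LaurentPolynomial.isUnit_T k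
  have h₀ : Polynomial.toLaurent.comp (dehomogenize 0) =
      h.comp (HomogeneousLocalization.awayMap 𝒜₂ (X_mem 1) rfl) := by
    refine RingHom.ext fun z ↦ ?_
    obtain ⟨N, a, ha', rfl⟩ := HomogeneousLocalization.Away.mk_surjective 𝒜₂ (X_mem 0) z
    rw [RingHom.comp_apply, RingHom.comp_apply, HomogeneousLocalization.awayMap_mk,
      dehomogenize_mk]
    refine (hT N).mul_right_cancel (Eq.trans ?_ (hh _ _ _).symm)
    have h₂ : (Polynomial.toLaurentAlg (R := ℂ)).comp (dehomEval 0) = f :=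
      MvPolynomial.algHom_ext fun l ↦ by fin_cases l <;> simp [dehomEval, f]
    rw [← h₂, map_mul, map_pow]
    simp [dehomEval]
  have h₁ : (Polynomial.aeval (R := ℂ) (LaurentPolynomial.T (-1) : ℂ[T;T⁻¹])).toRingHom.comp
      (dehomogenize 1) = h.comp (HomogeneousLocalization.awayMap 𝒜₂ (X_mem 0) (mul_comm _ _)) := by
    refine RingHom.ext fun z ↦ ?_
    obtain ⟨N, a, ha', rfl⟩ := HomogeneousLocalization.Away.mk_surjective 𝒜₂ (X_mem 1) z
    rw [RingHom.comp_apply, RingHom.comp_apply, HomogeneousLocalization.awayMap_mk,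
      dehomogenize_mk]
    refine (hT N).mul_right_cancel (Eq.trans ?_ (hh _ _ _).symm)
    -- In the second chart the point is `[T⁻¹ : 1] = T⁻¹ [1 : T]`, so a form of degree `N` acquires
    -- the factor `T⁻ᴺ`.
    have h₂ : (Polynomial.aeval (R := ℂ) (LaurentPolynomial.T (-1) : ℂ[T;T⁻¹])).comp (dehomEval 1) =
        MvPolynomial.aeval (fun l ↦ LaurentPolynomial.T (-1) * ![1, LaurentPolynomial.T 1] l) :=
      MvPolynomial.algHom_ext fun l ↦ by
        have hT' : (LaurentPolynomial.T (-1) : ℂ[T;T⁻¹]) * LaurentPolynomial.T 1 = 1 := by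
          rw [← LaurentPolynomial.T_add, neg_add_cancel, LaurentPolynomial.T_zero]
        rw [AlgHom.comp_apply, dehomEval, MvPolynomial.aeval_X, MvPolynomial.aeval_X]
        match l with
        | 0 => simp
        | 1 => exact (map_one _).trans hT'.symm
    have h₃ := DFunLike.congr_fun h₂ a
    rw [aeval_mul_of_isHomogeneous (k := N) (by simpa using ha')] at h₃
    have h₄ : (LaurentPolynomial.T (-1) : ℂ[T;T⁻¹]) ^ N * LaurentPolynomial.T N = 1 := by
      rw [LaurentPolynomial.T_pow, ← LaurentPolynomial.T_add]
      simp
    have h₅ : f (a * MvPolynomial.X 0 ^ N) = f a := by simp [f]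
    rw [h₅]
    refine (congrArg (· * _) h₃).trans ?_
    linear_combination f a * h₄
  have k₀ := Proj.SpecMap_awayMap_awayι 𝒜₂ (X_mem 0) one_pos (X_mem 1)
    (x := MvPolynomial.X 0 * MvPolynomial.X 1) rfl
  have k₁ := Proj.SpecMap_awayMap_awayι 𝒜₂ (X_mem 1) one_pos (X_mem 0)
    (x := MvPolynomial.X 0 * MvPolynomial.X 1) (mul_comm _ _)
  have k := k₀.trans k₁.symm
  rw [lineChart_eq, lineChart_eq, ← Spec.map_comp_assoc, ← Spec.map_comp_assoc,
    ← CommRingCat.ofHom_comp, ← CommRingCat.ofHom_comp, h₀, h₁, CommRingCat.ofHom_comp,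
    CommRingCat.ofHom_comp, Spec.map_comp, Spec.map_comp, Category.assoc, Category.assoc]
  exact congrArg (Spec.map (CommRingCat.ofHom h) ≫ ·) k

end ProjectiveLine

/-! ### Coordinates on affine line bundles over the projective line -/

section BundleProjection

/-- The preimages of the standard charts of the projective line. -/
def baseOpens {Z : Scheme.{0}} (p : Z ⟶ ProjLine) (i : Fin 2) : Z.Opens :=
  p ⁻¹ᵁ (lineChart i).opensRange

lemma baseOpens_sup {Z : Scheme.{0}} (p : Z ⟶ ProjLine) : baseOpens p 0 ⊔ baseOpens p 1 = ⊤ := by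
  rw [baseOpens, baseOpens, ← Scheme.Hom.preimage_sup, opensRange_lineChart_sup]
  rfl

/-- The chart projections agree on the overlap, since the transition acts on `u` as it does on `ℙ¹`.
The squares are cartesian because a point of the other chart lies over the given chart of `ℙ¹`
exactly when `u ≠ 0`, that is, when it lies in the overlap. -/
lemma exists_isBundleProjection (d : ℕ) (c : ℂ[T;T⁻¹]) : ∃ ρ, IsBundleProjection d c ρ := by
  have w : Spec.map (CommRingCat.ofHom incl) ≫ Spec.map (CommRingCat.ofHom Polynomial.C) ≫
      lineChart 0 = Spec.map (CommRingCat.ofHom (trans d c)) ≫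
        Spec.map (CommRingCat.ofHom Polynomial.C) ≫ lineChart 1 := by
    have h := congrArg (Spec.map (CommRingCat.ofHom (Polynomial.C (R := ℂ[T;T⁻¹]))) ≫ ·)
      toLaurent_lineChart
    simp only [← Spec.map_comp_assoc, ← CommRingCat.ofHom_comp] at h ⊢
    convert h using 4
    · ext <;> simp [incl]
    · ext <;> simp [trans]
  let ρ : AffineLineBundle d c ⟶ ProjLine := pushout.desc _ _ w
  have hρ (i : Fin 2) : bundleChart d c i ≫ ρ =
      Spec.map (CommRingCat.ofHom Polynomial.C) ≫ lineChart i := by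
    match i with
    | 0 => exact pushout.inl_desc _ _ _
    | 1 => exact pushout.inr_desc _ _ _
  refine ⟨ρ, fun i ↦ ?_⟩
  refine (IsOpenImmersion.isPullback _ _ _ _ (hρ i) ?_).flip
  refine le_antisymm (fun x hx ↦ ?_) ?_
  · obtain ⟨k, y, rfl⟩ := exists_bundleChart_eq d c x
    by_cases hik : k = i
    · exact ⟨y, by rw [hik]⟩
    · have h₁ : lineChart k (Spec.map (CommRingCat.ofHom Polynomial.C) y) ∈
          (lineChart i).opensRange := by
        have := congrArg (fun f : Spec (.of PlaneRing) ⟶ ProjLine ↦ f y) (hρ k)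
        exact this ▸ hx
      rw [mem_lineChart_preimage hik] at h₁
      have h₂ := bundleChart_preimage d c k i hik
      exact h₂.ge h₁
  · rintro _ ⟨y, rfl⟩
    have := congrArg (fun f : Spec (.of PlaneRing) ⟶ ProjLine ↦ f y) (hρ i)
    exact ⟨_, this.symm⟩

variable {d : ℕ} {c : ℂ[T;T⁻¹]} {ρ : AffineLineBundle d c ⟶ ProjLine}

lemma IsBundleProjection.w (hρ : IsBundleProjection d c ρ) (i : Fin 2) : bundleChart d c i ≫ ρ =
    Spec.map (CommRingCat.ofHom Polynomial.C) ≫ lineChart i :=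
  (hρ i).w

lemma IsBundleProjection.preimage (hρ : IsBundleProjection d c ρ) (i : Fin 2) :
    ρ ⁻¹ᵁ (lineChart i).opensRange = chartOpens d c i := by
  have := IsOpenImmersion.image_preimage_eq_preimage_image_of_isPullback (hρ i).flip ⊤
  rw [Scheme.Hom.image_top_eq_opensRange] at this
  exact this.symm.trans (Scheme.Hom.image_top_eq_opensRange _)

/-- The coordinate `u` on the preimage of a standard chart of the projective line. -/
lemma exists_baseHom {Z : Scheme.{0}} (p : Z ⟶ ProjLine) (i : Fin 2) :
    ∃ φ, ChartOn (lineChart i) p (baseOpens p i) φ :=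
  exists_chartOn le_rfl

/-- The local expression of a morphism to the projective line. -/
def baseHom {Z : Scheme.{0}} (p : Z ⟶ ProjLine) (i : Fin 2) :
    Polynomial ℂ →+* Γ(Z, baseOpens p i) :=
  (exists_baseHom p i).choose

lemma chartOn_baseHom {Z : Scheme.{0}} (p : Z ⟶ ProjLine) (i : Fin 2) :
    ChartOn (lineChart i) p (baseOpens p i) (baseHom p i) :=
  (exists_baseHom p i).choose_spec

lemma baseHom_eq {Z : Scheme.{0}} {p : Z ⟶ ProjLine} {i : Fin 2} {U : Z.Opens}
    (hU : U ≤ baseOpens p i) {φ : Polynomial ℂ →+* Γ(Z, U)} (h : ChartOn (lineChart i) p U φ) :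
    (res Z hU).comp (baseHom p i) = φ :=
  ((chartOn_baseHom p i).res hU).unique h

instance isOpenImmersion_toLaurent :
    IsOpenImmersion (Spec.map (CommRingCat.ofHom (Polynomial.toLaurent (R := ℂ)))) :=
  IsOpenImmersion.of_isLocalization (R := Polynomial ℂ) (S := ℂ[T;T⁻¹]) Polynomial.X

lemma mem_opensRange_toLaurent (p : Spec (.of (Polynomial ℂ))) :
    p ∈ (Spec.map (CommRingCat.ofHom (Polynomial.toLaurent (R := ℂ)))).opensRange ↔
      Polynomial.X ∉ p.asIdeal :=
  (congrArg (p ∈ ·) (PrimeSpectrum.localization_away_comap_range (R := Polynomial ℂ) ℂ[T;T⁻¹]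
    Polynomial.X)).to_iff

lemma exists_baseOverlap {Z : Scheme.{0}} (p : Z ⟶ ProjLine) :
    ∃ e : ℂ[T;T⁻¹] →+* Γ(Z, baseOpens p 0 ⊓ baseOpens p 1),
      (res Z inf_le_left).comp (baseHom p 0) = e.comp Polynomial.toLaurent ∧
      (res Z inf_le_right).comp (baseHom p 1) =
        e.comp (Polynomial.aeval (R := ℂ) (LaurentPolynomial.T (-1) : ℂ[T;T⁻¹])).toRingHom := by
  have hle : baseOpens p 0 ⊓ baseOpens p 1 ≤ p ⁻¹ᵁ (Spec.map
      (CommRingCat.ofHom (Polynomial.toLaurent (R := ℂ))) ≫ lineChart 0).opensRange := by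
    rintro x ⟨⟨y, hy⟩, hx⟩
    have h : lineChart 0 y ∈ (lineChart 1).opensRange := hy ▸ hx
    rw [mem_lineChart_preimage (by decide)] at h
    obtain ⟨z, hz⟩ := (mem_opensRange_toLaurent y).mpr h
    refine ⟨z, ?_⟩
    rw [Scheme.Hom.comp_apply, hz, hy]
  obtain ⟨e, he⟩ := exists_chartOn hle
  exact ⟨e, baseHom_eq _ (he.of_comp_comp rfl), baseHom_eq _ (he.of_comp_comp toLaurent_lineChart)⟩

/-- The functions of `u` on the preimage of the intersection of the two standard charts. -/
def baseOverlap {Z : Scheme.{0}} (p : Z ⟶ ProjLine) :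
    ℂ[T;T⁻¹] →+* Γ(Z, baseOpens p 0 ⊓ baseOpens p 1) :=
  (exists_baseOverlap p).choose

lemma res_baseHom_zero {Z : Scheme.{0}} (p : Z ⟶ ProjLine) :
    (res Z inf_le_left).comp (baseHom p 0) = (baseOverlap p).comp Polynomial.toLaurent :=
  (exists_baseOverlap p).choose_spec.1

lemma res_baseHom_one {Z : Scheme.{0}} (p : Z ⟶ ProjLine) :
    (res Z inf_le_right).comp (baseHom p 1) = (baseOverlap p).comp
      (Polynomial.aeval (R := ℂ) (LaurentPolynomial.T (-1) : ℂ[T;T⁻¹])).toRingHom :=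
  (exists_baseOverlap p).choose_spec.2

lemma laurent_hom_ext' {L : Type} [CommRing L] {φ ψ : ℂ[T;T⁻¹] →+* L}
    (h : φ.comp Polynomial.toLaurent = ψ.comp Polynomial.toLaurent) : φ = ψ :=
  IsLocalization.ringHom_ext (Submonoid.powers (Polynomial.X : Polynomial ℂ)) h

section Coordinates

variable {Z : Over ProjLine}

/-- Lying over `ℙ¹` fixes the value of the comorphism on functions of `u`; only the value of `T`
remains free. -/
lemma exists_fib (hρ : IsBundleProjection d c ρ) (g : Z ⟶ Over.mk ρ) (i : Fin 2) :
    ∃ t, ChartOn (bundleChart d c i) g.left (baseOpens Z.hom i)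
      (Polynomial.eval₂RingHom (baseHom Z.hom i) t) := by
  have hw : g.left ≫ ρ = Z.hom := Over.w g
  have hle : baseOpens Z.hom i ≤ g.left ⁻¹ᵁ (bundleChart d c i).opensRange := by
    rw [baseOpens, ← hw, Scheme.Hom.comp_preimage, hρ.preimage]
    rfl
  obtain ⟨φ, hφ⟩ := exists_chartOn hle
  refine ⟨φ Polynomial.X, ?_⟩
  have h := hφ.postcomp (hρ.w i)
  rw [hw] at h
  have h' := h.unique (chartOn_baseHom Z.hom i)
  have e : Polynomial.eval₂RingHom (baseHom Z.hom i) (φ Polynomial.X) = φ :=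
    Polynomial.ringHom_ext (fun a ↦ by simpa using (DFunLike.congr_fun h' a).symm) (by simp)
  rw [e]
  exact hφ

/-- The fibre coordinate over a chart of a point of an affine line bundle. -/
def fib (hρ : IsBundleProjection d c ρ) (g : Z ⟶ Over.mk ρ) (i : Fin 2) :
    Γ(Z.left, baseOpens Z.hom i) :=
  (exists_fib hρ g i).choose

lemma chartOn_fib (hρ : IsBundleProjection d c ρ) (g : Z ⟶ Over.mk ρ) (i : Fin 2) :
    ChartOn (bundleChart d c i) g.left (baseOpens Z.hom i)
      (Polynomial.eval₂RingHom (baseHom Z.hom i) (fib hρ g i)) :=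
  (exists_fib hρ g i).choose_spec

lemma fib_eq (hρ : IsBundleProjection d c ρ) {g : Z ⟶ Over.mk ρ} {i : Fin 2}
    {φ : PlaneRing →+* Γ(Z.left, baseOpens Z.hom i)} (h : ChartOn (bundleChart d c i) g.left (baseOpens Z.hom i) φ) :
    fib hρ g i = φ Polynomial.X := by
  rw [← (chartOn_fib hρ g i).unique h]
  simp

lemma fib_ext (hρ : IsBundleProjection d c ρ) {g g' : Z ⟶ Over.mk ρ}
    (h : ∀ i, fib hρ g i = fib hρ g' i) : g = g' := by
  refine Over.OverMorphism.ext ?_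
  refine ChartOn.hom_ext (baseOpens_sup Z.hom) (chartOn_fib hρ g 0) (chartOn_fib hρ g 1) ?_ ?_
  · rw [h]
    exact chartOn_fib hρ g' 0
  · rw [h]
    exact chartOn_fib hρ g' 1

lemma fib_comp (hρ : IsBundleProjection d c ρ) {Z' : Over ProjLine} (f : Z' ⟶ Z)
    (g : Z ⟶ Over.mk ρ) (i : Fin 2) (h : baseOpens Z'.hom i ≤ f.left ⁻¹ᵁ baseOpens Z.hom i) :
    fib hρ (f ≫ g) i = f.left.appLE _ _ h (fib hρ g i) := by
  refine (fib_eq hρ ((chartOn_fib hρ g i).comp f.left _ h)).trans ?_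
  simp

lemma baseOpens_le {Z' : Over ProjLine} (f : Z' ⟶ Z) (i : Fin 2) :
    baseOpens Z'.hom i ≤ f.left ⁻¹ᵁ baseOpens Z.hom i := by
  rw [baseOpens, ← Over.w f]
  rfl

/-- On the overlap both coordinates come from one homomorphism on `OverlapRing`, through `incl` and
`trans`. With `fib_ext` and `exists_fib_eq`, this describes the points of the bundle over a
`ℙ¹`-scheme as the pairs of functions obeying the transition rule. -/
lemma res_fib (hρ : IsBundleProjection d c ρ) (g : Z ⟶ Over.mk ρ) :
    res _ inf_le_right (fib hρ g 1) = baseOverlap Z.hom (LaurentPolynomial.T d) *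
      res _ inf_le_left (fib hρ g 0) + baseOverlap Z.hom c := by
  have h₀ := (chartOn_fib hρ g 0).res (inf_le_left : _ ⊓ baseOpens Z.hom 1 ≤ _)
  have h₁ := (chartOn_fib hρ g 1).res (inf_le_right : baseOpens Z.hom 0 ⊓ _ ≤ _)
  have hle : baseOpens Z.hom 0 ⊓ baseOpens Z.hom 1 ≤ g.left ⁻¹ᵁ (overlapChart d c).opensRange := by
    rw [← chartOpens_inf]
    exact fun x hx ↦ ⟨h₀.le hx, h₁.le hx⟩
  obtain ⟨ψ, hψ⟩ := exists_chartOn hle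
  have k₀ := h₀.unique (hψ.of_comp_comp rfl)
  have k₁ := h₁.unique (hψ.of_comp_comp (overlapChart_eq d c))
  have e : ψ.comp Polynomial.C = baseOverlap Z.hom := by
    refine laurent_hom_ext' ?_
    rw [← res_baseHom_zero]
    ext a
    · have := DFunLike.congr_fun k₀ (Polynomial.C (Polynomial.C a))
      simp [incl] at this
      simp [this]
    · have := DFunLike.congr_fun k₀ (Polynomial.C Polynomial.X)
      simp [incl] at this
      simp [this]
  have e₀ := DFunLike.congr_fun k₀ Polynomial.X
  have e₁ := DFunLike.congr_fun k₁ Polynomial.X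
  simp only [RingHom.comp_apply, Polynomial.coe_eval₂RingHom, Polynomial.eval₂_X, incl_X,
    trans_X, map_add, map_mul] at e₀ e₁
  rw [e₁, e₀, ← e]
  rfl

lemma exists_fib_eq (hρ : IsBundleProjection d c ρ) {t : ∀ i : Fin 2, Γ(Z.left, baseOpens Z.hom i)}
    (ht : res _ inf_le_right (t 1) = baseOverlap Z.hom (LaurentPolynomial.T d) *
      res _ inf_le_left (t 0) + baseOverlap Z.hom c) : ∃ g : Z ⟶ Over.mk ρ, ∀ i, fib hρ g i = t i := by
  obtain ⟨g, h₀, h₁⟩ := exists_hom_bundle (baseOpens_sup Z.hom) (res_baseHom_zero Z.hom)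
    (res_baseHom_one Z.hom) ht
  have w : g ≫ ρ = Z.hom := by
    refine ChartOn.hom_ext (baseOpens_sup Z.hom) (h₀.postcomp (hρ.w 0)) (h₁.postcomp (hρ.w 1)) ?_ ?_
    · convert chartOn_baseHom Z.hom 0 using 1
      exact RingHom.ext fun a ↦ by simp
    · convert chartOn_baseHom Z.hom 1 using 1
      exact RingHom.ext fun a ↦ by simp
  refine ⟨Over.homMk g w, fun i ↦ ?_⟩
  match i with
  | 0 => exact (fib_eq hρ h₀).trans (by simp)
  | 1 => exact (fib_eq hρ h₁).trans (by simp)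

end Coordinates

end BundleProjection

/-! ### The line bundle as a group scheme and its action by translations -/

section Torsor

variable {d : ℕ} {c : ℂ[T;T⁻¹]} {ρL : OMinus d ⟶ ProjLine} {ρ : AffineLineBundle d c ⟶ ProjLine}

/-- The sum of a solution of the linear rule and a solution of the affine rule solves the affine
rule. -/
lemma exists_translation (hL : IsBundleProjection d 0 ρL) (hρ : IsBundleProjection d c ρ)
    {Z : Over ProjLine} (x : Z ⟶ Over.mk ρL) (y : Z ⟶ Over.mk ρ) :
    ∃ g : Z ⟶ Over.mk ρ, ∀ i, fib hρ g i = fib hL x i + fib hρ y i := by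
  refine exists_fib_eq hρ ?_
  rw [map_add, map_add, res_fib, res_fib, map_zero]
  ring

/-- Fibrewise translation. -/
def translation (hL : IsBundleProjection d 0 ρL) (hρ : IsBundleProjection d c ρ) :
    Over.mk ρL ⊗ Over.mk ρ ⟶ Over.mk ρ :=
  (exists_translation hL hρ (fst _ _) (snd _ _)).choose

/-- Stated for arbitrary points, this reduces the group and action axioms to identities between
functions, by `fib_ext`. -/
lemma fib_comp_translation (hL : IsBundleProjection d 0 ρL) (hρ : IsBundleProjection d c ρ)
    {Z : Over ProjLine} (h : Z ⟶ Over.mk ρL ⊗ Over.mk ρ) (i : Fin 2) :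
    fib hρ (h ≫ translation hL hρ) i =
      fib hL (h ≫ fst _ _) i + fib hρ (h ≫ snd _ _) i := by
  rw [fib_comp hρ h _ i (baseOpens_le h i), fib_comp hL h _ i (baseOpens_le h i),
    fib_comp hρ h _ i (baseOpens_le h i), ← map_add]
  congr 1
  exact (exists_translation hL hρ (fst _ _) (snd _ _)).choose_spec i

lemma exists_zeroSection (hL : IsBundleProjection d 0 ρL) (Z : Over ProjLine) :
    ∃ g : Z ⟶ Over.mk ρL, ∀ i, fib hL g i = 0 :=
  exists_fib_eq hL (by simp)

lemma fib_comp_zeroSection (hL : IsBundleProjection d 0 ρL) {Z Z' : Over ProjLine} (h : Z' ⟶ Z)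
    (i : Fin 2) : fib hL (h ≫ (exists_zeroSection hL Z).choose) i = 0 := by
  rw [fib_comp hL h _ i (baseOpens_le h i), (exists_zeroSection hL Z).choose_spec, map_zero]

lemma exists_negation (hL : IsBundleProjection d 0 ρL) :
    ∃ g : Over.mk ρL ⟶ Over.mk ρL, ∀ i, fib hL g i = - fib hL (𝟙 _) i := by
  refine exists_fib_eq hL ?_
  have h := res_fib hL (𝟙 (Over.mk ρL))
  rw [map_zero, add_zero] at h ⊢
  rw [map_neg, map_neg]
  exact (congrArg _ h).trans (mul_neg _ _).symm

/-- The total space of the line bundle is a group scheme over the projective line. -/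
@[reducible]
def bundleGrpObj (hL : IsBundleProjection d 0 ρL) : GrpObj (Over.mk ρL) where
  one := (exists_zeroSection hL _).choose
  mul := translation hL hL
  inv := (exists_negation hL).choose
  one_mul := by
    refine fib_ext hL fun i ↦ ?_
    rw [fib_comp_translation, whiskerRight_fst, whiskerRight_snd, fib_comp_zeroSection, zero_add,
      leftUnitor_hom]
  mul_one := by
    refine fib_ext hL fun i ↦ ?_
    rw [fib_comp_translation, whiskerLeft_fst, whiskerLeft_snd, fib_comp_zeroSection, add_zero,
      rightUnitor_hom]
  mul_assoc := by
    refine fib_ext hL fun i ↦ ?_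
    rw [fib_comp_translation, whiskerRight_fst, whiskerRight_snd, fib_comp_translation,
      ← Category.assoc, fib_comp_translation, Category.assoc, Category.assoc, whiskerLeft_fst,
      whiskerLeft_snd, ← Category.assoc _ _ (translation hL hL), fib_comp_translation, add_assoc]
    simp
  left_inv := by
    refine fib_ext hL fun i ↦ ?_
    rw [fib_comp_translation, lift_fst, lift_snd, fib_comp_zeroSection,
      (exists_negation hL).choose_spec, neg_add_cancel]
  right_inv := by
    refine fib_ext hL fun i ↦ ?_
    rw [fib_comp_translation, lift_fst, lift_snd, fib_comp_zeroSection,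
      (exists_negation hL).choose_spec, add_neg_cancel]

/-- The action of the line bundle by translations. -/
@[reducible]
def bundleModObj (hL : IsBundleProjection d 0 ρL) (hρ : IsBundleProjection d c ρ) :
    letI := bundleGrpObj hL
    ModObj (Over.mk ρL) (Over.mk ρ) :=
  letI := bundleGrpObj hL
  { smul := translation hL hρ
    one_smul := by
      refine fib_ext hρ fun i ↦ ?_
      refine (fib_comp_translation hL hρ ((exists_zeroSection hL _).choose ▷ Over.mk ρ) i).trans ?_
      rw [whiskerRight_fst, whiskerRight_snd, fib_comp_zeroSection, zero_add]
      rfl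
    mul_smul := by
      refine fib_ext hρ fun i ↦ ?_
      refine (fib_comp_translation hL hρ (translation hL hL ▷ Over.mk ρ) i).trans ?_
      refine Eq.trans ?_ (fib_comp_translation hL hρ
        ((α_ _ _ _).hom ≫ Over.mk ρL ◁ translation hL hρ) i).symm
      rw [whiskerRight_fst, whiskerRight_snd, fib_comp_translation, Category.assoc, Category.assoc,
        whiskerLeft_fst, whiskerLeft_snd, ← Category.assoc _ _ (translation hL hρ),
        fib_comp_translation, add_assoc]
      simp }

lemma chartOn_comp_chartPoint {Z : Scheme.{0}} (e : Z ⟶ Spec (.of (Polynomial PlaneRing)))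
    (i : Fin 2) (f : Polynomial PlaneRing) (U : Z.Opens) :
    ChartOn (bundleChart d c i) (e ≫ chartPoint d c i f) U
      (((e.appLE ⊤ U le_top).hom.comp (specFun ⊤)).comp 
        (Polynomial.eval₂RingHom (Polynomial.C.comp Polynomial.C) f)) :=
  (chartOn_specMap _ ⊤).comp e U le_top

lemma isTranslation_translation (hL : IsBundleProjection d 0 ρL) (hρ : IsBundleProjection d c ρ) :
    IsTranslation (translation hL hρ) := by
  intro i Z e x y hx hy
  -- Both points factor through the chart `i`, so the base point does too and a single fibre
  -- coordinate determines everything.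
  have hZ : baseOpens Z.hom i = ⊤ := by
    refine top_unique fun z _ ↦ ?_
    have h : Z.hom = (e ≫ Spec.map (CommRingCat.ofHom (Polynomial.eval₂RingHom
        (Polynomial.C.comp Polynomial.C) (Polynomial.C Polynomial.X : Polynomial PlaneRing))) ≫
        Spec.map (CommRingCat.ofHom Polynomial.C)) ≫ lineChart i := by
      have hw : x.left ≫ ρL = Z.hom := Over.w x
      rw [← hw, hx, chartPoint, Category.assoc, Category.assoc, hL.w, Category.assoc,
        Category.assoc]
    rw [baseOpens, h]
    exact ⟨_, (Scheme.Hom.comp_apply _ _ _).symm⟩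
  have hx' := chartOn_comp_chartPoint (d := d) (c := 0) e i (Polynomial.C Polynomial.X)
    (baseOpens Z.hom i)
  have hy' := chartOn_comp_chartPoint (d := d) (c := c) e i Polynomial.X (baseOpens Z.hom i)
  rw [← hx] at hx'
  rw [← hy] at hy'
  have h := chartOn_fib hρ (lift x y ≫ translation hL hρ) i
  rw [fib_comp_translation, lift_fst, lift_snd, fib_eq hL hx', fib_eq hρ hy'] at h
  have k := (chartOn_fib hρ y i).unique hy'
  have h' := chartOn_comp_chartPoint (d := d) (c := c) e i (Polynomial.C Polynomial.X + Polynomial.X)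
    (baseOpens Z.hom i)
  have key := h.trans (Eq.trans ?_ h'.symm)
  · exact hom_ext_of_sup_eq_top (by rw [hZ, sup_idem]) key key
  · congr 4
    refine Polynomial.ringHom_ext (fun a ↦ ?_) ?_
    · have := DFunLike.congr_fun k (Polynomial.C a)
      simp only [Polynomial.coe_eval₂RingHom, Polynomial.eval₂_C] at this
      simp [this]
    · simp

/-- The constant term `c` cancels in the difference of two points over the same base point, so the
difference is a point of the line bundle, and it is the only one translating the second to the
first. -/
lemma isPullback_translation (hL : IsBundleProjection d 0 ρL) (hρ : IsBundleProjection d c ρ) :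
    IsPullback (translation hL hρ).left (snd (Over.mk ρL) (Over.mk ρ)).left ρ ρ := by
  refine isPullback_of_existsUnique ?_ fun W f g hfg ↦ ?_
  · exact (Over.w (translation hL hρ)).trans (Over.w (snd (Over.mk ρL) (Over.mk ρ))).symm
  let Z := Over.mk (f ≫ ρ)
  let x : Z ⟶ Over.mk ρ := Over.homMk f rfl
  let y : Z ⟶ Over.mk ρ := Over.homMk g hfg.symm
  obtain ⟨z, hz⟩ : ∃ z : Z ⟶ Over.mk ρL, ∀ i, fib hL z i = fib hρ x i - fib hρ y i := by
    refine exists_fib_eq hL ?_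
    rw [map_sub, map_sub, res_fib, res_fib, map_zero]
    ring
  have hzx : lift z y ≫ translation hL hρ = x := fib_ext hρ fun i ↦ by
    rw [fib_comp_translation, lift_fst, lift_snd, hz, sub_add_cancel]
  refine ⟨(lift z y).left, ⟨congrArg CommaMorphism.left hzx,
    congrArg CommaMorphism.left (lift_snd z y)⟩, fun l ⟨h₁, h₂⟩ ↦ ?_⟩
  have hl : l ≫ (Over.mk ρL ⊗ Over.mk ρ).hom = Z.hom := by
    rw [← Over.w (translation hL hρ), reassoc_of% h₁]
    rfl
  let k : Z ⟶ Over.mk ρL ⊗ Over.mk ρ := Over.homMk l hl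
  have k₁ : k ≫ translation hL hρ = x := Over.OverMorphism.ext h₁
  have k₂ : k ≫ snd _ _ = y := Over.OverMorphism.ext h₂
  have hk : k = lift z y := by
    refine CartesianMonoidalCategory.hom_ext _ _ (fib_ext hL fun i ↦ ?_) ?_
    · rw [lift_fst, hz, ← k₁, fib_comp_translation, k₂, add_sub_cancel_right]
    · rw [k₂, lift_snd]
  exact congrArg CommaMorphism.left hk

lemma exists_isOMinusTorsor (d : ℕ) (c : ℂ[T;T⁻¹]) :
    ∃ ρ : AffineLineBundle d c ⟶ ProjLine, IsOMinusTorsor ρ := by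
  obtain ⟨ρL, hL⟩ := exists_isBundleProjection d 0
  obtain ⟨ρ, hρ⟩ := exists_isBundleProjection d c
  refine ⟨ρ, hρ, ρL, hL, bundleGrpObj hL, bundleModObj hL hρ, isTranslation_translation hL hL,
    isTranslation_translation hL hρ, isPullback_translation hL hρ, fun s ↦ ?_⟩
  obtain ⟨i, hi⟩ : ∃ i, s ∈ (lineChart i).opensRange := by
    rcases opensRange_lineChart_sup.ge (TopologicalSpace.Opens.mem_top s) with h | h
    exacts [⟨0, h⟩, ⟨1, h⟩]
  -- The local section over a chart is `T = 0`.
  refine ⟨(lineChart i).opensRange, hi, (lineChart i).isoOpensRange.inv ≫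
    Spec.map (CommRingCat.ofHom (Polynomial.evalRingHom 0)) ≫ bundleChart d c i, ?_⟩
  have h : Spec.map (CommRingCat.ofHom (Polynomial.evalRingHom (0 : Polynomial ℂ))) ≫
      Spec.map (CommRingCat.ofHom Polynomial.C) = 𝟙 _ := by
    rw [← Spec.map_comp, ← CommRingCat.ofHom_comp]
    have : (Polynomial.evalRingHom (0 : Polynomial ℂ)).comp Polynomial.C = RingHom.id _ :=
      RingHom.ext fun a ↦ by simp
    rw [this]
    exact Spec.map_id _
  rw [Category.assoc, Category.assoc, hρ.w, reassoc_of% h, Scheme.Hom.isoOpensRange_inv_comp]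

end Torsor

/-! ## The coordinate ring of the threefold is factorial -/

section Factorial

variable {m n : ℕ} {L : Type} [CommRing L]

/-- The ring map `ℂ[X_{m,n}] → L` given by a point of `X_{m,n}` with values in `L`. -/
def threefoldEval (m n : ℕ) (f : ℂ →+* L) (x y u v : L) (h : x ^ m * v - y ^ n * u = 1) :
    ThreefoldRing m n →+* L :=
  Ideal.Quotient.lift _ (MvPolynomial.eval₂Hom f ![x, y, u, v]) fun a ha ↦ by
    obtain ⟨b, rfl⟩ := Ideal.mem_span_singleton'.mp ha
    simp [threefoldEq, h]

lemma threefoldEval_algebraMap (f : ℂ →+* L) (x y u v : L) (h : x ^ m * v - y ^ n * u = 1) (z : ℂ) :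
    threefoldEval m n f x y u v h (algebraMap ℂ _ z) = f z :=
  MvPolynomial.eval₂Hom_C f ![x, y, u, v] z

lemma threefoldEval_coord (f : ℂ →+* L) (x y u v : L) (h : x ^ m * v - y ^ n * u = 1) (i : Fin 4) :
    threefoldEval m n f x y u v h (coord m n i) = ![x, y, u, v] i :=
  MvPolynomial.eval₂Hom_X' f ![x, y, u, v] i

/-- In the polynomial ring `x` is prime and does not divide the equation, whose value at the origin
is `-1`; so `x` divides the cofactor and can be cancelled. -/
lemma coord_zero_mul_cancel {a : ThreefoldRing m n} (h : coord m n 0 * a = 0) :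
    a = 0 := by
  obtain ⟨f, rfl⟩ := Ideal.Quotient.mk_surjective a
  have h' : MvPolynomial.X 0 * f ∈ Ideal.span {threefoldEq m n} :=
    Ideal.Quotient.eq_zero_iff_mem.mp ((map_mul (Ideal.Quotient.mk _) _ _).trans h)
  obtain ⟨g, hg⟩ := Ideal.mem_span_singleton'.mp h'
  have hX : Prime (MvPolynomial.X 0 : MvPolynomial (Fin 4) ℂ) := MvPolynomial.X_prime
  have hdvd : ¬ (MvPolynomial.X 0 : MvPolynomial (Fin 4) ℂ) ∣ threefoldEq m n := fun ⟨k, hk⟩ ↦ by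
    have := congrArg (MvPolynomial.eval (fun _ ↦ (0 : ℂ))) hk
    simp [threefoldEq] at this
  obtain ⟨k, rfl⟩ := (hX.dvd_or_dvd ⟨f, hg⟩).resolve_right hdvd
  refine Ideal.Quotient.eq_zero_iff_mem.mpr (Ideal.mem_span_singleton'.mpr ⟨k, ?_⟩)
  exact mul_left_cancel₀ hX.ne_zero ((mul_assoc _ _ _).symm.trans hg)

/-- The open subset `x ≠ 0` of `X_{m,n}` is the spectrum of this ring, with coordinates
`x = T 1`, `y = C (C X)` and `u = C X`. -/
def localChart (m n : ℕ) : ThreefoldRing m n →+* PlaneRing[T;T⁻¹] :=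
  threefoldEval (L := PlaneRing[T;T⁻¹]) m n (LaurentPolynomial.C.comp (algebraMap ℂ PlaneRing))
    (LaurentPolynomial.T 1) (LaurentPolynomial.C (Polynomial.C Polynomial.X))
    (LaurentPolynomial.C Polynomial.X)
    (LaurentPolynomial.T (-m) * LaurentPolynomial.C
      (1 + Polynomial.C Polynomial.X ^ n * Polynomial.X)) (by
    have h := T_one_pow_mul_T_neg (R := PlaneRing) m
    rw [map_add, map_mul, map_pow, map_one]
    linear_combination (1 + LaurentPolynomial.C (Polynomial.C Polynomial.X : PlaneRing) ^ n *
      LaurentPolynomial.C Polynomial.X) * h)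

lemma localChart_algebraMap (z : ℂ) : localChart m n (algebraMap ℂ _ z) =
    LaurentPolynomial.C (Polynomial.C (Polynomial.C z)) :=
  threefoldEval_algebraMap (L := PlaneRing[T;T⁻¹]) ..

lemma localChart_coord_zero : localChart m n (coord m n 0) = LaurentPolynomial.T 1 :=
  threefoldEval_coord (L := PlaneRing[T;T⁻¹]) ..

lemma localChart_coord_one : localChart m n (coord m n 1) =
    LaurentPolynomial.C (Polynomial.C Polynomial.X) :=
  threefoldEval_coord (L := PlaneRing[T;T⁻¹]) ..

lemma localChart_coord_two : localChart m n (coord m n 2) = LaurentPolynomial.C Polynomial.X :=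
  threefoldEval_coord (L := PlaneRing[T;T⁻¹]) ..

lemma localChart_coord_three : localChart m n (coord m n 3) =
    LaurentPolynomial.T (-m) * LaurentPolynomial.C
      (1 + Polynomial.C Polynomial.X ^ n * Polynomial.X) :=
  threefoldEval_coord (L := PlaneRing[T;T⁻¹]) ..

lemma C_mem_range_localChart (p : PlaneRing) : 
    ∃ a, localChart m n a = LaurentPolynomial.C p := by
  induction p using Polynomial.induction_on' with
  | add p q hp hq =>
    obtain ⟨a, ha⟩ := hp
    obtain ⟨b, hb⟩ := hq
    exact ⟨a + b, by rw [map_add, map_add, ha, hb]⟩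
  | monomial k r =>
    have hr : ∃ a, localChart m n a = LaurentPolynomial.C (Polynomial.C r) := by
      induction r using Polynomial.induction_on' with
      | add p q hp hq =>
        obtain ⟨a, ha⟩ := hp
        obtain ⟨b, hb⟩ := hq
        exact ⟨a + b, by rw [map_add, map_add, map_add, ha, hb]⟩
      | monomial k r =>
        refine ⟨algebraMap ℂ _ r * coord m n 1 ^ k, ?_⟩
        rw [← Polynomial.C_mul_X_pow_eq_monomial, map_mul, map_pow, map_mul, map_mul, map_pow,
          map_pow, localChart_algebraMap, localChart_coord_one]
    obtain ⟨a, ha⟩ := hr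
    refine ⟨a * coord m n 2 ^ k, ?_⟩
    rw [← Polynomial.C_mul_X_pow_eq_monomial, map_mul, map_pow, map_mul, map_pow, ha,
      localChart_coord_two]

lemma exists_localChart_eq (z : PlaneRing[T;T⁻¹]) :
    ∃ (k : ℕ) (a : ThreefoldRing m n), localChart m n a = z * LaurentPolynomial.T k := by
  obtain ⟨k, f, hf⟩ := LaurentPolynomial.exists_T_pow z
  suffices h : ∃ a, localChart m n a = Polynomial.toLaurent f by
    obtain ⟨a, ha⟩ := h
    exact ⟨k, a, ha.trans hf⟩
  clear hf
  induction f using Polynomial.induction_on' with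
  | add p q hp hq =>
    obtain ⟨a, ha⟩ := hp
    obtain ⟨b, hb⟩ := hq
    exact ⟨a + b, by rw [map_add, map_add, ha, hb]⟩
  | monomial k r =>
    obtain ⟨a, ha⟩ := C_mem_range_localChart (m := m) (n := n) r
    refine ⟨a * coord m n 0 ^ k, ?_⟩
    rw [← Polynomial.C_mul_X_pow_eq_monomial, map_mul, map_pow, map_mul, map_pow, ha,
      localChart_coord_zero, Polynomial.toLaurent_C, Polynomial.toLaurent_X]

/-- Where `x` is invertible the equation can be solved for `v`, and `x`, `y`, `u` are free. -/
lemma exists_comp_localChart (π : ThreefoldRing m n →+* L) (hπ : IsUnit (π (coord m n 0))) :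
    ∃ ρ : PlaneRing[T;T⁻¹] →+* L, ρ.comp (localChart m n) = π := by
  obtain ⟨x, hx⟩ := hπ
  let ρ : PlaneRing[T;T⁻¹] →+* L := LaurentPolynomial.eval₂
    (planeEval (π.comp (algebraMap ℂ (ThreefoldRing m n))) (π (coord m n 1)) (π (coord m n 2))) x
  have hC (p : PlaneRing) : ρ (LaurentPolynomial.C p) = planeEval (π.comp (algebraMap ℂ
      (ThreefoldRing m n))) (π (coord m n 1)) (π (coord m n 2)) p := LaurentPolynomial.eval₂_C _ _ _
  have hT : ρ (LaurentPolynomial.T 1) = π (coord m n 0) := by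
    rw [← hx]
    exact (LaurentPolynomial.eval₂_T _ _ _).trans (by rw [zpow_one])
  have hTm : π (coord m n 0) ^ m * ρ (LaurentPolynomial.T (-m)) = 1 := by
    rw [← hT, ← map_pow, ← map_mul, T_one_pow_mul_T_neg, map_one]
  refine ⟨ρ, threefoldRing_hom_ext (fun z ↦ ?_) fun i ↦ ?_⟩
  · rw [RingHom.comp_apply, localChart_algebraMap, hC, planeEval_C_C, RingHom.comp_apply]
  · rw [RingHom.comp_apply]
    match i with
    | 0 => rw [localChart_coord_zero, hT]
    | 1 => rw [localChart_coord_one, hC, planeEval_C_X]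
    | 2 => rw [localChart_coord_two, hC, planeEval_X]
    | 3 =>
      have h₃ := congrArg π (coord_relation m n)
      simp only [map_sub, map_mul, map_pow, map_one] at h₃
      rw [localChart_coord_three, map_mul, hC, map_add, map_mul, map_pow, planeEval_C_X,
        planeEval_X, map_one]
      linear_combination (-ρ (LaurentPolynomial.T (-m))) * h₃ + π (coord m n 3) * hTm

/-- The map to the localization at `x` factors through `localChart`, so an element of the kernel is
killed by a power of `x`, hence is zero. -/
lemma localChart_injective : Function.Injective (localChart m n) := by
  refine (injective_iff_map_eq_zero _).mpr fun a ha ↦ ?_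
  obtain ⟨ρ, hρ⟩ := exists_comp_localChart
    (algebraMap (ThreefoldRing m n) (Localization.Away (coord m n 0)))
    (IsLocalization.Away.algebraMap_isUnit _)
  have h : algebraMap _ (Localization.Away (coord m n 0)) a = algebraMap _ _ 0 := by
    rw [← hρ, RingHom.comp_apply, ha, map_zero, map_zero]
  obtain ⟨⟨_, k, rfl⟩, hc⟩ := IsLocalization.exists_of_eq (M := Submonoid.powers (coord m n 0)) h
  replace hc : coord m n 0 ^ k * a = 0 := by simpa using hc
  induction k with
  | zero => simpa using hc
  | succ k ih => exact ih (coord_zero_mul_cancel (by rwa [pow_succ', mul_assoc] at hc))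

instance isDomain_threefoldRing : IsDomain (ThreefoldRing m n) :=
  localChart_injective.isDomain (localChart m n)

/-- The closed subset `x = 0` of `X_{m,n}` is the spectrum of this ring, with coordinates
`y = T 1` and `v = C X`. -/
def boundaryChart (n : ℕ) (hm : 1 ≤ m) : ThreefoldRing m n →+* (Polynomial ℂ)[T;T⁻¹] :=
  threefoldEval (L := (Polynomial ℂ)[T;T⁻¹]) m n
    (LaurentPolynomial.C.comp (algebraMap ℂ (Polynomial ℂ))) 0 (LaurentPolynomial.T 1)
    (-LaurentPolynomial.T (-n)) (LaurentPolynomial.C Polynomial.X) (by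
      have h := T_one_pow_mul_T_neg (R := Polynomial ℂ) n
      have h0 : (0 : (Polynomial ℂ)[T;T⁻¹]) ^ m = 0 := zero_pow (by omega)
      linear_combination h + LaurentPolynomial.C Polynomial.X * h0)

/-- At `x = 0` the equation becomes `-yⁿ u = 1`, which makes `y` invertible and determines `u`,
while `v` stays free. -/
lemma exists_comp_boundaryChart (hm : 1 ≤ m) (hn : 1 ≤ n) (π : ThreefoldRing m n →+* L)
    (hπ : π (coord m n 0) = 0) :
    ∃ ρ : (Polynomial ℂ)[T;T⁻¹] →+* L, ρ.comp (boundaryChart n hm) = π := by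
  have h₃ := congrArg π (coord_relation m n)
  rw [map_sub, map_mul, map_mul, map_pow, map_pow, hπ, zero_pow (by omega), zero_mul, map_one] at h₃
  have hy : π (coord m n 1) * (-(π (coord m n 1) ^ (n - 1) * π (coord m n 2))) = 1 := by
    rw [mul_neg, ← mul_assoc, ← pow_succ', Nat.sub_add_cancel hn]
    linear_combination h₃
  let ρ : (Polynomial ℂ)[T;T⁻¹] →+* L := LaurentPolynomial.eval₂
    (Polynomial.eval₂RingHom (π.comp (algebraMap ℂ (ThreefoldRing m n))) (π (coord m n 3)))
    (Units.mkOfMulEqOne _ _ hy)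
  have hC (p : Polynomial ℂ) : ρ (LaurentPolynomial.C p) = Polynomial.eval₂RingHom (π.comp
      (algebraMap ℂ (ThreefoldRing m n))) (π (coord m n 3)) p := LaurentPolynomial.eval₂_C _ _ _
  have hT : ρ (LaurentPolynomial.T 1) = π (coord m n 1) :=
    (LaurentPolynomial.eval₂_T _ _ _).trans (by rw [zpow_one]; rfl)
  have hTn : π (coord m n 1) ^ n * ρ (LaurentPolynomial.T (-n)) = 1 := by
    rw [← hT, ← map_pow, ← map_mul, T_one_pow_mul_T_neg, map_one]
  refine ⟨ρ, threefoldRing_hom_ext (fun z ↦ ?_) fun i ↦ ?_⟩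
  · rw [RingHom.comp_apply, boundaryChart, threefoldEval_algebraMap (L := (Polynomial ℂ)[T;T⁻¹]),
      RingHom.comp_apply, hC]
    simp
  · rw [RingHom.comp_apply, boundaryChart, threefoldEval_coord (L := (Polynomial ℂ)[T;T⁻¹])]
    match i with
    | 0 => exact (map_zero ρ).trans hπ.symm
    | 1 => exact hT
    | 2 =>
      refine (map_neg ρ _).trans ?_
      linear_combination π (coord m n 2) * hTn + ρ (LaurentPolynomial.T (-n)) * h₃
    | 3 => exact (hC _).trans (Polynomial.eval₂_X _ _)

lemma coord_zero_dvd_iff (hm : 1 ≤ m) (hn : 1 ≤ n) {a : ThreefoldRing m n} :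
    coord m n 0 ∣ a ↔ boundaryChart n hm a = 0 := by
  refine ⟨fun ⟨b, hb⟩ ↦ ?_, fun h ↦ ?_⟩
  · rw [hb, map_mul, show boundaryChart n hm (coord m n 0) = 0 from
      threefoldEval_coord (L := (Polynomial ℂ)[T;T⁻¹]) .., zero_mul]
  · obtain ⟨ρ, hρ⟩ := exists_comp_boundaryChart hm hn
      (L := ThreefoldRing m n ⧸ Ideal.span {coord m n 0}) (Ideal.Quotient.mk _)
      (Ideal.Quotient.eq_zero_iff_mem.mpr (Ideal.mem_span_singleton_self _))
    refine Ideal.mem_span_singleton.mp (Ideal.Quotient.eq_zero_iff_mem.mp ?_)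
    rw [← hρ, RingHom.comp_apply, h, map_zero]

/-- The ideal generated by `x` is the kernel of `boundaryChart`, a homomorphism to a domain. -/
lemma prime_coord_zero (hm : 1 ≤ m) (hn : 1 ≤ n) : Prime (coord m n 0) := by
  refine ⟨fun h ↦ ?_, fun h ↦ ?_, fun a b h ↦ ?_⟩
  · have h1 := LaurentPolynomial.isUnit_T (R := PlaneRing) 1
    rw [← localChart_coord_zero (m := m) (n := n), h, map_zero] at h1
    exact not_isUnit_zero h1
  · have := (coord_zero_dvd_iff hm hn (a := 1)).mp h.dvd
    rw [map_one] at this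
    exact one_ne_zero this
  · rw [coord_zero_dvd_iff hm hn, map_mul] at h
    rw [coord_zero_dvd_iff hm hn, coord_zero_dvd_iff hm hn]
    exact mul_eq_zero.mp h

/-- Nagata's theorem for an explicitly given localization `f`. -/
lemma uniqueFactorizationMonoid_of_hom {A K : Type} [CommRing A] [IsDomain A] [IsNoetherianRing A]
    [CommRing K] [UniqueFactorizationMonoid K] (f : A →+* K) (hf : Function.Injective f) {x : A}
    (hx : Prime x) (hfx : IsUnit (f x)) (h : ∀ z, ∃ (k : ℕ) (a : A), f a = z * f x ^ k) :
    UniqueFactorizationMonoid A := by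
  let : Algebra A K := f.toAlgebra
  have : IsLocalization.Away x K := by
    refine ⟨?_, fun z ↦ ?_, fun {a b} h ↦ ⟨1, by rw [hf h]⟩⟩
    · rintro ⟨_, k, rfl⟩
      rw [map_pow]
      exact hfx.pow k
    · obtain ⟨k, a, h⟩ := h z
      refine ⟨⟨a, _, k, rfl⟩, ?_⟩
      rw [map_pow]
      exact h.symm
  rwa [UniqueFactorizationMonoid.iff_of_isLocalizationAway_of_prime hx K]

instance uniqueFactorizationMonoid_laurent {R : Type} [CommRing R] [IsDomain R]
    [UniqueFactorizationMonoid R] : UniqueFactorizationMonoid R[T;T⁻¹] :=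
  .of_isLocalization (Submonoid.powers (Polynomial.X : Polynomial R)) _

lemma uniqueFactorizationMonoid_threefoldRing (hm : 1 ≤ m) (hn : 1 ≤ n) :
    UniqueFactorizationMonoid (ThreefoldRing m n) := by
  refine uniqueFactorizationMonoid_of_hom (K := PlaneRing[T;T⁻¹]) (localChart m n)
    localChart_injective (prime_coord_zero hm hn) ?_ fun z ↦ ?_
  · rw [localChart_coord_zero]
    exact LaurentPolynomial.isUnit_T 1
  · obtain ⟨k, a, h⟩ := exists_localChart_eq (m := m) (n := n) z
    exact ⟨k, a, by rw [localChart_coord_zero, LaurentPolynomial.T_pow, h, mul_one]⟩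

lemma subsingleton_pic_threefoldRing (hm : 1 ≤ m) (hn : 1 ≤ n) :
    Subsingleton (CommRing.Pic (ThreefoldRing m n)) := by
  have := uniqueFactorizationMonoid_threefoldRing hm hn
  infer_instance

end Factorial

/-! ## The Picard group of the ring of invariants -/

section Graded

lemma laurent_C_ne_zero {A : Type} [CommRing A] {a : A} (ha : a ≠ 0) :
    (LaurentPolynomial.C a : A[T;T⁻¹]) ≠ 0 := fun h ↦ ha (by
  have := congrArg (LaurentPolynomial.eval₂ (RingHom.id A) 1) h
  rwa [LaurentPolynomial.eval₂_C, map_zero] at this)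

/-- After clearing denominators the product is a monomial. Degrees and trailing degrees add over a
domain, so both coincide for each factor. -/
lemma exists_eq_C_mul_T {A : Type} [CommRing A] [IsDomain A] {F G : A[T;T⁻¹]} {c : A} (hc : c ≠ 0)
    (h : F * G = LaurentPolynomial.C c) :
    ∃ (a : A) (k : ℤ), F = LaurentPolynomial.C a * LaurentPolynomial.T k := by
  obtain ⟨p, f, hf⟩ := F.exists_T_pow
  obtain ⟨q, g, hg⟩ := G.exists_T_pow
  have hfg : f * g = Polynomial.C c * Polynomial.X ^ (p + q) := by
    apply Polynomial.toLaurent_injective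
    rw [map_mul, hf, hg, Polynomial.toLaurent_C_mul_X_pow, ← h, Nat.cast_add,
      LaurentPolynomial.T_add]
    ring
  have hfg0 : f * g ≠ 0 := by
    rw [hfg]
    exact mul_ne_zero (Polynomial.C_ne_zero.mpr hc) (pow_ne_zero _ Polynomial.X_ne_zero)
  have hf0 := left_ne_zero_of_mul hfg0
  have hg0 := right_ne_zero_of_mul hfg0
  have h₁ := Polynomial.natDegree_mul hf0 hg0
  have h₂ := Polynomial.natTrailingDegree_mul hf0 hg0
  rw [hfg, Polynomial.natDegree_C_mul_X_pow _ _ hc] at h₁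
  rw [hfg, Polynomial.C_mul_X_pow_eq_monomial, Polynomial.natTrailingDegree_monomial hc] at h₂
  have h₃ := Polynomial.natTrailingDegree_le_natDegree f
  have h₄ := Polynomial.natTrailingDegree_le_natDegree g
  have hf' : f = Polynomial.C (f.coeff f.natDegree) * Polynomial.X ^ f.natDegree := by
    ext i
    rw [Polynomial.coeff_C_mul_X_pow]
    split_ifs with hi
    · rw [hi]
    · rcases lt_or_gt_of_ne hi with hi | hi
      · exact Polynomial.coeff_eq_zero_of_lt_natTrailingDegree (by omega)
      · exact Polynomial.coeff_eq_zero_of_natDegree_lt hi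
  refine ⟨f.coeff f.natDegree, f.natDegree - p, ?_⟩
  rw [hf', Polynomial.toLaurent_C_mul_X_pow] at hf
  rw [LaurentPolynomial.T_sub, ← mul_assoc, hf, mul_assoc, ← LaurentPolynomial.T_add,
    add_neg_cancel, LaurentPolynomial.T_zero, mul_one]

variable {A B : Type} [CommRing A] [CommRing B] [Algebra B A] (δ : A →+* A[T;T⁻¹])
  (hB : ∀ b : B, δ (algebraMap B A b) = LaurentPolynomial.C (algebraMap B A b))

/-- The functions of weight `k`, for a coaction `δ` under which `B` is invariant. -/
def weightSubmodule (k : ℤ) : Submodule B A where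
  carrier := {a | δ a = LaurentPolynomial.C a * LaurentPolynomial.T k}
  add_mem' {a b} (ha : δ a = _) (hb : δ b = _) :=
    show δ (a + b) = _ by rw [map_add, map_add, ha, hb, add_mul]
  zero_mem' := show δ 0 = _ by rw [map_zero, map_zero, zero_mul]
  smul_mem' b a (ha : δ a = _) := show δ (b • a) = _ by
    rw [Algebra.smul_def, map_mul, map_mul, ha, hB, mul_assoc]

lemma mem_weightSubmodule {k : ℤ} {a : A} : a ∈ weightSubmodule δ hB k ↔
    δ a = LaurentPolynomial.C a * LaurentPolynomial.T k := Iff.rfl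

lemma weightSubmodule_mul_le (k l : ℤ) :
    weightSubmodule δ hB k * weightSubmodule δ hB l ≤ weightSubmodule δ hB (k + l) := by
  refine Submodule.mul_le.mpr fun a ha b hb ↦ ?_
  rw [mem_weightSubmodule] at *
  rw [map_mul, map_mul, ha, hb, LaurentPolynomial.T_add]
  ring

lemma weightSubmodule_zero (h : ∀ a, δ a = LaurentPolynomial.C a → ∃ b, algebraMap B A b = a) :
    weightSubmodule δ hB 0 = 1 := by
  refine le_antisymm (fun a ha ↦ ?_) (Submodule.one_le.mpr ?_)
  · rw [mem_weightSubmodule, LaurentPolynomial.T_zero, mul_one] at ha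
    exact Submodule.mem_one.mpr (h a ha)
  · rw [mem_weightSubmodule, map_one, map_one, LaurentPolynomial.T_zero, one_mul]

/-- Modules of functions of weight `k`, which are invertible with inverse of weight `-k`. -/
def HasWeight (I : (Submodule B A)ˣ) (k : ℤ) : Prop :=
  (I : Submodule B A) ≤ weightSubmodule δ hB k ∧
    ((I⁻¹ : (Submodule B A)ˣ) : Submodule B A) ≤ weightSubmodule δ hB (-k)

variable {δ hB}

lemma HasWeight.mul {I J : (Submodule B A)ˣ} {k l : ℤ} (hI : HasWeight δ hB I k)
    (hJ : HasWeight δ hB J l) : HasWeight δ hB (I * J) (k + l) := by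
  refine ⟨(mul_le_mul' hI.1 hJ.1).trans (weightSubmodule_mul_le δ hB k l), ?_⟩
  rw [mul_inv, neg_add]
  exact (mul_le_mul' hI.2 hJ.2).trans (weightSubmodule_mul_le δ hB (-k) (-l))

lemma HasWeight.inv {I : (Submodule B A)ˣ} {k : ℤ} (hI : HasWeight δ hB I k) :
    HasWeight δ hB I⁻¹ (-k) := by
  refine ⟨hI.2, ?_⟩
  rw [inv_inv, neg_neg]
  exact hI.1

lemma HasWeight.one : HasWeight δ hB 1 0 := by
  have : (1 : Submodule B A) ≤ weightSubmodule δ hB 0 := by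
    refine Submodule.one_le.mpr ?_
    rw [mem_weightSubmodule, map_one, map_one, LaurentPolynomial.T_zero, one_mul]
  refine ⟨this, ?_⟩
  rw [inv_one, neg_zero]
  exact this

lemma HasWeight.zpow {I : (Submodule B A)ˣ} (hI : HasWeight δ hB I 1) (k : ℤ) :
    HasWeight δ hB (I ^ k) k := by
  induction k with
  | zero => simpa using HasWeight.one
  | succ k ih => rw [zpow_add_one]; exact ih.mul hI
  | pred k ih => rw [zpow_sub_one, sub_eq_add_neg]; exact ih.mul hI.inv

/-- `I J⁻¹` lies in weight zero, which is `B`, so `I ≤ J`; the situation is symmetric. -/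
lemma HasWeight.eq (h : ∀ a, δ a = LaurentPolynomial.C a → ∃ b, algebraMap B A b = a)
    {I J : (Submodule B A)ˣ} {k : ℤ} (hI : HasWeight δ hB I k) (hJ : HasWeight δ hB J k) :
    I = J := by
  have key {I J : (Submodule B A)ˣ} (hI : HasWeight δ hB I k) (hJ : HasWeight δ hB J k) :
      (I : Submodule B A) ≤ J := by
    have h₁ := (hI.mul hJ.inv).1
    rw [add_neg_cancel, weightSubmodule_zero δ hB h] at h₁
    have h₂ := mul_le_mul' h₁ (le_refl (J : Submodule B A))
    rwa [← Units.val_mul, inv_mul_cancel_right, one_mul] at h₂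
  exact Units.ext (le_antisymm (key hI hJ) (key hJ hI))

variable [IsDomain A]

/-- Products of elements of `I` and `I⁻¹` are invariant. Hence one nonzero element of weight `-k` in
`I⁻¹` forces weight `k` on all of `I`, and conversely. -/
lemma HasWeight.of_mem {I : (Submodule B A)ˣ} {a b : A} {k : ℤ} (ha : a ∈ (I : Submodule B A))
    (hb : b ∈ ((I⁻¹ : (Submodule B A)ˣ) : Submodule B A)) (ha0 : a ≠ 0) (hb0 : b ≠ 0)
    (hak : δ a = LaurentPolynomial.C a * LaurentPolynomial.T k)
    (hbk : δ b = LaurentPolynomial.C b * LaurentPolynomial.T (-k)) : HasWeight δ hB I k := by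
  have key {I : (Submodule B A)ˣ} {b : A} {k : ℤ} 
      (hb : b ∈ ((I⁻¹ : (Submodule B A)ˣ) : Submodule B A)) (hb0 : b ≠ 0)
      (hbk : δ b = LaurentPolynomial.C b * LaurentPolynomial.T (-k)) :
      (I : Submodule B A) ≤ weightSubmodule δ hB k := fun a ha ↦ by
    have h := Submodule.mul_mem_mul ha hb
    rw [← Units.val_mul, mul_inv_cancel] at h
    obtain ⟨c, hc⟩ := Submodule.mem_one.mp h
    have h' : δ a * δ b = LaurentPolynomial.C a * LaurentPolynomial.C b := by
      rw [← map_mul, ← map_mul, ← hc, hB]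
    have hT : (LaurentPolynomial.T k : A[T;T⁻¹]) * LaurentPolynomial.T (-k) = 1 := by
      rw [← LaurentPolynomial.T_add, add_neg_cancel, LaurentPolynomial.T_zero]
    have hCb : (LaurentPolynomial.C b : A[T;T⁻¹]) ≠ 0 := laurent_C_ne_zero hb0
    rw [mem_weightSubmodule]
    refine mul_right_cancel₀ hCb ?_
    rw [hbk] at h'
    linear_combination LaurentPolynomial.T k * h' - δ a * LaurentPolynomial.C b * hT
  refine ⟨key hb hb0 hbk, key (I := I⁻¹) (by rwa [inv_inv]) ha0 (by rwa [neg_neg])⟩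

/-- Choose `a ∈ I` and `b ∈ I⁻¹` with `a b ≠ 0`. As `a b` is invariant, the coactions of `a` and `b`
multiply to a nonzero constant Laurent polynomial, so both are monomials. -/
lemma exists_hasWeight (hδ : ∀ a, LaurentPolynomial.eval₂ (RingHom.id A) 1 (δ a) = a)
    (I : (Submodule B A)ˣ) : ∃ k, HasWeight δ hB I k := by
  -- Evaluating at `λ = 1` shows that the coefficient of the monomial is the element itself.
  have hm {a c : A} {k : ℤ} (h : δ a = LaurentPolynomial.C c * LaurentPolynomial.T k) : c = a := by
    have := hδ a
    rwa [h, LaurentPolynomial.eval₂_C_mul_T, one_zpow, Units.val_one, mul_one] at this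
  have hI : (I : Submodule B A) * ((I⁻¹ : (Submodule B A)ˣ) : Submodule B A) = 1 := by
    rw [← Units.val_mul, mul_inv_cancel, Units.val_one]
  obtain ⟨a, ha, b, hb, hab⟩ : ∃ a ∈ (I : Submodule B A),
      ∃ b ∈ ((I⁻¹ : (Submodule B A)ˣ) : Submodule B A), a * b ≠ 0 := by
    by_contra! h
    have h₀ : (I : Submodule B A) * ((I⁻¹ : (Submodule B A)ˣ) : Submodule B A) ≤ ⊥ :=
      Submodule.mul_le.mpr fun a ha b hb ↦ (Submodule.mem_bot B).mpr (h a ha b hb)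
    rw [hI] at h₀
    exact one_ne_zero ((Submodule.mem_bot B).mp (h₀ (Submodule.one_le.mp le_rfl)))
  have hab' := Submodule.mul_mem_mul ha hb
  rw [hI] at hab'
  obtain ⟨c, hc⟩ := Submodule.mem_one.mp hab'
  have h : δ a * δ b = LaurentPolynomial.C (a * b) := by rw [← map_mul, ← hc, hB]
  obtain ⟨a', k, hk⟩ := exists_eq_C_mul_T hab h
  obtain ⟨b', l, hl⟩ := exists_eq_C_mul_T hab ((mul_comm _ _).trans h)
  obtain rfl := hm hk
  obtain rfl := hm hl
  have hkl : LaurentPolynomial.C (a' * b') * LaurentPolynomial.T (k + l) =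
      LaurentPolynomial.C (a' * b') * LaurentPolynomial.T 0 := by
    rw [LaurentPolynomial.T_add, LaurentPolynomial.T_zero, mul_one]
    refine Eq.trans ?_ h
    rw [hk, hl, map_mul]
    ring
  have hkl' := congrArg LaurentPolynomial.degree hkl
  rw [LaurentPolynomial.degree_C_mul_T _ _ hab, LaurentPolynomial.degree_C_mul_T _ _ hab] at hkl'
  obtain rfl : l = -k := by
    have := WithBot.coe_injective hkl'
    omega
  exact ⟨k, .of_mem ha hb (left_ne_zero_of_mul hab) (right_ne_zero_of_mul hab) hk hl⟩

variable (δ hB)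

/-- If the coordinate ring `A` of a principal `𝔾ₘ`-bundle over `Spec B` has trivial Picard group
and only units of weight `0`, then the class of the bundle generates the Picard group of `B`
freely. -/
lemma exists_pic_generator [FaithfulSMul B A] [Subsingleton (CommRing.Pic A)]
    (hδ : ∀ a, LaurentPolynomial.eval₂ (RingHom.id A) 1 (δ a) = a)
    (h₀ : ∀ a, δ a = LaurentPolynomial.C a → ∃ b, algebraMap B A b = a)
    (hu : ∀ u : Aˣ, δ u = LaurentPolynomial.C (u : A))
    (h₁ : 1 ∈ weightSubmodule δ hB 1 * weightSubmodule δ hB (-1)) :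
    ∃ L : CommRing.Pic B, Nonempty (L.AsModule ≃ₗ[B] weightSubmodule δ hB 1) ∧
      Subgroup.zpowers L = ⊤ ∧ ∀ k : ℤ, L ^ k = 1 → k = 0 := by
  -- The product lies in weight zero, which is `B`, and contains `1`; so the weight one part is
  -- invertible.
  have h₂ : weightSubmodule δ hB 1 * weightSubmodule δ hB (-1) = 1 := by
    refine le_antisymm ?_ (Submodule.one_le.mpr h₁)
    refine (weightSubmodule_mul_le δ hB 1 (-1)).trans (le_of_eq ?_)
    rw [add_neg_cancel, weightSubmodule_zero δ hB h₀]
  let I : (Submodule B A)ˣ := ⟨_, _, h₂, (mul_comm _ _).trans h₂⟩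
  have hI : HasWeight δ hB I 1 := ⟨le_rfl, le_rfl⟩
  refine ⟨Submodule.unitsToPic B A I, ⟨Submodule.unitsToPicEquiv I⟩, ?_, fun k hk ↦ ?_⟩
  · refine eq_top_iff.mpr fun P _ ↦ ?_
    -- The range consists of the classes that become trivial over `A`, which are all classes.
    have hP : P ∈ (Submodule.unitsToPic B A).range := by
      rw [Submodule.range_unitsToPic, CommRing.relPic_eq_top]
      trivial
    obtain ⟨J, rfl⟩ := hP
    obtain ⟨k, hJ⟩ := exists_hasWeight (hB := hB) hδ J
    refine ⟨k, ?_⟩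
    change Submodule.unitsToPic B A I ^ k = _
    rw [← map_zpow, (hI.zpow k).eq h₀ hJ]
  -- A trivial class is spanned by a unit of `A`; it has weight `k` as an element of the power of
  -- `I` and weight `0` as a unit.
  · rw [← map_zpow, ← MonoidHom.mem_ker, Submodule.ker_unitsToPic] at hk
    obtain ⟨u, hu'⟩ := hk
    have hmem : (u : A) ∈ weightSubmodule δ hB k := by
      refine (hI.zpow k).1 ?_
      rw [← hu']
      exact Submodule.mem_span_singleton_self (u : A)
    rw [mem_weightSubmodule, hu u] at hmem
    have := congrArg LaurentPolynomial.degree hmem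
    rw [LaurentPolynomial.degree_C_mul_T _ _ u.ne_zero, LaurentPolynomial.degree_C u.ne_zero] at this
    exact (WithBot.coe_injective this).symm

end Graded

/-! ## The Picard group of the surface -/

section Pic

variable {m n : ℕ}

lemma counit_coact (a : ThreefoldRing m n) :
    LaurentPolynomial.eval₂ (RingHom.id (ThreefoldRing m n)) 1 (coact m n a) = a := by
  have h : (LaurentPolynomial.eval₂ (RingHom.id (ThreefoldRing m n)) 1).comp (coact m n) =
      RingHom.id _ := by
    refine threefoldRing_hom_ext (fun z ↦ ?_) fun i ↦ ?_
    · rw [RingHom.comp_apply, coact_algebraMap, LaurentPolynomial.eval₂_C]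
    · rw [RingHom.comp_apply, coact_coord, map_mul, LaurentPolynomial.eval₂_C,
        LaurentPolynomial.eval₂_T, one_zpow, Units.val_one, one_mul]
  exact DFunLike.congr_fun h a

lemma laurent_eq_of_mul_eq_one {A : Type} [CommRing A] [IsDomain A] {F G : A[T;T⁻¹]}
    (h : F * G = 1) : ∃ (a b : A) (k : ℤ), a * b = 1 ∧
      F = LaurentPolynomial.C a * LaurentPolynomial.T k ∧
      G = LaurentPolynomial.C b * LaurentPolynomial.T (-k) := by
  rw [← map_one (LaurentPolynomial.C (R := A))] at h
  obtain ⟨a, k, rfl⟩ := exists_eq_C_mul_T one_ne_zero h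
  obtain ⟨b, l, rfl⟩ := exists_eq_C_mul_T one_ne_zero ((mul_comm _ _).trans h)
  have hab : a * b = 1 := by
    have := congrArg (LaurentPolynomial.eval₂ (RingHom.id A) 1) h
    rwa [map_mul, LaurentPolynomial.eval₂_C_mul_T, LaurentPolynomial.eval₂_C_mul_T,
      one_zpow, one_zpow, LaurentPolynomial.eval₂_C, Units.val_one, mul_one, mul_one] at this
  have hab' := congrArg (LaurentPolynomial.C (R := A)) hab
  rw [map_mul, map_one] at hab'
  have hk : (LaurentPolynomial.T k : A[T;T⁻¹]) * LaurentPolynomial.T (-k) = 1 := by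
    rw [← LaurentPolynomial.T_add, add_neg_cancel, LaurentPolynomial.T_zero]
  rw [map_one] at h
  refine ⟨a, b, k, hab, rfl, ?_⟩
  linear_combination LaurentPolynomial.C b * LaurentPolynomial.T (-k) * h -
    LaurentPolynomial.C b * LaurentPolynomial.T l * hk * (LaurentPolynomial.C a *
    LaurentPolynomial.C b) - LaurentPolynomial.C b * LaurentPolynomial.T l * hab'

/-- After inverting `x`, a unit is a constant times a power of `x`, and the exponent is zero because
`x` is not a unit of the coordinate ring. -/
lemma eq_algebraMap_of_isUnit (hm : 1 ≤ m) (hn : 1 ≤ n) (u : (ThreefoldRing m n)ˣ) :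
    ∃ z : ℂ, (u : ThreefoldRing m n) = algebraMap ℂ _ z := by
  -- This excludes positive exponents; negative ones are excluded by applying it to the inverse.
  have key (u : (ThreefoldRing m n)ˣ) (p : PlaneRing) (k : ℕ) : localChart m n u ≠
      LaurentPolynomial.C p * LaurentPolynomial.T (k + 1) := fun h ↦ by
    obtain ⟨a, ha⟩ := C_mem_range_localChart (m := m) (n := n) p
    have h' : (u : ThreefoldRing m n) = a * coord m n 0 ^ (k + 1) := by
      apply localChart_injective
      rw [h, map_mul, ha, map_pow, localChart_coord_zero, LaurentPolynomial.T_pow]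
      simp
    refine (prime_coord_zero hm hn).not_isUnit (isUnit_of_dvd_unit ⟨a * coord m n 0 ^ k, ?_⟩ u.isUnit)
    rw [h', pow_succ]
    ring
  have h₁ : localChart m n u * localChart m n (u⁻¹ : (ThreefoldRing m n)ˣ) = 1 := by
    rw [← map_mul, u.mul_inv, map_one]
  obtain ⟨a, b, k, hab, h, h'⟩ := laurent_eq_of_mul_eq_one h₁
  obtain hk | rfl | hk := lt_trichotomy k 0
  · obtain ⟨j, hj⟩ := Int.eq_ofNat_of_zero_le (show 0 ≤ -k - 1 by omega)
    exact (key u⁻¹ b j (by rw [h', ← hj, sub_add_cancel])).elim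
  · obtain ⟨z, hz, rfl⟩ := Polynomial.isUnit_iff.mp (IsUnit.of_mul_eq_one b hab)
    obtain ⟨z, hz, rfl⟩ := Polynomial.isUnit_iff.mp hz
    have hz : localChart m n u = localChart m n (algebraMap ℂ _ z) := by
      rw [h, localChart_algebraMap, LaurentPolynomial.T_zero, mul_one]
    exact ⟨z, localChart_injective hz⟩
  · obtain ⟨j, hj⟩ := Int.eq_ofNat_of_zero_le (show 0 ≤ k - 1 by omega)
    exact (key u a j (by rw [h, ← hj, sub_add_cancel])).elim

lemma coact_unit (hm : 1 ≤ m) (hn : 1 ≤ n) (u : (ThreefoldRing m n)ˣ) :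
    coact m n u = LaurentPolynomial.C (u : ThreefoldRing m n) := by
  obtain ⟨z, hz⟩ := eq_algebraMap_of_isUnit hm hn u
  rw [hz, coact_algebraMap]

variable {B : Type} [CommRing B] [Algebra B (ThreefoldRing m n)]

/-- The relation reads `1 = x (xᵐ⁻¹ v) - y (yⁿ⁻¹ u)`, where the first factors have weight `1` and
the bracketed ones weight `-1`. -/
lemma one_mem_weightSubmodule_mul (hm : 1 ≤ m) (hn : 1 ≤ n)
    (hB : ∀ b : B, coact m n (algebraMap B _ b) = LaurentPolynomial.C (algebraMap B _ b)) :
    1 ∈ weightSubmodule (coact m n) hB 1 * weightSubmodule (coact m n) hB (-1) := by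
  have h₁ : coord m n 0 ∈ weightSubmodule (coact m n) hB 1 := by
    rw [mem_weightSubmodule, coact_zero, mul_comm]
  have h₂ : coord m n 1 ∈ weightSubmodule (coact m n) hB 1 := by
    rw [mem_weightSubmodule, coact_one, mul_comm]
  have hT (k : ℕ) (hk : 1 ≤ k) : (LaurentPolynomial.T 1 : (ThreefoldRing m n)[T;T⁻¹]) ^ (k - 1) *
      LaurentPolynomial.T (-k) = LaurentPolynomial.T (-1) := by
    rw [LaurentPolynomial.T_pow, ← LaurentPolynomial.T_add]
    congr 1
    push_cast [hk]
    ring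
  have h₃ : coord m n 0 ^ (m - 1) * coord m n 3 ∈ weightSubmodule (coact m n) hB (-1) := by
    rw [mem_weightSubmodule, map_mul, map_pow, coact_zero, coact_three, map_mul, map_pow]
    linear_combination LaurentPolynomial.C (coord m n 0) ^ (m - 1) *
      LaurentPolynomial.C (coord m n 3) * hT m hm
  have h₄ : coord m n 1 ^ (n - 1) * coord m n 2 ∈ weightSubmodule (coact m n) hB (-1) := by
    rw [mem_weightSubmodule, map_mul, map_pow, coact_one, coact_two, map_mul, map_pow]
    linear_combination LaurentPolynomial.C (coord m n 1) ^ (n - 1) *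
      LaurentPolynomial.C (coord m n 2) * hT n hn
  have h := sub_mem (Submodule.mul_mem_mul h₁ h₃) (Submodule.mul_mem_mul h₂ h₄)
  have h' : coord m n 0 * (coord m n 0 ^ (m - 1) * coord m n 3) -
      coord m n 1 * (coord m n 1 ^ (n - 1) * coord m n 2) = 1 := by
    rw [← mul_assoc, ← mul_assoc, ← pow_succ', ← pow_succ', Nat.sub_add_cancel hm,
      Nat.sub_add_cancel hn, coord_relation]
  rwa [h'] at h

variable {q : Threefold m n ⟶ Surface (m + n) m}

lemma funOn_top_bijective : Function.Bijective (funOn m n ⊤) := by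
  have h : ⇑(funOn m n ⊤) = (Scheme.ΓSpecIso (.of (ThreefoldRing m n))).inv :=
    funext fun a ↦ specFun_top a
  rw [h]
  exact ConcreteCategory.bijective_of_isIso (Scheme.ΓSpecIso (.of (ThreefoldRing m n))).inv

lemma gmFunOn_top_injective : Function.Injective (gmFunOn m n ⊤) := by
  have h : ⇑(gmFunOn m n ⊤) = (Scheme.ΓSpecIso (.of (ThreefoldRing m n)[T;T⁻¹])).inv :=
    funext fun a ↦ specFun_top a
  rw [h]
  exact (ConcreteCategory.bijective_of_isIso
    (Scheme.ΓSpecIso (.of (ThreefoldRing m n)[T;T⁻¹])).inv).injective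

lemma act_appTop_funOn (a : ThreefoldRing m n) :
    (act m n).appTop (funOn m n ⊤ a) = gmFunOn m n ⊤ (coact m n a) := by
  have h : (act m n).appLE ⊤ ⊤ le_rfl = (act m n).appTop := (act m n).appLE_eq_app (U := ⊤)
  rw [← h]
  exact act_appLE_funOn m n (U := ⊤) (W := ⊤) le_rfl a

lemma proj_appTop_funOn (a : ThreefoldRing m n) :
    (proj m n).appTop (funOn m n ⊤ a) = gmFunOn m n ⊤ (LaurentPolynomial.C a) := by
  have h : (proj m n).appLE ⊤ ⊤ le_rfl = (proj m n).appTop := (proj m n).appLE_eq_app (U := ⊤)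
  rw [← h]
  exact proj_appLE_funOn m n (U := ⊤) (W := ⊤) le_rfl a

lemma exists_appTop_eq_iff (h : IsGeometricQuotient (act m n) (proj m n) q)
    (a : ThreefoldRing m n) :
    (∃ b, q.appTop b = funOn m n ⊤ a) ↔ coact m n a = LaurentPolynomial.C a := by
  refine (h.invariants ⊤ (funOn m n ⊤ a)).trans ⟨fun H ↦ ?_, fun H W ha hp ↦ ?_⟩
  · have := H ⊤ le_rfl le_rfl
    exact gmFunOn_top_injective ((act_appLE_funOn m n (U := ⊤) (W := ⊤) le_rfl a).symm.trans
      (this.trans (proj_appLE_funOn m n (U := ⊤) (W := ⊤) le_rfl a)))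
  · exact (act_appLE_funOn m n (U := ⊤) ha a).trans ((congrArg _ H).trans
      (proj_appLE_funOn m n (U := ⊤) hp a).symm)

/-- The class of the quotient bundle freely generates the Picard group of the surface. -/
lemma exists_isClassOfBundle [IsAffine (Surface (m + n) m)] (hm : 1 ≤ m) (hn : 1 ≤ n)
    (h : IsGeometricQuotient (act m n) (proj m n) q) :
    ∃ L : Pic (Surface (m + n) m), IsClassOfBundle (act m n) (proj m n) (scaling m n) q L ∧
      Subgroup.zpowers L = ⊤ ∧ ∀ k : ℤ, L ^ k = 1 → k = 0 := by
  let e : ThreefoldRing m n ≃+* Γ(Threefold m n, ⊤) := .ofBijective _ funOn_top_bijective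
  let β : Γ(Surface (m + n) m, ⊤) →+* ThreefoldRing m n := e.symm.toRingHom.comp q.appTop.hom
  have hβ (b) : funOn m n ⊤ (β b) = q.appTop b := e.apply_symm_apply _
  let : Algebra Γ(Surface (m + n) m, ⊤) (ThreefoldRing m n) := β.toAlgebra
  have : FaithfulSMul Γ(Surface (m + n) m, ⊤) (ThreefoldRing m n) :=
    (faithfulSMul_iff_algebraMap_injective _ _).mpr
      (e.symm.injective.comp (h.injective ⊤))
  have := subsingleton_pic_threefoldRing hm hn
  have hB (b) : coact m n (β b) = LaurentPolynomial.C (β b) :=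
    (exists_appTop_eq_iff h (β b)).mp ⟨b, (hβ b).symm⟩
  obtain ⟨L, ⟨φ⟩, hL, hL'⟩ := exists_pic_generator (coact m n) hB counit_coact
    (fun a ha ↦ by
      obtain ⟨b, hb⟩ := (exists_appTop_eq_iff h a).mpr ha
      exact ⟨b, funOn_top_bijective.injective ((hβ b).trans hb)⟩)
    (coact_unit hm hn) (one_mem_weightSubmodule_mul hm hn hB)
  have hs : scaling m n = gmFunOn m n ⊤ (LaurentPolynomial.T 1) := (specFun_top _).symm
  have key (a : ThreefoldRing m n) : (act m n).appTop (funOn m n ⊤ a) =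
      scaling m n * (proj m n).appTop (funOn m n ⊤ a) ↔
        a ∈ weightSubmodule (coact m n) hB 1 := by
    rw [act_appTop_funOn, proj_appTop_funOn, hs, ← map_mul, gmFunOn_top_injective.eq_iff,
      mem_weightSubmodule, mul_comm]
  have hrange (f : Γ(Threefold m n, ⊤)) : (∃ s, funOn m n ⊤ (φ s : ThreefoldRing m n) = f) ↔
      (act m n).appTop f = scaling m n * (proj m n).appTop f := by
    have hf : ∃ a, funOn m n ⊤ a = f := funOn_top_bijective.surjective f
    obtain ⟨a, rfl⟩ := hf
    refine Iff.trans ⟨?_, fun ha ↦ ?_⟩ (key a).symm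
    · rintro ⟨s, hs⟩
      have hs' : (φ s : ThreefoldRing m n) = a := funOn_top_bijective.injective hs
      rw [← hs']
      exact (φ s).2
    · exact ⟨φ.symm ⟨a, ha⟩, congrArg (funOn m n ⊤) (congrArg Subtype.val (φ.apply_symm_apply _))⟩
  refine ⟨L, ⟨⟨⟨fun s ↦ funOn m n ⊤ (φ s : ThreefoldRing m n), fun s t ↦ ?_⟩, fun b s ↦ ?_⟩,
    fun s t hst ↦ ?_, Set.ext hrange⟩, hL, hL'⟩
  · rw [map_add, Submodule.coe_add, map_add]
  · have h₁ : (φ (b • s) : ThreefoldRing m n) = β b * φ s := congrArg Subtype.val (φ.map_smul b s)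
    exact (congrArg (funOn m n ⊤) h₁).trans ((map_mul _ _ _).trans (congrArg (· * _) (hβ b)))
  · exact φ.injective (Subtype.ext (funOn_top_bijective.injective hst))

end Pic

/-! ### The first cohomology of a sheaf from a cover by two open subsets -/

section Sheaf
open Opposite TopologicalSpace

/-- Injective sheaves are flasque: sections over `W` are maps from the free abelian sheaf on `W`,
and the free sheaf on `U` embeds in the one on `V`. -/
lemma surjective_map_of_injective {C : Type} [Category.{0} C] {J : GrothendieckTopology C}
    [HasSheafify J AddCommGrpCat.{0}] (I : Sheaf J AddCommGrpCat.{0}) [Injective I] {U V : C}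
    (h : U ⟶ V) [Mono h] : Function.Surjective (I.obj.map h.op) := by
  intro s
  let e (W : C) : ((presheafToSheaf J AddCommGrpCat.{0}).obj
      (yoneda.obj W ⋙ AddCommGrpCat.free) ⟶ I) ≃ (I.obj.obj (op W) : Type) :=
    ((sheafificationAdjunction J AddCommGrpCat.{0}).homEquiv (yoneda.obj W ⋙ AddCommGrpCat.free)
      I).trans ((((Adjunction.whiskerRight Cᵒᵖ AddCommGrpCat.adj.{0}).homEquiv (yoneda.obj W)
        I.obj)).trans yonedaEquiv)
  let g := (presheafToSheaf J AddCommGrpCat.{0}).map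
    (Functor.whiskerRight (yoneda.map h) AddCommGrpCat.free)
  have he (t : (presheafToSheaf J AddCommGrpCat.{0}).obj (yoneda.obj V ⋙ AddCommGrpCat.free) ⟶ I) :
      I.obj.map h.op (e V t) = e U (g ≫ t) := by
    simp only [e, Equiv.trans_apply]
    refine Eq.trans ?_ (congrArg _ (congrArg _
      ((sheafificationAdjunction J AddCommGrpCat).homEquiv_naturality_left _ _).symm))
    refine Eq.trans ?_ (congrArg _ (((Adjunction.whiskerRight Cᵒᵖ
      AddCommGrpCat.adj.{0}).homEquiv_naturality_left (yoneda.map h) _).symm))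
    exact yonedaEquiv_naturality (C := C) (F := I.obj ⋙ forget AddCommGrpCat.{0}) _ h
  refine ⟨e V (Injective.factorThru ((e U).symm s) g), ?_⟩
  rw [he, Injective.comp_factorThru, Equiv.apply_symm_apply]


open Abelian in
-- The long exact sequence, with `H¹` of the injective middle term equal to zero.
lemma exists_connecting {C : Type} [Category.{0} C] {J : GrothendieckTopology C}
    [HasSheafify J AddCommGrpCat.{0}] [HasExt.{0} (Sheaf J AddCommGrpCat.{0})] {T : C}
    (hT : IsTerminal T) {S : ShortComplex (Sheaf J AddCommGrpCat.{0})} (hS : S.ShortExact)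
    [Injective S.X₂] : ∃ π : S.X₃.obj.obj (op T) →+ S.X₁.H 1, Function.Surjective π ∧
      ∀ t, π t = 0 ↔ ∃ s, S.g.hom.app (op T) s = t := by
  let e (F : Sheaf J AddCommGrpCat.{0}) := Sheaf.H.equiv₀ F hT
  refine ⟨(hS.extClass.postcomp _ (zero_add 1)).comp (e S.X₃).symm.toAddMonoidHom, fun x ↦ ?_,
    fun t ↦ ⟨fun h ↦ ?_, ?_⟩⟩
  · obtain ⟨y, hy⟩ := Ext.covariant_sequence_exact₁ _ hS x (Ext.eq_zero_of_injective _) (zero_add 1)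
    refine ⟨e S.X₃ y, Eq.trans ?_ hy⟩
    exact congrArg (fun z ↦ z.comp hS.extClass (zero_add 1)) ((e S.X₃).symm_apply_apply y)
  · obtain ⟨y, hy⟩ := Ext.covariant_sequence_exact₃ _ hS _ (zero_add 1) h
    have hy' : Sheaf.H.map S.g 0 y = (e S.X₃).symm t := hy
    refine ⟨e S.X₂ y, (Sheaf.H.equiv₀_naturality hT S.g y).trans ?_⟩
    rw [hy']
    exact (e S.X₃).apply_symm_apply t
  · rintro ⟨s, rfl⟩
    have h := Sheaf.H.equiv₀_symm_naturality hT S.g s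
    change ((e S.X₃).symm _).comp hS.extClass (zero_add 1) = 0
    rw [← h, Sheaf.H.map_apply]
    refine (Ext.comp_assoc_of_second_deg_zero _ _ _ _).trans ?_
    rw [hS.comp_extClass, Ext.comp_zero]


variable {X : TopCat.{0}} (F : Sheaf (Opens.grothendieckTopology X) AddCommGrpCat.{0})

/-- The restriction maps of a sheaf of abelian groups. -/
def sheafRes {U V : Opens X} (h : U ≤ V) : F.obj.obj (op V) →+ F.obj.obj (op U) :=
  (F.obj.map (homOfLE h).op).hom

lemma sheafRes_sheafRes {U V W : Opens X} (h : U ≤ V) (h' : V ≤ W) (s : F.obj.obj (op W)) :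
    sheafRes F h (sheafRes F h' s) = sheafRes F (h.trans h') s :=
  (ConcreteCategory.congr_hom (F.obj.map_comp (homOfLE h').op (homOfLE h).op) s).symm

lemma sheafRes_self {U : Opens X} (s : F.obj.obj (op U)) :
    sheafRes F le_rfl s = s :=
  ConcreteCategory.congr_hom (F.obj.map_id (op U)) s

variable {F} in
lemma app_sheafRes {G : Sheaf (Opens.grothendieckTopology X) AddCommGrpCat.{0}} (g : F ⟶ G) {U V : Opens X} (h : U ≤ V)
    (s : F.obj.obj (op V)) : g.hom.app (op U) (sheafRes F h s) =
      sheafRes G h (g.hom.app (op V) s) :=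
  ConcreteCategory.congr_hom (g.hom.naturality (homOfLE h).op) s

lemma sheaf_ext_of_sup {U₁ U₂ V : Opens X} (h₁ : U₁ ≤ V) (h₂ : U₂ ≤ V) (h : V ≤ U₁ ⊔ U₂)
    {s t : F.obj.obj (op V)} (e₁ : sheafRes F h₁ s = sheafRes F h₁ t)
    (e₂ : sheafRes F h₂ s = sheafRes F h₂ t) : s = t :=
  TopCat.Sheaf.eq_of_locally_eq₂ F (homOfLE h₁) (homOfLE h₂) h s t e₁ e₂

lemma sheaf_exists_glue {U₁ U₂ V : Opens X} (h₁ : U₁ ≤ V) (h₂ : U₂ ≤ V) (h : V ≤ U₁ ⊔ U₂)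
    (s₁ : F.obj.obj (op U₁)) (s₂ : F.obj.obj (op U₂))
    (e : sheafRes F inf_le_left s₁ = sheafRes F (inf_le_right : U₁ ⊓ U₂ ≤ U₂) s₂) :
    ∃ s, sheafRes F h₁ s = s₁ ∧ sheafRes F h₂ s = s₂ := by
  let U : Fin 2 → Opens X := ![U₁, U₂]
  let sf : (i : Fin 2) → F.obj.obj (op (U i)) 
    | 0 => s₁
    | 1 => s₂
  have hU (i : Fin 2) : U i ≤ V := by
    match i with
    | 0 => exact h₁
    | 1 => exact h₂
  have hcover : V ≤ iSup U := h.trans (sup_le (le_iSup U 0) (le_iSup U 1))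
  have hsf : TopCat.Presheaf.IsCompatible F.obj U sf := by
    intro i j
    match i, j with
    | 0, 0 => rfl
    | 1, 1 => rfl
    | 0, 1 => exact e
    | 1, 0 =>
      have := congrArg (sheafRes F (le_of_eq (inf_comm U₂ U₁))) e
      rw [sheafRes_sheafRes, sheafRes_sheafRes] at this
      exact this.symm
  obtain ⟨s, hs, -⟩ := TopCat.Sheaf.existsUnique_gluing' F U V (fun i ↦ homOfLE (hU i)) hcover sf hsf
  exact ⟨s, hs 0, hs 1⟩

/-- Every short exact sequence `0 → F → G → H → 0` of sheaves induces a surjection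
`G(V) → H(V)`. -/
def LiftsOn (V : Opens X) : Prop :=
  ∀ ⦃G H : Sheaf (Opens.grothendieckTopology X) AddCommGrpCat.{0}⦄ (f : F ⟶ G) (g : G ⟶ H) (w : f ≫ g = 0),
    (ShortComplex.mk f g w).ShortExact → Function.Surjective (g.hom.app (op V))

lemma app_injective_of_shortExact {S : ShortComplex (Sheaf (Opens.grothendieckTopology X) AddCommGrpCat.{0})} 
    (hS : S.ShortExact) (V : Opens X) : Function.Injective (S.f.hom.app (op V)) := by
  have := hS.mono_f
  have : Mono ((sheafToPresheaf _ _).map S.f) := inferInstance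
  exact (AddCommGrpCat.mono_iff_injective _).mp ((NatTrans.mono_iff_mono_app _).mp this (op V))

lemma app_app_eq_zero (S : ShortComplex (Sheaf (Opens.grothendieckTopology X) AddCommGrpCat.{0})) (V : Opens X)
    (s : S.X₁.obj.obj (op V)) : S.g.hom.app (op V) (S.f.hom.app (op V) s) = 0 :=
  ConcreteCategory.congr_hom (congr_app (congrArg (·.hom) S.zero) (op V)) s

/-- If `F` is acyclic on the members of an open cover `{V₀, V₁}` and its Čech cohomology group is
freely generated by the class of `c`, then the first cohomology of `F` is infinite cyclic. -/
lemma nonempty_H_one_addEquiv {V₀ V₁ : Opens X} (hV : V₀ ⊔ V₁ = ⊤) (h₀ : LiftsOn F V₀)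
    (h₁ : LiftsOn F V₁) (c : F.obj.obj (op (V₀ ⊓ V₁)))
    (hc : ∀ x, ∃ (k : ℤ) (a : F.obj.obj (op V₀)) (b : F.obj.obj (op V₁)),
      x = k • c + sheafRes F inf_le_left a - sheafRes F inf_le_right b)
    (hc' : ∀ (k : ℤ) (a : F.obj.obj (op V₀)) (b : F.obj.obj (op V₁)),
      k • c = sheafRes F inf_le_left a - sheafRes F inf_le_right b → k = 0) :
    Nonempty (Sheaf.H F 1 ≃+ ℤ) := by
  let S := ShortComplex.mk (Injective.ι F) (cokernel.π (Injective.ι F)) (cokernel.condition _)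
  have hS : S.ShortExact := { exact := ShortComplex.exact_cokernel _ }
  have hI : Injective S.X₂ := inferInstanceAs (Injective (Injective.under F))
  obtain ⟨π, hπ, hπ'⟩ := exists_connecting (isTerminalTop (α := Opens X)) hS
  let f (V : Opens X) : F.obj.obj (op V) →+ S.X₂.obj.obj (op V) := (S.f.hom.app (op V)).hom
  let g (V : Opens X) : S.X₂.obj.obj (op V) →+ S.X₃.obj.obj (op V) := (S.g.hom.app (op V)).hom
  have hf (V : Opens X) : Function.Injective (f V) := app_injective_of_shortExact hS V
  have hgf (V : Opens X) (s) : g V (f V s) = 0 := app_app_eq_zero S V s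
  have hfg (V : Opens X) (s) (hs : g V s = 0) : ∃ t, f V t = s :=
    TopCat.Sheaf.sections_exact_of_left_exact hS.exact hS.mono_f s hs
  have hfr {U V : Opens X} (h : U ≤ V) (s) : f U (sheafRes F h s) = sheafRes S.X₂ h (f V s) :=
    app_sheafRes S.f h s
  have hgr {U V : Opens X} (h : U ≤ V) (s) : g U (sheafRes S.X₂ h s) = sheafRes S.X₃ h (g V s) :=
    app_sheafRes S.g h s
  -- `G` is a correspondence between `H¹` and `ℤ`: its elements are `(s₀, s₁, t, k)`, where `s₀` and
  -- `s₁` lift `t` on the two open subsets and `s₀ - s₁` is the image of `k • c`. The projections to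
  -- `π t` and to `k` are both surjective and have the same kernel.
  let G : AddSubgroup (S.X₂.obj.obj (op V₀) × S.X₂.obj.obj (op V₁) × S.X₃.obj.obj (op ⊤) × ℤ) :=
    { carrier := {x | g V₀ x.1 = sheafRes _ le_top x.2.2.1 ∧ g V₁ x.2.1 = sheafRes _ le_top x.2.2.1 ∧
        x.2.2.2 • f _ c = sheafRes _ inf_le_left x.1 - sheafRes _ inf_le_right x.2.1}
      add_mem' := by
        rintro x y ⟨hx₁, hx₂, hx₃⟩ ⟨hy₁, hy₂, hy₃⟩
        refine ⟨?_, ?_, ?_⟩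
        · simp only [Prod.fst_add, Prod.snd_add, map_add, hx₁, hy₁]
        · simp only [Prod.fst_add, Prod.snd_add, map_add, hx₂, hy₂]
        · simp only [Prod.fst_add, Prod.snd_add, map_add, add_smul, hx₃, hy₃]
          abel
      zero_mem' := by
        refine ⟨?_, ?_, ?_⟩
        · simp only [Prod.fst_zero, Prod.snd_zero, map_zero]
        · simp only [Prod.fst_zero, Prod.snd_zero, map_zero]
        · simp only [Prod.fst_zero, Prod.snd_zero, map_zero, zero_smul, sub_zero]
      neg_mem' := by
        rintro x ⟨hx₁, hx₂, hx₃⟩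
        refine ⟨?_, ?_, ?_⟩
        · simp only [Prod.fst_neg, Prod.snd_neg, map_neg, hx₁]
        · simp only [Prod.fst_neg, Prod.snd_neg, map_neg, hx₂]
        · simp only [Prod.fst_neg, Prod.snd_neg, map_neg, neg_smul, hx₃]
          abel }
  have hG {x} : x ∈ G ↔ g V₀ x.1 = sheafRes _ le_top x.2.2.1 ∧
      g V₁ x.2.1 = sheafRes _ le_top x.2.2.1 ∧
      x.2.2.2 • f _ c = sheafRes _ inf_le_left x.1 - sheafRes _ inf_le_right x.2.1 := Iff.rfl
  let α : G →+ Sheaf.H F 1 := π.comp ((AddMonoidHom.fst _ _).comp ((AddMonoidHom.snd _ _).comp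
    ((AddMonoidHom.snd _ _).comp G.subtype)))
  let β : G →+ ℤ := (AddMonoidHom.snd _ _).comp ((AddMonoidHom.snd _ _).comp
    ((AddMonoidHom.snd _ _).comp G.subtype))
  have hα : Function.Surjective α := fun z ↦ by
    obtain ⟨t, rfl⟩ := hπ z
    obtain ⟨s₀, hs₀⟩ := h₀ _ _ _ hS (sheafRes _ le_top t)
    obtain ⟨s₁, hs₁⟩ := h₁ _ _ _ hS (sheafRes _ le_top t)
    change g V₀ s₀ = _ at hs₀
    change g V₁ s₁ = _ at hs₁
    obtain ⟨x, hx⟩ := hfg _ (sheafRes _ inf_le_left s₀ - sheafRes _ inf_le_right s₁) (by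
      rw [map_sub, hgr, hgr, hs₀, hs₁, sheafRes_sheafRes, sheafRes_sheafRes, sub_self])
    obtain ⟨k, a, b, rfl⟩ := hc x
    refine ⟨⟨(s₀ - f _ a, s₁ - f _ b, t, k), hG.mpr ⟨?_, ?_, ?_⟩⟩, rfl⟩
    · rw [map_sub, hgf, sub_zero, hs₀]
    · rw [map_sub, hgf, sub_zero, hs₁]
    · simp only [map_sub, map_add, map_zsmul, hfr] at hx ⊢
      rw [eq_sub_iff_add_eq] at hx
      rw [← sub_eq_zero, ← sub_eq_zero.mpr hx]
      abel
  have hβ : Function.Surjective β := fun k ↦ by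
    -- Flasqueness extends `k • c` to `V₀`; the lift on `V₁` is taken to be `0`.
    obtain ⟨s, hs⟩ := surjective_map_of_injective S.X₂ (homOfLE (inf_le_left : V₀ ⊓ V₁ ≤ V₀))
      (k • f _ c)
    change sheafRes _ inf_le_left s = _ at hs
    obtain ⟨t, ht₀, ht₁⟩ := sheaf_exists_glue S.X₃ (le_top : V₀ ≤ ⊤) (le_top : V₁ ≤ ⊤) hV.ge
      (g V₀ s) 0 (by rw [← hgr, hs, map_zsmul, hgf, smul_zero, map_zero])
    refine ⟨⟨(s, 0, t, k), hG.mpr ⟨ht₀.symm, ?_, ?_⟩⟩, rfl⟩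
    · rw [map_zero, ht₁]
    · rw [hs, map_zero, sub_zero]
  have hker : α.ker = β.ker := by
    ext ⟨⟨s₀, s₁, t, k⟩, hx⟩
    obtain ⟨hx₁, hx₂, hx₃⟩ := hG.mp hx
    change π t = 0 ↔ k = 0
    rw [hπ']
    refine ⟨?_, ?_⟩
    · rintro ⟨s, rfl⟩
      change g V₀ s₀ = sheafRes _ le_top (g ⊤ s) at hx₁
      change g V₁ s₁ = sheafRes _ le_top (g ⊤ s) at hx₂
      obtain ⟨a, ha⟩ := hfg V₀ (s₀ - sheafRes _ le_top s) (by rw [map_sub, hx₁, hgr, sub_self])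
      obtain ⟨b, hb⟩ := hfg V₁ (s₁ - sheafRes _ le_top s) (by rw [map_sub, hx₂, hgr, sub_self])
      refine hc' k a b (hf _ ?_)
      rw [map_zsmul, map_sub, hfr, hfr, ha, hb, map_sub, map_sub, sheafRes_sheafRes,
        sheafRes_sheafRes, hx₃]
      abel
    · rintro rfl
      rw [zero_smul] at hx₃
      obtain ⟨s, hs₀, hs₁⟩ := sheaf_exists_glue S.X₂ (le_top : V₀ ≤ ⊤) (le_top : V₁ ≤ ⊤) hV.ge
        s₀ s₁ (sub_eq_zero.mp hx₃.symm)
      refine ⟨s, sheaf_ext_of_sup S.X₃ (le_top : V₀ ≤ ⊤) (le_top : V₁ ≤ ⊤) hV.ge ?_ ?_⟩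
      · exact (hgr le_top s).symm.trans ((congrArg (g V₀) hs₀).trans hx₁)
      · exact (hgr le_top s).symm.trans ((congrArg (g V₁) hs₁).trans hx₂)
  exact ⟨((QuotientAddGroup.quotientKerEquivOfSurjective α hα).symm.trans
    (QuotientAddGroup.quotientAddEquivOfEq hker)).trans
    (QuotientAddGroup.quotientKerEquivOfSurjective β hβ)⟩

end Sheaf

/-! ### Acyclicity on compact open subsets -/

section Compact
open Opposite TopologicalSpace

variable {X : TopCat.{0}} (F : Sheaf (Opens.grothendieckTopology X) AddCommGrpCat.{0})

lemma exists_local_lift {G : Sheaf (Opens.grothendieckTopology X) AddCommGrpCat.{0}} (g : F ⟶ G)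
    [Epi g] {V : Opens X} (t : G.obj.obj (op V)) {x : X} (hx : x ∈ V) :
    ∃ (U : Opens X) (h : U ≤ V), x ∈ U ∧ ∃ s, g.hom.app (op U) s = sheafRes G h t := by
  have h : TopCat.Presheaf.IsLocallySurjective g.hom :=
    (TopCat.Sheaf.isLocallySurjective_iff_epi (X := X) (F := F) (G := G) g).mpr ‹Epi g›
  obtain ⟨U, hU, hs, hxU⟩ := (TopCat.Presheaf.isLocallySurjective_iff g.hom).mp h V t x hx
  exact ⟨U, hU, hxU, hs⟩

/-- A sheaf whose Čech cohomology vanishes for covers by two open subsets is acyclic on compact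
open subsets. -/
lemma liftsOn_of_isCompact {V : Opens X} (hV : IsCompact (V : Set X))
    (h : ∀ U₁ ≤ V, ∀ U₂ ≤ V, ∀ c : F.obj.obj (op (U₁ ⊓ U₂)),
      ∃ (a : F.obj.obj (op U₁)) (b : F.obj.obj (op U₂)),
        c = sheafRes F inf_le_left a - sheafRes F inf_le_right b) : LiftsOn F V := by
  intro I Q f g w hS t
  have hg : Epi g := hS.epi_g
  -- Compact induction on the existence of a lift over some open subset of `V` containing `Z`.
  let p (Z : Set X) : Prop := ∃ (U : Opens X) (h : U ≤ V), Z ⊆ U ∧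
    ∃ s, g.hom.app (op U) s = sheafRes Q h t
  suffices hp : p V by
    obtain ⟨U, hU, hVU, s, hs⟩ := hp
    obtain rfl : U = V := le_antisymm hU hVU
    exact ⟨s, hs.trans (sheafRes_self Q t)⟩
  refine hV.induction_on ⟨⊥, bot_le, Set.empty_subset _, 0, ?_⟩ ?_ ?_ fun x hx ↦ ?_
  · refine TopCat.Sheaf.eq_of_locally_eq' Q (fun i : Empty ↦ i.elim) ⊥ (fun i ↦ i.elim) bot_le
      _ _ fun i ↦ i.elim
  · rintro Z Z' hZ ⟨U, hU, hZ', hs⟩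
    exact ⟨U, hU, hZ.trans hZ', hs⟩
  · rintro Z Z' ⟨U, hU, hZ, s, hs⟩ ⟨U', hU', hZ', s', hs'⟩
    refine ⟨U ⊔ U', sup_le hU hU', Set.union_subset_union hZ hZ', ?_⟩
    obtain ⟨c, hc⟩ := TopCat.Sheaf.sections_exact_of_left_exact hS.exact hS.mono_f
      (sheafRes I (inf_le_left : U ⊓ U' ≤ U) s - sheafRes I inf_le_right s') (by
        change g.hom.app _ _ = _
        rw [map_sub, app_sheafRes, app_sheafRes, hs, hs', sheafRes_sheafRes, sheafRes_sheafRes,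
          sub_self])
    -- The difference of the two lifts comes from `F` and splits; subtracting the parts makes the
    -- lifts glue.
    obtain ⟨a, b, rfl⟩ := h U hU U' hU' c
    have hfg (U : Opens X) (s) : g.hom.app (op U) (f.hom.app (op U) s) = 0 :=
      app_app_eq_zero (ShortComplex.mk f g w) U s
    obtain ⟨r, hr, hr'⟩ := sheaf_exists_glue I (le_sup_left : U ≤ U ⊔ U') le_sup_right le_rfl
      (s - f.hom.app (op U) a) (s' - f.hom.app (op U') b) (by
        change f.hom.app _ _ = _ at hc
        rw [map_sub, app_sheafRes, app_sheafRes, sub_eq_sub_iff_add_eq_add] at hc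
        rw [map_sub, map_sub, sub_eq_sub_iff_add_eq_add, ← hc, add_comm])
    refine ⟨r, sheaf_ext_of_sup Q (le_sup_left : U ≤ U ⊔ U') le_sup_right le_rfl ?_ ?_⟩
    · rw [← app_sheafRes, hr, map_sub, hfg, sub_zero, hs, sheafRes_sheafRes]
    · rw [← app_sheafRes, hr', map_sub, hfg, sub_zero, hs', sheafRes_sheafRes]
  · obtain ⟨U, hU, hxU, hs⟩ := exists_local_lift I g t hx
    exact ⟨U, mem_nhdsWithin_of_mem_nhds (U.isOpen.mem_nhds hxU), U, hU, subset_rfl, hs⟩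

end Compact

/-! ### Units on open subsets of the spectrum of a factorial ring -/

section Factorial
open TopologicalSpace

variable {R : Type} [CommRing R]

lemma le_specOpen_iff {U : (Spec (.of R)).Opens} {a : R} :
    U ≤ specOpen a ↔ ∀ x : PrimeSpectrum R, x ∈ U → a ∉ x.asIdeal :=
  Iff.rfl

lemma specOpen_mul_le {U : (Spec (.of R)).Opens} {a b : R} :
    U ≤ specOpen (a * b) ↔ U ≤ specOpen a ∧ U ≤ specOpen b := by
  have h : specOpen (a * b) = specOpen a ⊓ specOpen b := PrimeSpectrum.basicOpen_mul a b
  rw [h, le_inf_iff]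

lemma le_specOpen_of_isUnit {U : (Spec (.of R)).Opens} {a : R} (h : IsUnit a) : U ≤ specOpen a :=
  fun x _ ↦ fun ha ↦ (x : PrimeSpectrum R).isPrime.ne_top (Ideal.eq_top_of_isUnit_mem _ ha h)

lemma exists_specFun_pow_mul {U : (Spec (.of R)).Opens} {a : R} (h : specOpen a ≤ U)
    (s : Γ(Spec (.of R), U)) :
    ∃ (k : ℕ) (b : R), specFun (specOpen a) b = specFun (specOpen a) a ^ k * res _ h s := by
  have ha : (Spec (.of R)).basicOpen (specFun ⊤ a) = specOpen a := by
    rw [specFun_top]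
    exact basicOpen_eq_of_affine (R := .of R) a
  obtain ⟨k, y, hy⟩ := exists_eq_pow_mul_of_isAffineOpen (Spec (.of R)) ⊤ (isAffineOpen_top _)
    (specFun ⊤ a) (res _ (ha.le.trans h) s)
  obtain ⟨b, rfl⟩ : ∃ b, specFun ⊤ b = y :=
    ⟨(Scheme.ΓSpecIso (.of R)).hom y, by rw [specFun_top]; exact Iso.hom_inv_id_apply (Scheme.ΓSpecIso (.of R)) y⟩
  refine ⟨k, b, ?_⟩
  have h' := congrArg (res _ ha.ge) hy
  change res _ ha.ge (res _ le_top (specFun ⊤ b)) = res _ ha.ge (res _ le_top (specFun ⊤ a) ^ k * _) at h'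
  rwa [map_mul, map_pow, res_res, res_res, res_res, res_specFun, res_specFun] at h'

lemma exists_specOpen_le {U : (Spec (.of R)).Opens} {x : Spec (.of R)} (hx : x ∈ U) :
    ∃ a : R, x ∈ specOpen a ∧ specOpen a ≤ U := by
  obtain ⟨_, ⟨_, ⟨a, rfl⟩, rfl⟩, hxa, ha⟩ :=
    (PrimeSpectrum.isBasis_basic_opens (R := R)).exists_subset_of_mem_open (a := x) hx U.isOpen
  exact ⟨_, hxa, ha⟩

/-- If both open subsets meet the irreducible closed set `p = 0`, both contain its generic point. -/
lemma le_or_le_specOpen {U₁ U₂ : (Spec (.of R)).Opens} {p : R} (hp : Prime p)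
    (h : U₁ ⊓ U₂ ≤ specOpen p) : U₁ ≤ specOpen p ∨ U₂ ≤ specOpen p := by
  by_contra! H
  let ξ : PrimeSpectrum R := ⟨Ideal.span {p}, (Ideal.span_singleton_prime hp.ne_zero).mpr hp⟩
  have key {U : (Spec (.of R)).Opens} (hU : ¬ U ≤ specOpen p) : (ξ : Spec (.of R)) ∈ U := by
    rw [le_specOpen_iff] at hU
    push Not at hU
    obtain ⟨x, hx, hpx⟩ := hU
    refine Specializes.mem_open ((PrimeSpectrum.le_iff_specializes ξ x).mp ?_) U.isOpen hx
    exact (Ideal.span_singleton_le_iff_mem _).mpr hpx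
  exact h (show ξ ∈ U₁ ⊓ U₂ from ⟨key H.1, key H.2⟩) (Ideal.mem_span_singleton_self p)

/-- Each prime factor is invertible on one of the two open subsets and is assigned to that one. -/
lemma exists_eq_mul_of_inf_le_specOpen [UniqueFactorizationMonoid R]
    {U₁ U₂ : (Spec (.of R)).Opens} {a : R} (ha : a ≠ 0) (h : U₁ ⊓ U₂ ≤ specOpen a) :
    ∃ a₁ a₂, a = a₁ * a₂ ∧ U₁ ≤ specOpen a₁ ∧ U₂ ≤ specOpen a₂ := by
  induction a using UniqueFactorizationMonoid.induction_on_prime with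
  | h₁ => exact (ha rfl).elim
  | h₂ a hu => exact ⟨a, 1, by simp, le_specOpen_of_isUnit hu, le_specOpen_of_isUnit isUnit_one⟩
  | h₃ a p ha' hp ih =>
    rw [specOpen_mul_le] at h
    obtain ⟨a₁, a₂, rfl, h₁, h₂⟩ := ih ha' h.2
    rcases le_or_le_specOpen hp h.1 with hp | hp
    · exact ⟨p * a₁, a₂, by ring, specOpen_mul_le.mpr ⟨hp, h₁⟩, h₂⟩
    · exact ⟨a₁, p * a₂, by ring, h₁, specOpen_mul_le.mpr ⟨hp, h₂⟩⟩

variable [IsDomain R]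

lemma specFun_injective {U : (Spec (.of R)).Opens} (hU : (U : Set (Spec (.of R))).Nonempty) :
    Function.Injective (specFun U) := by
  have : Nonempty U := hU.to_subtype
  have h₁ : Function.Injective (res (Spec (.of R)) (le_top : U ≤ ⊤)) :=
    map_injective_of_isIntegral (Spec (.of R)) (homOfLE (le_top : U ≤ ⊤))
  exact h₁.comp (ConcreteCategory.bijective_of_isIso (Scheme.ΓSpecIso (.of R)).inv).injective

variable [UniqueFactorizationMonoid R]

/-- Near a point the section is `r / cᵏ` with `c` nonzero there. Then `b r = a cᵏ`, so `b` divides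
`cᵏ` and cannot vanish at the point. -/
lemma le_specOpen_of_isRelPrime {U : (Spec (.of R)).Opens} {a b : R} (hab : IsRelPrime a b)
    {s : Γ(Spec (.of R), U)} (h : specFun U b * s = specFun U a) : U ≤ specOpen b := by
  intro x hx
  obtain ⟨c, hxc, hc⟩ := exists_specOpen_le hx
  obtain ⟨k, r, hr⟩ := exists_specFun_pow_mul hc s
  have h' := congrArg (res _ hc) h
  rw [map_mul, res_specFun, res_specFun] at h'
  have key : b * r = a * c ^ k := by
    apply specFun_injective (U := specOpen c) ⟨x, hxc⟩
    rw [map_mul, map_mul, map_pow, hr, ← h']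
    ring
  have hdvd : b ∣ c ^ k := hab.symm.dvd_of_dvd_mul_left ⟨r, key.symm⟩
  intro hb
  exact hxc ((x : PrimeSpectrum R).isPrime.mem_of_pow_mem k (Ideal.mem_of_dvd _ hdvd hb))

/-- On the spectrum of a factorial ring, units on the intersection of two open subsets are
quotients of units on the two subsets. -/
lemma exists_unit_mul_eq {U₁ U₂ : (Spec (.of R)).Opens} {s : Γ(Spec (.of R), U₁ ⊓ U₂)}
    (hs : IsUnit s) : ∃ (a : Γ(Spec (.of R), U₁)) (b : Γ(Spec (.of R), U₂)), IsUnit a ∧ IsUnit b ∧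
      res _ inf_le_right b * s = res _ inf_le_left a := by
  rcases (U₁ ⊓ U₂ : Set (Spec (.of R))).eq_empty_or_nonempty with hU | hU
  · have hU' : U₁ ⊓ U₂ = ⊥ := SetLike.coe_injective hU
    have : Subsingleton Γ(Spec (.of R), U₁ ⊓ U₂) := by
      rw [hU']
      infer_instance
    exact ⟨1, 1, isUnit_one, isUnit_one, Subsingleton.elim _ _⟩
  · have : Nonempty (U₁ ⊓ U₂ : (Spec (.of R)).Opens) := hU.to_subtype
    obtain ⟨x, hx⟩ := hU
    obtain ⟨c, hxc, hc⟩ := exists_specOpen_le (U := U₁ ⊓ U₂) hx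
    obtain ⟨k, r, hr⟩ := exists_specFun_pow_mul hc s
    have hr : specFun (U₁ ⊓ U₂) r = specFun (U₁ ⊓ U₂) (c ^ k) * s := by
      have : Nonempty (specOpen c) := ⟨x, hxc⟩
      apply map_injective_of_isIntegral (Spec (.of R)) (homOfLE hc)
      change res _ hc _ = res _ hc _
      rw [map_mul, res_specFun, res_specFun, map_pow, hr]
    have hc0 : c ^ k ≠ 0 := pow_ne_zero _ fun h ↦ hxc (by rw [h]; exact zero_mem _)
    -- Reduce the fraction `r / cᵏ` to lowest terms, `s = a / b`; both `a` and `b` are then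
    -- invertible on the intersection.
    obtain ⟨b, a, d, hab, hd, rfl⟩ := UniqueFactorizationMonoid.exists_reduced_factors _ hc0 r
    have hd0 : specFun (U₁ ⊓ U₂) d ≠ 0 := fun h ↦ hc0 (by
      rw [← hd, specFun_injective (U := U₁ ⊓ U₂) ⟨x, hx⟩ (h.trans (map_zero _).symm), zero_mul])
    have h₁ : specFun (U₁ ⊓ U₂) b * s = specFun (U₁ ⊓ U₂) a := by
      apply mul_left_cancel₀ hd0
      rw [← mul_assoc, ← map_mul, ← map_mul, hd, hr]
    obtain ⟨s, rfl⟩ := hs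
    have h₂ : specFun (U₁ ⊓ U₂) a * (s⁻¹ : Γ(Spec (.of R), U₁ ⊓ U₂)ˣ) = specFun (U₁ ⊓ U₂) b := by
      rw [← h₁, mul_assoc, Units.mul_inv, mul_one]
    have hb0 : b ≠ 0 := fun h ↦ hc0 (by rw [← hd, h, mul_zero])
    have ha0 : a ≠ 0 := fun h ↦ hb0 (by
      apply specFun_injective (U := U₁ ⊓ U₂) ⟨x, hx⟩
      rw [← h₂, h, map_zero, zero_mul])
    obtain ⟨b₁, b₂, rfl, hb₁, hb₂⟩ :=
      exists_eq_mul_of_inf_le_specOpen hb0 (le_specOpen_of_isRelPrime hab.symm h₁)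
    obtain ⟨a₁, a₂, rfl, ha₁, ha₂⟩ :=
      exists_eq_mul_of_inf_le_specOpen ha0 (le_specOpen_of_isRelPrime hab h₂)
    obtain ⟨w, hw⟩ := isUnit_specFun hb₁
    obtain ⟨z, hz⟩ := isUnit_specFun ha₂
    -- `s = (a₁ / b₁) (a₂ / b₂)`, where the first factor is a unit on `U₁` and the second on `U₂`.
    refine ⟨specFun U₁ a₁ * (w⁻¹ : Γ(Spec (.of R), U₁)ˣ), specFun U₂ b₂ *
      (z⁻¹ : Γ(Spec (.of R), U₂)ˣ), (isUnit_specFun ha₁).mul (Units.isUnit _),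
      (isUnit_specFun hb₂).mul (Units.isUnit _), ?_⟩
    have hw' := congrArg (res _ (inf_le_left : U₁ ⊓ U₂ ≤ U₁)) w.mul_inv
    have hz' := congrArg (res _ (inf_le_right : U₁ ⊓ U₂ ≤ U₂)) z.mul_inv
    rw [hw, map_mul, res_specFun, map_one] at hw'
    rw [hz, map_mul, res_specFun, map_one] at hz'
    rw [map_mul, map_mul] at h₁
    rw [map_mul, map_mul, res_specFun, res_specFun]
    set w' := res _ (inf_le_left : U₁ ⊓ U₂ ≤ U₁) (w⁻¹ : Γ(Spec (.of R), U₁)ˣ)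
    set z' := res _ (inf_le_right : U₁ ⊓ U₂ ≤ U₂) (z⁻¹ : Γ(Spec (.of R), U₂)ˣ)
    linear_combination w' * z' * h₁ - specFun (U₁ ⊓ U₂) b₂ * z' * s * hw' +
      specFun (U₁ ⊓ U₂) a₁ * w' * hz'

end Factorial

/-! ## The cohomology group of the sheaf of units on the surface -/

section Units
open Opposite TopologicalSpace

variable (S : Scheme.{0})

/-- The sections of the sheaf of units. -/
def unitsSection (U : S.Opens) : Additive Γ(S, U)ˣ ≃+ (unitsSheaf S).obj.obj (op U) :=
  AddEquiv.refl _

variable {S} {R : Type} [CommRing R] [IsDomain R] [UniqueFactorizationMonoid R]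

lemma exists_unit_mul_eq_of_isOpenImmersion (j : Spec (.of R) ⟶ S) [IsOpenImmersion j]
    {U₁ U₂ : S.Opens} (h₁ : U₁ ≤ j.opensRange) (h₂ : U₂ ≤ j.opensRange) {s : Γ(S, U₁ ⊓ U₂)}
    (hs : IsUnit s) : ∃ (a : Γ(S, U₁)) (b : Γ(S, U₂)), IsUnit a ∧ IsUnit b ∧
      res _ inf_le_right b * s = res _ inf_le_left a := by
  have hj (U : S.Opens) (hU : U ≤ j.opensRange) : Function.Bijective (j.app U) :=
    have := j.isIso_app U hU
    ConcreteCategory.bijective_of_isIso (j.app U)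
  have hj' (U : S.Opens) (hU : U ≤ j.opensRange) {s : Γ(S, U)} (h : IsUnit (j.app U s)) :
      IsUnit s :=
    have := j.isIso_app U hU
    isUnit_of_map_unit (j.app U).hom _ h
  have hres {U V : S.Opens} (h : U ≤ V) (h' : j ⁻¹ᵁ U ≤ j ⁻¹ᵁ V) (s : Γ(S, V)) :
      j.app U (res S h s) = res _ h' (j.app V s) :=
    ConcreteCategory.congr_hom (j.naturality (homOfLE h).op) s
  obtain ⟨a, b, ha, hb, h⟩ := exists_unit_mul_eq (U₁ := j ⁻¹ᵁ U₁) (U₂ := j ⁻¹ᵁ U₂)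
    (s := j.app (U₁ ⊓ U₂) s) (hs.map (j.app (U₁ ⊓ U₂)).hom)
  obtain ⟨a, rfl⟩ := (hj U₁ h₁).surjective a
  obtain ⟨b, rfl⟩ := (hj U₂ h₂).surjective b
  refine ⟨a, b, hj' U₁ h₁ ha, hj' U₂ h₂ hb, (hj _ (inf_le_left.trans h₁)).injective ?_⟩
  rw [map_mul, hres inf_le_right fun _ hx ↦ hx.2, hres inf_le_left fun _ hx ↦ hx.1]
  exact h

/-- The sheaf of units is acyclic on an open subset that is the spectrum of a factorial ring. -/
lemma liftsOn_unitsSheaf (j : Spec (.of R) ⟶ S) [IsOpenImmersion j] :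
    LiftsOn (X := S.toTopCat) (unitsSheaf S) j.opensRange := by
  refine liftsOn_of_isCompact _ (isAffineOpen_opensRange j).isCompact fun U₁ h₁ U₂ h₂ c ↦ ?_
  obtain ⟨s, rfl⟩ := (unitsSection S (U₁ ⊓ U₂)).surjective c
  obtain ⟨a, b, ⟨a, rfl⟩, ⟨b, rfl⟩, h⟩ :=
    exists_unit_mul_eq_of_isOpenImmersion j h₁ h₂ (s.toMul.isUnit)
  refine ⟨unitsSection S U₁ (.ofMul a), unitsSection S U₂ (.ofMul b), ?_⟩
  rw [eq_sub_iff_add_eq']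
  exact congrArg (unitsSection S (U₁ ⊓ U₂)) (congrArg Additive.ofMul (Units.ext h))

end Units

/-! ### Units on the charts and on the overlap -/

section Surface
open Opposite TopologicalSpace

lemma isUnit_of_bijective {A B : Type} [CommRing A] [CommRing B] {f : A →+* B}
    (hf : Function.Bijective f) {a : A} (h : IsUnit (f a)) : IsUnit a :=
  (isUnit_map_iff (RingEquiv.ofBijective f hf) a).mp h

lemma planeRing_eq_of_isUnit {P : PlaneRing} (h : IsUnit P) :
    ∃ z : ℂ, P = Polynomial.C (Polynomial.C z) := by
  obtain ⟨p, hp, rfl⟩ := Polynomial.isUnit_iff.mp h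
  obtain ⟨z, -, rfl⟩ := Polynomial.isUnit_iff.mp hp
  exact ⟨z, rfl⟩

/-- A unit of a polynomial ring over a domain is a constant, here a unit Laurent polynomial, hence a
monomial. -/
lemma overlapRing_eq_of_isUnit {P : OverlapRing} (h : IsUnit P) : ∃ (z : ℂ) (k : ℤ), IsUnit z ∧
    P = Polynomial.C (LaurentPolynomial.C z * LaurentPolynomial.T k) := by
  obtain ⟨p, ⟨u, rfl⟩, rfl⟩ := Polynomial.isUnit_iff.mp h
  obtain ⟨z, w, k, hzw, hz, -⟩ := laurent_eq_of_mul_eq_one u.mul_inv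
  exact ⟨z, k, IsUnit.of_mul_eq_one _ hzw, by rw [hz]⟩

lemma incl_C_C (z : ℂ) : incl (Polynomial.C (Polynomial.C z)) =
    Polynomial.C (LaurentPolynomial.C z) := by
  simp [incl]

lemma trans_C_C (d : ℕ) (c : ℂ[T;T⁻¹]) (z : ℂ) : trans d c (Polynomial.C (Polynomial.C z)) =
    Polynomial.C (LaurentPolynomial.C z) := by
  simp [trans]

/-- The unit `T` of the ring of Laurent polynomials. -/
def laurentUnit : ℂ[T;T⁻¹]ˣ := (LaurentPolynomial.isUnit_T 1).unit

lemma laurentUnit_zpow (k : ℤ) : ((laurentUnit ^ k : ℂ[T;T⁻¹]ˣ) : ℂ[T;T⁻¹]) =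
    LaurentPolynomial.T k := by
  rw [← LaurentPolynomial.eval₂_T LaurentPolynomial.C laurentUnit k]
  have h : LaurentPolynomial.eval₂ LaurentPolynomial.C laurentUnit = RingHom.id ℂ[T;T⁻¹] := by
    refine laurent_hom_ext (fun a ↦ LaurentPolynomial.eval₂_C _ _ _) ?_
    rw [LaurentPolynomial.eval₂_T, zpow_one]
    rfl
  rw [h, RingHom.id_apply]

/-- The first cohomology of the sheaf of units on an affine line bundle over `ℙ¹`. -/
lemma nonempty_H1Units_addEquiv (d : ℕ) (c : ℂ[T;T⁻¹]) :
    Nonempty (H1Units (AffineLineBundle d c) ≃+ ℤ) := by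
  let S := AffineLineBundle d c
  let V₀ := chartOpens d c 0
  let V₁ := chartOpens d c 1
  let f : ℂ[T;T⁻¹] →+* Γ(S, V₀ ⊓ V₁) := (overlapSection d c).comp Polynomial.C
  have hf : Function.Injective f := (overlapSection_bijective d c).injective.comp
    Polynomial.C_injective
  let c₀ := Units.map f.toMonoidHom laurentUnit
  have hc₀ (k : ℤ) : ((c₀ ^ k : Γ(S, V₀ ⊓ V₁)ˣ) : Γ(S, V₀ ⊓ V₁)) = f (LaurentPolynomial.T k) := by
    rw [← map_zpow, Units.coe_map, laurentUnit_zpow]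
    rfl
  refine nonempty_H_one_addEquiv (X := S.toTopCat) (unitsSheaf S) (chartOpens_sup d c)
    (liftsOn_unitsSheaf (bundleChart d c 0)) (liftsOn_unitsSheaf (bundleChart d c 1))
    (unitsSection S (V₀ ⊓ V₁) (.ofMul c₀)) (fun x ↦ ?_) fun k a b h ↦ ?_
  · obtain ⟨u, rfl⟩ := (unitsSection S (V₀ ⊓ V₁)).surjective x
    obtain ⟨P, hP⟩ := (overlapSection_bijective d c).surjective (u.toMul : Γ(S, V₀ ⊓ V₁))
    have hP' : IsUnit P :=
      isUnit_of_bijective (overlapSection_bijective d c) (hP ▸ u.toMul.isUnit)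
    -- The unit is `z uᵏ`: the power of `u` is `k` times the generating class, and the constant `z`
    -- extends to the first chart.
    obtain ⟨z, k, hz, rfl⟩ := overlapRing_eq_of_isUnit hP'
    obtain ⟨a, ha⟩ := hz.map ((chartSection d c 0).comp (Polynomial.C.comp Polynomial.C))
    refine ⟨k, unitsSection S V₀ (.ofMul a), 0, ?_⟩
    rw [map_zero, sub_zero]
    have h : u.toMul = c₀ ^ k * Units.map (res S inf_le_left).toMonoidHom a := Units.ext ?_
    · exact congrArg (fun v ↦ unitsSection S (V₀ ⊓ V₁) (.ofMul v)) h
    rw [← hP, Units.val_mul, hc₀, mul_comm (LaurentPolynomial.C z), map_mul, map_mul]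
    refine congrArg (f (LaurentPolynomial.T k) * ·) ?_
    rw [← incl_C_C, ← res_chartSection_zero]
    exact (congrArg (res S inf_le_left) ha).symm
  · obtain ⟨a, rfl⟩ := (unitsSection S V₀).surjective a
    obtain ⟨b, rfl⟩ := (unitsSection S V₁).surjective b
    rw [eq_sub_iff_add_eq] at h
    have h' : c₀ ^ k * Units.map (res S inf_le_right).toMonoidHom b.toMul =
      Units.map (res S inf_le_left).toMonoidHom a.toMul :=
      Additive.ofMul.injective ((unitsSection S (V₀ ⊓ V₁)).injective h)
    have hsection (i : Fin 2) (u : Γ(S, chartOpens d c i)ˣ) : ∃ z : ℂ, z ≠ 0 ∧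
        chartSection d c i (Polynomial.C (Polynomial.C z)) = u := by
      obtain ⟨P, hP⟩ := (chartSection_bijective d c i).surjective u
      have hP' : IsUnit P := isUnit_of_bijective (chartSection_bijective d c i) (hP ▸ u.isUnit)
      obtain ⟨z, rfl⟩ := planeRing_eq_of_isUnit hP'
      refine ⟨z, fun hz ↦ ?_, hP⟩
      rw [hz, map_zero, map_zero] at hP'
      exact not_isUnit_zero hP'
    obtain ⟨z, hz, hz'⟩ := hsection 0 a.toMul
    obtain ⟨w, hw, hw'⟩ := hsection 1 b.toMul
    have h₁ : res S inf_le_right (b.toMul : Γ(S, V₁)) = f (LaurentPolynomial.C w) :=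
      (congrArg (res S inf_le_right) hw').symm.trans ((res_chartSection_one d c _).trans
        (congrArg (overlapSection d c) (trans_C_C d c w)))
    have h₂ : res S inf_le_left (a.toMul : Γ(S, V₀)) = f (LaurentPolynomial.C z) :=
      (congrArg (res S inf_le_left) hz').symm.trans ((res_chartSection_zero d c _).trans
        (congrArg (overlapSection d c) (incl_C_C z)))
    have h₃ : f (LaurentPolynomial.T k) * res S inf_le_right (b.toMul : Γ(S, V₁)) =
        res S inf_le_left (a.toMul : Γ(S, V₀)) := by
      rw [← hc₀]
      exact congrArg Units.val h'
    rw [h₁, h₂, ← map_mul, mul_comm] at h₃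
    -- Units on the charts are constants, so `uᵏ` times a constant is a constant and the degrees
    -- give `k = 0`.
    have h₄ := congrArg LaurentPolynomial.degree (hf h₃)
    rw [LaurentPolynomial.degree_C_mul_T _ _ hw, LaurentPolynomial.degree_C hz] at h₄
    exact WithBot.coe_injective h₄

end Surface

/-- A commutative group generated by an element of infinite order is isomorphic to `ℤ`. -/
theorem nonempty_mulEquiv_int_of_zpowers {G : Type*} [CommGroup G] {g : G}
    (hg : Subgroup.zpowers g = ⊤) (hg' : ∀ k : ℤ, g ^ k = 1 → k = 0) :
    Nonempty (G ≃* Multiplicative ℤ) := by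
  refine ⟨(MulEquiv.ofBijective (zpowersHom G g) ⟨?_, fun x ↦ ?_⟩).symm⟩
  · rw [injective_iff_map_eq_one]
    intro k hk
    exact hg' k.toAdd (by simpa [zpowersHom_apply] using hk)
  · obtain ⟨k, rfl⟩ := Subgroup.mem_zpowers_iff.1 (hg ▸ Subgroup.mem_top x)
    exact ⟨Multiplicative.ofAdd k, by simp [zpowersHom_apply]⟩

end FactorialThreefold

end

theorem mainTheorem4 (m n : ℕ) (hm : 1 ≤ m) (hn : 1 ≤ n) :
    ∃ _ : IsAffine (Surface (m + n) m),
      (∃ ρ : Surface (m + n) m ⟶ ProjLine, IsOMinusTorsor ρ) ∧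
      Nonempty (Pic (Surface (m + n) m) ≃* Multiplicative (H1Units (Surface (m + n) m))) ∧
      Nonempty (H1Units (Surface (m + n) m) ≃+ ℤ) ∧
      ∃ q : Threefold m n ⟶ Surface (m + n) m,
        q ≫ AffineLineBundle.toSpec (m + n) (LaurentPolynomial.T m) = Threefold.toSpec m n ∧
        IsGeometricQuotient (act m n) (proj m n) q ∧
        IsPrincipalBundle (act m n) (proj m n) q ∧
        ∃ L : Pic (Surface (m + n) m),
          IsClassOfBundle (act m n) (proj m n) (scaling m n) q L ∧
          Subgroup.zpowers L = ⊤ := by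
  have hA : IsAffine (Surface (m + n) m) := isAffine_surface hm hn
  obtain ⟨q, hq⟩ := exists_isQuotientMorphism hm hn
  have hp := hq.isPrincipalBundle hm hn
  have hg := hp.isGeometricQuotient
  obtain ⟨L, hL, hL', hL''⟩ := exists_isClassOfBundle hm hn hg
  obtain ⟨e⟩ := nonempty_H1Units_addEquiv (m + n) (LaurentPolynomial.T m)
  obtain ⟨e'⟩ := nonempty_mulEquiv_int_of_zpowers hL' hL''
  -- `Pic` and `H¹` are each isomorphic to `ℤ`, which gives the isomorphism between them.
  exact ⟨hA, exists_isOMinusTorsor _ _, ⟨e'.trans (AddEquiv.toMultiplicative e).symm⟩, ⟨e⟩,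
    q, hq.comp_toSpec hm hn, hg, hp, L, hL, hL'⟩
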